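/- Let $X=\mathbb R$ or $X=\mathbb T=\mathbb R/2\pi\mathbb Z$, let $s<3/2$, and let $H^s=H^s(X)$ be the Sobolev space of real-valued distributions, with norm $\|f\|_{H^s}^2=\int_{\mathbb R}(1+\xi^2)^s|\hat f(\xi)|^2\,d\xi$, respectively $\sum_{n\in\mathbb Z}(1+n^2)^s|\hat f(n)|^2$. Consider the Cauchy problem for the Novikov equation $$u_t+u^2u_x+\partial_xD^{-2}\Big[u^3+\tfrac32uu_x^2\Big]+D^{-2}\Big[\tfrac12u_x^3\Big]=0,\qquad u(0)=u_0\in H^s,\qquad D^{-2}=(1-\partial_x^2)^{-1},$$ where a solution on $[0,T]$, $T>0$, is a $u\in C([0,T];H^s)$ that on $(0,T)\times X$ is given by a function in $L^3((0,T);W^{1,3}(X))$ (so that all terms are defined) and satisfies the equation in the sense of distributions there. The problem is ill-posed in $H^s$ in the sense of Hadamard, both on $\mathbb R$ and on $\mathbb T$: it is not the case that solutions are unique and that every datum has a neighbourhood on which there is a continuous data-to-solution map $u_0\mapsto u\in C([0,T];H^s)$ with a common $T>0$. More precisely, the following holds on $\mathbb R$ and on $\mathbb T$. 1. If $5/4<s<3/2$,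 there is norm inflation: for every $\varepsilon>0$ there are $0<T<\varepsilon$ and $u\in C([0,T);H^s)$, a solution on $[0,T']$ for every $0<T'<T$, such that $\|u(0)\|_{H^s}<\varepsilon$ and $\lim_{t\to T^-}\|u(t)\|_{H^s}=\infty$. Hence the data-to-solution map is not continuous at the zero solution: for every $T>0$ it is false that for every $\varepsilon>0$ there is a $\delta>0$ such that every solution $v$ on some $[0,T']$, $0<T'\le T$, with $\|v(0)\|_{H^s}<\delta$ satisfies $\|v(t)\|_{H^s}<\varepsilon$ for all $t\in[0,T']$. 2. If $s<5/4$, uniqueness fails: for some $T>0$ there are two different solutions on $[0,T]$ with the same initial value. 3. If $s=5/4$, then either uniqueness fails in the same sense, or continuity fails: there is a datum $w\in H^s$ such that for no $T>0$ and no neighbourhood $B$ of $w$ in $H^s$ is there a continuous map $B\to C([0,T];H^s)$ that sends each datum in $B$ to a solution on $[0,T]$ with this datum. -/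

import Mathlib

open MeasureTheory Set Filter Topology
open scoped ENNReal ContDiff SchwartzMap

noncomputable section

/-! ### Real Sobolev spaces of arbitrary order, on the Fourier side -/

/-- The measure `(1 + |ξ|²)^s dν(ξ)` on a frequency space `Ξ`; the map `j` reads a frequency as a
real number. -/
def freqMeasure {Ξ : Type} [MeasurableSpace Ξ] (ν : Measure Ξ) (j : Ξ → ℝ) (s : ℝ) : Measure Ξ :=
  ν.withDensity fun ξ => ENNReal.ofReal ((1 + j ξ ^ 2) ^ s)

theorem ae_of_ae_freqMeasure {Ξ : Type} [MeasurableSpace Ξ] (ν : Measure Ξ) {j : Ξ → ℝ}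
    (hj : Measurable j) (s : ℝ) {p : Ξ → Prop} (h : ∀ᵐ ξ ∂(freqMeasure ν j s), p ξ) :
    ∀ᵐ ξ ∂ν, p ξ := by
  refine (withDensity_absolutelyContinuous' (μ := ν) ?_ ?_).ae_le h
  · exact (((hj.pow_const 2).const_add 1).pow_const s).ennreal_ofReal.aemeasurable
  · refine Eventually.of_forall fun ξ => ?_
    have h0 : (0 : ℝ) < (1 + j ξ ^ 2) ^ s := Real.rpow_pos_of_pos (by positivity) s
    simpa using h0

/-- The elements `F` of the weighted `L²` space that are Fourier transforms of real-valued
distributions: `F(-ξ)` is the complex conjugate of `F(ξ)`. The norm is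
`(∫ (1 + |ξ|²)^s |F(ξ)|² dν(ξ))^(1/2)`. -/
def realSobolev {Ξ : Type} [MeasurableSpace Ξ] [AddGroup Ξ] [MeasurableNeg Ξ] (ν : Measure Ξ)
    [ν.IsNegInvariant] (j : Ξ → ℝ) (hj : Measurable j) (s : ℝ) :
    AddSubgroup (Lp ℂ 2 (freqMeasure ν j s)) where
  carrier := {F | ∀ᵐ ξ ∂ν, F (-ξ) = star (F ξ)}
  zero_mem' := by
    have h := ae_of_ae_freqMeasure ν hj s (Lp.coeFn_zero ℂ 2 (freqMeasure ν j s))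
    have h' := (Measure.measurePreserving_neg ν).quasiMeasurePreserving.ae h
    filter_upwards [h, h'] with ξ h1 h2
    rw [h1, h2]; simp
  add_mem' := by
    intro F G hF hG
    change ∀ᵐ ξ ∂ν, (F + G) (-ξ) = star ((F + G) ξ)
    change ∀ᵐ ξ ∂ν, F (-ξ) = star (F ξ) at hF
    change ∀ᵐ ξ ∂ν, G (-ξ) = star (G ξ) at hG
    have h := ae_of_ae_freqMeasure ν hj s (Lp.coeFn_add F G)
    have h' := (Measure.measurePreserving_neg ν).quasiMeasurePreserving.ae h
    filter_upwards [h, h', hF, hG] with ξ h1 h2 h3 h4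
    rw [h1, h2]; simp [h3, h4]
  neg_mem' := by
    intro F hF
    change ∀ᵐ ξ ∂ν, (-F) (-ξ) = star ((-F) ξ)
    change ∀ᵐ ξ ∂ν, F (-ξ) = star (F ξ) at hF
    have h := ae_of_ae_freqMeasure ν hj s (Lp.coeFn_neg F)
    have h' := (Measure.measurePreserving_neg ν).quasiMeasurePreserving.ae h
    filter_upwards [h, h', hF] with ξ h1 h2 h3
    rw [h1, h2]; simp [h3]

/-- The real Sobolev space `H^s(ℝ)`: a distribution is represented by its Fourier transform, an
element of `L²(ℝ, (1 + ξ²)^s dξ)`. -/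
abbrev HsLine (s : ℝ) : Type := realSobolev (volume : Measure ℝ) (fun ξ => ξ) measurable_id s

/-- The real Sobolev space `H^s(𝕋)`, `𝕋 = ℝ/2πℤ`: a distribution is represented by the sequence
of its Fourier coefficients, an element of the space `ℓ²(ℤ)` with weights `(1 + n²)^s`. -/
abbrev HsCircle (s : ℝ) : Type :=
  realSobolev (Measure.count : Measure ℤ) (fun n => (n : ℝ)) (measurable_of_countable _) s

/-- `F` is the Fourier transform of `f`, `F(ξ) = ∫ e^{-ixξ} f(x) dx`, in the sense of tempered
distributions. -/
def IsLineFourier (f : ℝ → ℝ) (F : ℝ → ℂ) : Prop :=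
  ∀ φ : 𝓢(ℝ, ℂ),
    ∫ x : ℝ, (f x : ℂ) * (∫ ξ : ℝ, Complex.exp (-(Complex.I * x * ξ)) * φ ξ) = ∫ ξ : ℝ, F ξ * φ ξ

/-- `F(n)` is the `n`-th Fourier coefficient of the `2π`-periodic function `f`. -/
def IsCircleFourier (f : ℝ → ℝ) (F : ℤ → ℂ) : Prop :=
  ∀ n : ℤ, F n = (2 * Real.pi : ℂ)⁻¹ *
    ∫ x in Ioc 0 (2 * Real.pi), Complex.exp (-(Complex.I * n * x)) * (f x : ℂ)

/-! ### The Novikov equation in the sense of distributions -/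

/-- The Green function of `1 - ∂ₓ²` on the line. -/
def lineKernel (x : ℝ) : ℝ := Real.exp (-|x|) / 2

/-- The Green function of `1 - ∂ₓ²` on the circle of length `2π`. -/
def circleKernel (x : ℝ) : ℝ :=
  Real.cosh (x - 2 * Real.pi * ⌊x / (2 * Real.pi)⌋ - Real.pi) / (2 * Real.sinh Real.pi)

/-- The Bessel potential `D⁻² f = (1 - ∂ₓ²)⁻¹ f`, where `G` is the Green function and `X` a
fundamental domain. -/
def invD2 (X : Set ℝ) (G : ℝ → ℝ) (f : ℝ → ℝ) (x : ℝ) : ℝ := ∫ y in X, G (x - y) * f y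

/-- Smooth functions with compact support in `(0,T) × ℝ`. -/
def IsLineTest (T : ℝ) (φ : ℝ → ℝ → ℝ) : Prop :=
  ContDiff ℝ ∞ (fun z : ℝ × ℝ => φ z.1 z.2) ∧
  ∃ a b R : ℝ, 0 < a ∧ b < T ∧ ∀ t x, φ t x ≠ 0 → t ∈ Icc a b ∧ |x| ≤ R

/-- Smooth functions with compact support in `(0,T) × 𝕋`. -/
def IsCircleTest (T : ℝ) (φ : ℝ → ℝ → ℝ) : Prop :=
  ContDiff ℝ ∞ (fun z : ℝ × ℝ => φ z.1 z.2) ∧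
  (∀ t, Function.Periodic (φ t) (2 * Real.pi)) ∧
  ∃ a b : ℝ, 0 < a ∧ b < T ∧ ∀ t x, φ t x ≠ 0 → t ∈ Icc a b

/-- `u` belongs to `L³((0,T); W^{1,3})`, has the weak derivative `u_x = v`, and solves
`u_t + u² u_x + ∂ₓ D⁻²[u³ + (3/2) u u_x²] + D⁻²[(1/2) u_x³] = 0`
in the sense of distributions on `(0,T) × X`. The first argument of `u` and `v` is the time. -/
structure IsWeakNovikov (X : Set ℝ) (G : ℝ → ℝ) (Test : (ℝ → ℝ → ℝ) → Prop) (T : ℝ)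
    (u v : ℝ → ℝ → ℝ) : Prop where
  memLp_u : MemLp (fun z : ℝ × ℝ => u z.1 z.2) 3 (volume.restrict (Ioo 0 T ×ˢ X))
  memLp_v : MemLp (fun z : ℝ × ℝ => v z.1 z.2) 3 (volume.restrict (Ioo 0 T ×ˢ X))
  weakDeriv : ∀ φ, Test φ →
    ∫ z in Ioo 0 T ×ˢ X, u z.1 z.2 * deriv (φ z.1) z.2 = - ∫ z in Ioo 0 T ×ˢ X, v z.1 z.2 * φ z.1 z.2
  equation : ∀ φ, Test φ →
    ∫ z in Ioo 0 T ×ˢ X,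
      (- u z.1 z.2 * deriv (fun τ => φ τ z.2) z.1
        + u z.1 z.2 ^ 2 * v z.1 z.2 * φ z.1 z.2
        - invD2 X G (fun y => u z.1 y ^ 3 + 3 / 2 * u z.1 y * v z.1 y ^ 2) z.2 * deriv (φ z.1) z.2
        + invD2 X G (fun y => 1 / 2 * v z.1 y ^ 3) z.2 * φ z.1 z.2) = 0

/-- `U ∈ C([0,T]; H^s(ℝ))` is a solution of the Novikov equation on the line. -/
def LineSolution (s T : ℝ) (U : ℝ → HsLine s) : Prop :=
  ContinuousOn U (Icc 0 T) ∧
  ∃ u v : ℝ → ℝ → ℝ, IsWeakNovikov univ lineKernel (IsLineTest T) T u v ∧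
    ∀ᵐ t ∂(volume.restrict (Ioo 0 T)), IsLineFourier (u t) (U t).1

/-- `U ∈ C([0,T]; H^s(𝕋))` is a solution of the Novikov equation on the circle. -/
def CircleSolution (s T : ℝ) (U : ℝ → HsCircle s) : Prop :=
  ContinuousOn U (Icc 0 T) ∧
  ∃ u v : ℝ → ℝ → ℝ,
    (∀ t, Function.Periodic (u t) (2 * Real.pi)) ∧ (∀ t, Function.Periodic (v t) (2 * Real.pi)) ∧
    IsWeakNovikov (Ioc 0 (2 * Real.pi)) circleKernel (IsCircleTest T) T u v ∧
    ∀ᵐ t ∂(volume.restrict (Ioo 0 T)), IsCircleFourier (u t) (U t).1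

/-! ### Well-posedness notions

Here `Sol T U` says that `U` is a solution on the time interval `[0,T]`, with initial value `U 0`,
in the space `H`. -/

section

variable {H : Type} [NormedAddCommGroup H]

/-- Two solutions on `[0,T]` with the same initial value agree on `[0,T]`. -/
def UniqueSolutions (Sol : ℝ → (ℝ → H) → Prop) : Prop :=
  ∀ T > 0, ∀ U V : ℝ → H, Sol T U → Sol T V → U 0 = V 0 → ∀ t ∈ Icc 0 T, U t = V t

/-- Near every initial value there is a continuous map that sends an initial value to a solution
in `C([0,T]; H)`, for a common `T > 0`. -/
def HasContinuousSolutionMap (Sol : ℝ → (ℝ → H) → Prop) : Prop :=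
  ∀ u₀ : H, ∃ T > 0, ∃ r > 0, ∃ S : H → ℝ → H,
    (∀ w ∈ Metric.ball u₀ r, Sol T (S w) ∧ S w 0 = w) ∧
    ∀ w ∈ Metric.ball u₀ r, ∀ ε > 0, ∃ δ > 0, ∀ w' ∈ Metric.ball u₀ r, ‖w' - w‖ < δ →
      ∀ t ∈ Icc 0 T, ‖S w' t - S w t‖ < ε

/-- Well-posedness in the sense of Hadamard: local existence, uniqueness, continuity of the
data-to-solution map. -/
def WellPosed (Sol : ℝ → (ℝ → H) → Prop) : Prop :=
  UniqueSolutions Sol ∧ HasContinuousSolutionMap Sol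

/-- Continuity of the (possibly multivalued) map from data to solutions at the solution `U` on
`[0,T]`: solutions whose data are close to `U 0` stay close to `U` as long as they exist. -/
def SolutionMapContinuousAt (Sol : ℝ → (ℝ → H) → Prop) (T : ℝ) (U : ℝ → H) : Prop :=
  ∀ ε > 0, ∃ δ > 0, ∀ T' ∈ Ioc 0 T, ∀ V : ℝ → H, Sol T' V → ‖V 0 - U 0‖ < δ →
    ∀ t ∈ Icc 0 T', ‖V t - U t‖ < ε

/-- Norm inflation: arbitrarily small data, and solutions in `C([0,T); H)` with arbitrarily small
`T > 0` whose norm tends to infinity as `t → T`. -/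
def NormInflation (Sol : ℝ → (ℝ → H) → Prop) : Prop :=
  ∀ ε > 0, ∃ T : ℝ, 0 < T ∧ T < ε ∧ ∃ U : ℝ → H, (∀ T' ∈ Ioo 0 T, Sol T' U) ∧ ‖U 0‖ < ε ∧
    Tendsto (fun t => ‖U t‖) (𝓝[<] T) atTop

end

end

/-! The counterexamples are superpositions of two peakons, $u=p_1k(x-q_1)+p_2k(x-q_2)$, where $k=2G$
and $G$ is the Green function of $1-\partial_x^2$. Since $k''=k$ off the crest, the equation reduces
to ordinary differential equations for the amplitudes and positions (`TwoPeakonFlow`). In the weak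
form, the pairing of $u$ with a test function $\varphi$ is
$2p_1(D^{-2}\varphi)(q_1)+2p_2(D^{-2}\varphi)(q_2)$. Once the potentials are moved onto $\varphi$,
the remaining terms are exact derivatives between the crests (`hasDerivAt_boundaryTerm`), so only
jumps at the crests are left; the peakon equations say that they balance the time derivative of the
pairing (`PeakonGeometry.isWeakNovikov`).

The system is integrable. Put $r=q_2-q_1$, $c=k(0)$, $a=k(r)$. The quantities $p_1^2p_2^2(c^2-a^2)$
and $c(p_1+p_2)^2-2(c-a)p_1p_2$ are conserved, so they determine the amplitudes from $r$, and
$r'=(c^2-a^2)(p_2-p_1)(p_2+p_1)$. For amplitudes of opposite sign, $c^2-a^2\sim r$ gives $|p_i|\sim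
r^{-1/4}$ and $r'\sim r^{3/4}$ as $r\to0$. The exponent is below one, so $r$ can leave the
equilibrium $0$ in finite time: a single peakon splits into a pair (`exists_emanating_pair`). The
symmetry $(t,x)\mapsto(-t,-x)$ turns splitting into collision.

On the Fourier side, $k(\cdot-q_2)-k(\cdot-q_1)$ has $H^s$ norm at least a constant times
$r^{3/2-s}$ for $r\le1/2$, and at most a constant times $r^\theta$ for any admissible
$\theta<3/2-s$. The pair is a peakon of amplitude $p_1+p_2$, which stays bounded, plus a dipole
$p_2(k(\cdot-q_2)-k(\cdot-q_1))$, which thus has critical size $r^{5/4-s}$.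

For $s<5/4$ the dipole tends to zero at the splitting time, so the splitting pair and the peakon
that travels on unchanged are two solutions with the same datum (`not_uniqueSolutions`). For $s>5/4$
the norm of a colliding pair tends to infinity, while a suitable choice of the conserved quantities
makes both its datum and its lifetime small. For $s=5/4$ the colliding pair has no limit: mode by
mode its Fourier transform converges to that of a single peakon, the only candidate, but the dipole
keeps a norm bounded away from zero (`exists_colliding_pair`). Well-posedness near zero would
provide a continuous solution beyond the collision time, equal to the pair before it; this is a
contradiction whenever $s\ge5/4$ (`ill_posed`).

The structures `FreqScale`, `AdmitsPeakons` and `PeakonGeometry` isolate what is needed of the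
domain. The line has $c=1$, the circle $c=\coth\pi$. -/

noncomputable section

/-! ### Peakons in Sobolev spaces -/

section Frequency

variable {Ξ : Type}

/-- The properties of the frequency spaces `ℝ` and `ℤ` that the Sobolev estimates use. -/
structure FreqScale [MeasurableSpace Ξ] [Neg Ξ] (ν : Measure Ξ) (j : Ξ → ℝ) : Prop where
  meas : Measurable j
  map_neg : ∀ ξ, j (-ξ) = -j ξ
  integrable : ∀ r : ℝ, 1 / 2 < r → Integrable (fun ξ => (1 + j ξ ^ 2) ^ (-r)) ν
  -- Lower bounds in $H^s$ come from a single dyadic block of frequencies, which must have mass of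
  -- order $R$.
  dyadic : ∃ c > 0, ∀ R : ℝ, 2 ≤ R → ENNReal.ofReal (c * R) ≤ ν {ξ | R ≤ j ξ ∧ j ξ ≤ 2 * R}
  -- This recovers the total amplitude from frequency zero, also on the line, where that frequency
  -- is a null set.
  eval_zero : ∀ f : ℝ → ℂ, Continuous f → (∀ᵐ ξ ∂ν, f (j ξ) = 0) → f 0 = 0

theorem norm_sq_freqMeasure [MeasurableSpace Ξ] {ν : Measure Ξ} {j : Ξ → ℝ} (hj : Measurable j) {s : ℝ}
    (F : Lp ℂ 2 (freqMeasure ν j s)) :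
    ‖F‖ ^ 2 = ∫ ξ, (1 + j ξ ^ 2) ^ s * ‖F ξ‖ ^ 2 ∂ν := by
  have h1 : ‖F‖ ^ 2 = ∫ ξ, ‖F ξ‖ ^ 2 ∂(freqMeasure ν j s) := by
    have h := L2.inner_def (𝕜 := ℂ) F F
    rw [inner_self_eq_norm_sq_to_K] at h
    have h2 : ∀ ξ, inner ℂ (F ξ) (F ξ) = ((‖F ξ‖ ^ 2 : ℝ) : ℂ) := fun ξ => by
      rw [inner_self_eq_norm_sq_to_K]; norm_cast
    simp only [h2] at h
    rw [integral_complex_ofReal] at h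
    refine Complex.ofReal_injective ((Complex.ofReal_pow _ _).trans ?_)
    exact h
  rw [h1]
  refine (integral_withDensity_eq_integral_toReal_smul
    (((hj.pow_const 2).const_add 1).pow_const s).ennreal_ofReal
    (Eventually.of_forall fun _ => ENNReal.ofReal_lt_top) (fun ξ => ‖F ξ‖ ^ 2)).trans ?_
  refine integral_congr_ae (Eventually.of_forall fun ξ => ?_)
  have h0 : (0 : ℝ) ≤ (1 + j ξ ^ 2) ^ s := by positivity
  simp [ENNReal.toReal_ofReal h0]

/-- The Fourier transform of the peakon at `q`, up to the factor `κ` that normalizes it. -/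
def peakonSymbol (κ : ℝ) (j : Ξ → ℝ) (q : ℝ) (ξ : Ξ) : ℂ :=
  ((κ / (1 + j ξ ^ 2) : ℝ) : ℂ) * Complex.exp (-(Complex.I * q * j ξ))

theorem norm_peakonSymbol (κ : ℝ) (j : Ξ → ℝ) (q : ℝ) (ξ : Ξ) :
    ‖peakonSymbol κ j q ξ‖ = |κ| / (1 + j ξ ^ 2) := by
  have h : -(Complex.I * q * j ξ) = Complex.I * ((-(q * j ξ) : ℝ) : ℂ) := by push_cast; ring
  rw [peakonSymbol, norm_mul, h, Complex.norm_exp_I_mul_ofReal, mul_one, Complex.norm_real,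
    Real.norm_eq_abs, abs_div, abs_of_pos (a := 1 + j ξ ^ 2) (by positivity)]

theorem norm_peakonSymbol_sub (κ : ℝ) (j : Ξ → ℝ) (q r : ℝ) (ξ : Ξ) :
    ‖peakonSymbol κ j q ξ - peakonSymbol κ j r ξ‖
      = |κ| / (1 + j ξ ^ 2) * |2 * Real.sin ((q - r) * j ξ / 2)| := by
  have h : peakonSymbol κ j q ξ - peakonSymbol κ j r ξ
      = -(peakonSymbol κ j q ξ * (Complex.exp (Complex.I * (((q - r) * j ξ : ℝ) : ℂ)) - 1)) := by
    have : Complex.exp (-(Complex.I * r * j ξ)) = Complex.exp (-(Complex.I * q * j ξ)) *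
        Complex.exp (Complex.I * (((q - r) * j ξ : ℝ) : ℂ)) := by
      rw [← Complex.exp_add]; congr 1; push_cast; ring
    simp only [peakonSymbol, this]; ring
  rw [h, norm_neg, norm_mul, norm_peakonSymbol, Complex.norm_exp_I_mul_ofReal_sub_one,
    Real.norm_eq_abs]

variable [MeasurableSpace Ξ]

theorem measurable_peakonSymbol (κ : ℝ) {j : Ξ → ℝ} (hj : Measurable j) (q : ℝ) :
    Measurable (peakonSymbol κ j q) := by
  unfold peakonSymbol
  fun_prop

/-- The weight times the squared symbol is $\kappa^2(1+\xi^2)^{s-2}$, and $2-s>1/2$ is the condition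
$s<3/2$. -/
theorem FreqScale.memLp [Neg Ξ] {ν : Measure Ξ} {j : Ξ → ℝ} (hF : FreqScale ν j) {s : ℝ}
    (hs : s < 3 / 2) (κ q : ℝ) : MemLp (peakonSymbol κ j q) 2 (freqMeasure ν j s) := by
  refine (memLp_two_iff_integrable_sq_norm
    (measurable_peakonSymbol κ hF.meas q).aestronglyMeasurable).2 ?_
  rw [freqMeasure, integrable_withDensity_iff_integrable_smul'
    (((hF.meas.pow_const 2).const_add 1).pow_const s).ennreal_ofReal
    (Eventually.of_forall fun _ => ENNReal.ofReal_lt_top)]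
  refine ((hF.integrable (2 - s) (by linarith)).const_mul (κ ^ 2)).congr
    (Eventually.of_forall fun ξ => ?_)
  have hpos : (0 : ℝ) < 1 + j ξ ^ 2 := by positivity
  have h0 : (0 : ℝ) ≤ (1 + j ξ ^ 2) ^ s := by positivity
  simp only [norm_peakonSymbol, ENNReal.toReal_ofReal h0, smul_eq_mul]
  rw [div_pow, sq_abs, neg_sub, Real.rpow_sub hpos, Real.rpow_two]
  ring

/-- The peakon at `q`, as an element of the weighted `L²` space. -/
def peakonLp [Neg Ξ] {ν : Measure Ξ} {j : Ξ → ℝ} (hF : FreqScale ν j) {s : ℝ} (hs : s < 3 / 2)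
    (κ q : ℝ) : Lp ℂ 2 (freqMeasure ν j s) := (hF.memLp hs κ q).toLp _

variable [Neg Ξ] {ν : Measure Ξ} {j : Ξ → ℝ} (hF : FreqScale ν j) {s : ℝ} (hs : s < 3 / 2) (κ : ℝ)

theorem coeFn_peakonLp (q : ℝ) : ∀ᵐ ξ ∂ν, peakonLp hF hs κ q ξ = peakonSymbol κ j q ξ :=
  ae_of_ae_freqMeasure ν hF.meas s (MemLp.coeFn_toLp _)

/-! ### Norms of differences of translated peakons -/

theorem norm_sq_peakonLp_sub (q r : ℝ) :
    ‖peakonLp hF hs κ q - peakonLp hF hs κ r‖ ^ 2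
      = ∫ ξ, κ ^ 2 * ((1 + j ξ ^ 2) ^ (s - 2) * (2 * Real.sin ((q - r) * j ξ / 2)) ^ 2) ∂ν := by
  rw [norm_sq_freqMeasure hF.meas]
  refine integral_congr_ae ?_
  filter_upwards [coeFn_peakonLp hF hs κ q, coeFn_peakonLp hF hs κ r,
    ae_of_ae_freqMeasure ν hF.meas s
      (Lp.coeFn_sub (peakonLp hF hs κ q) (peakonLp hF hs κ r))] with ξ h1 h2 h3
  have hpos : (0 : ℝ) < 1 + j ξ ^ 2 := by positivity
  rw [h3, Pi.sub_apply, h1, h2, norm_peakonSymbol_sub, mul_pow, sq_abs, div_pow, sq_abs,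
    Real.rpow_sub hpos, Real.rpow_two]
  ring

/-- A translation changes only the phase of the symbol. -/
theorem norm_peakonLp_eq (q r : ℝ) : ‖peakonLp hF hs κ q‖ = ‖peakonLp hF hs κ r‖ := by
  rw [← sq_eq_sq₀ (norm_nonneg _) (norm_nonneg _), norm_sq_freqMeasure hF.meas,
    norm_sq_freqMeasure hF.meas]
  refine integral_congr_ae ?_
  filter_upwards [coeFn_peakonLp hF hs κ q, coeFn_peakonLp hF hs κ r] with ξ h1 h2
  rw [h1, h2, norm_peakonSymbol, norm_peakonSymbol]

/-- Interpolates between the bounds $x^2$ and $4$ for the left-hand side. -/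
theorem two_mul_sin_sq_le {θ : ℝ} (h0 : 0 < θ) (h1 : θ ≤ 1) (x : ℝ) :
    (2 * Real.sin (x / 2)) ^ 2 ≤ 4 * (x ^ 2) ^ θ := by
  rcases le_or_gt (x ^ 2) 1 with h | h
  · have h2 : x ^ 2 ≤ (x ^ 2) ^ θ := by
      simpa using Real.rpow_le_rpow_of_exponent_ge' (sq_nonneg x) h h0.le h1
    have h3 : Real.sin (x / 2) ^ 2 ≤ (x / 2) ^ 2 := sq_le_sq.2 Real.abs_sin_le_abs
    nlinarith [sq_nonneg x]
  · have h2 : 1 ≤ (x ^ 2) ^ θ := Real.one_le_rpow h.le h0.le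
    nlinarith [Real.sin_sq_le_one (x / 2)]

/-- The interpolated sine bound trades a factor $|q-r|^{2\theta}$ for $\theta$ derivatives. The
remaining weight $(1+\xi^2)^{-(2-s-\theta)}$ is integrable because $\theta<3/2-s$. -/
theorem exists_norm_peakonLp_sub_le {θ : ℝ} (h0 : 0 < θ) (h1 : θ ≤ 1) (h2 : θ < 3 / 2 - s) :
    ∃ C > 0, ∀ q r : ℝ, ‖peakonLp hF hs κ q - peakonLp hF hs κ r‖ ≤ C * |q - r| ^ θ := by
  set A : ℝ := ∫ ξ, (1 + j ξ ^ 2) ^ (-(2 - s - θ)) ∂ν with hA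
  have hA0 : 0 ≤ A := integral_nonneg fun ξ => by positivity
  -- The added one only makes the constant positive; $\kappa$ may vanish here.
  refine ⟨√(4 * κ ^ 2 * A) + 1, by positivity, fun q r => ?_⟩
  have key : ‖peakonLp hF hs κ q - peakonLp hF hs κ r‖ ^ 2
      ≤ 4 * κ ^ 2 * A * (|q - r| ^ θ) ^ 2 := by
    rw [norm_sq_peakonLp_sub]
    have : 4 * κ ^ 2 * A * (|q - r| ^ θ) ^ 2
        = ∫ ξ, 4 * κ ^ 2 * (|q - r| ^ θ) ^ 2 * (1 + j ξ ^ 2) ^ (-(2 - s - θ)) ∂ν := by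
      rw [integral_const_mul]; ring
    rw [this]
    refine integral_mono_of_nonneg (Eventually.of_forall fun ξ => by positivity)
      ((hF.integrable _ (by linarith)).const_mul _) (Eventually.of_forall fun ξ => ?_)
    have hpos : (0 : ℝ) < 1 + j ξ ^ 2 := by positivity
    have h3 := two_mul_sin_sq_le h0 h1 ((q - r) * j ξ)
    rw [mul_pow (q - r), Real.mul_rpow (by positivity) (by positivity)] at h3
    have h4 : (j ξ ^ 2) ^ θ ≤ (1 + j ξ ^ 2) ^ θ :=
      Real.rpow_le_rpow (by positivity) (by linarith) h0.le
    have h5 : ((q - r) ^ 2) ^ θ = (|q - r| ^ θ) ^ 2 := by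
      rw [← sq_abs, ← Real.rpow_natCast, ← Real.rpow_natCast, ← Real.rpow_mul (abs_nonneg _),
        ← Real.rpow_mul (abs_nonneg _), mul_comm]
    have h6 : (1 + j ξ ^ 2) ^ (-(2 - s - θ)) = (1 + j ξ ^ 2) ^ (s - 2) * (1 + j ξ ^ 2) ^ θ := by
      rw [← Real.rpow_add hpos]; congr 1; ring
    rw [h5] at h3
    simp only []
    rw [h6]
    have h7 : (0 : ℝ) ≤ (1 + j ξ ^ 2) ^ (s - 2) := by positivity
    have h8 : (2 * Real.sin ((q - r) * j ξ / 2)) ^ 2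
        ≤ 4 * ((|q - r| ^ θ) ^ 2 * (1 + j ξ ^ 2) ^ θ) :=
      h3.trans (by gcongr)
    calc κ ^ 2 * ((1 + j ξ ^ 2) ^ (s - 2) * (2 * Real.sin ((q - r) * j ξ / 2)) ^ 2)
        ≤ κ ^ 2 * ((1 + j ξ ^ 2) ^ (s - 2) * (4 * ((|q - r| ^ θ) ^ 2 * (1 + j ξ ^ 2) ^ θ))) := by
          gcongr
      _ = _ := by ring
  have h3 : ‖peakonLp hF hs κ q - peakonLp hF hs κ r‖ ≤ √(4 * κ ^ 2 * A) * |q - r| ^ θ := by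
    refine le_of_sq_le_sq ?_ (by positivity)
    rw [mul_pow, Real.sq_sqrt (by positivity)]; exact key
  refine h3.trans ?_
  gcongr
  linarith

theorem continuous_peakonLp : Continuous (peakonLp hF hs κ) := by
  have h0 : 0 < min 1 ((3 / 2 - s) / 2) := lt_min one_pos (by linarith)
  obtain ⟨C, -, hC⟩ := exists_norm_peakonLp_sub_le hF hs κ h0 (min_le_left _ _)
    ((min_le_right _ _).trans_lt (by linarith))
  refine continuous_iff_continuousAt.2 fun q => tendsto_iff_norm_sub_tendsto_zero.2 ?_
  refine squeeze_zero (fun _ => norm_nonneg _) (fun r => hC r q) ?_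
  have : ContinuousAt (fun r : ℝ => C * |r - q| ^ (min 1 ((3 / 2 - s) / 2))) q := by
    refine continuousAt_const.mul (ContinuousAt.rpow_const (by fun_prop) (Or.inr h0.le))
  simpa [ContinuousAt, Real.zero_rpow h0.ne'] using this

/-- With $h=|q-r|$, only frequencies between $1/h$ and $2/h$ are kept. There the sine is bounded
below and the weight is of order $h^{4-2s}$, while the block has mass at least of order $h^{-1}$;
together these give $h^{3-2s}$, the square of the claimed rate. -/
theorem exists_le_norm_peakonLp_sub (hκ : κ ≠ 0) :
    ∃ c > 0, ∀ q r : ℝ, q ≠ r → |q - r| ≤ 1 / 2 →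
      c * |q - r| ^ (3 / 2 - s) ≤ ‖peakonLp hF hs κ q - peakonLp hF hs κ r‖ := by
  obtain ⟨c, hc, hd⟩ := hF.dyadic
  -- The factor $5^{s-2}$ comes from $1+\xi^2\le5h^{-2}$ on the block, $1/4$ from the sine, and $c$
  -- from the mass of the block.
  refine ⟨√(κ ^ 2 * ((5 : ℝ) ^ (s - 2) * (1 / 4) * c)), by positivity, fun q r hqr hh => ?_⟩
  set h := |q - r| with hh_def
  have hpos : 0 < h := abs_pos.2 (sub_ne_zero.2 hqr)
  refine le_of_sq_le_sq ?_ (norm_nonneg _)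
  rw [mul_pow, Real.sq_sqrt (by positivity), norm_sq_peakonLp_sub, integral_const_mul, mul_assoc]
  refine mul_le_mul_of_nonneg_left ?_ (sq_nonneg κ)
  set E := {ξ | h⁻¹ ≤ j ξ ∧ j ξ ≤ 2 * h⁻¹} with hE
  have hR : 2 ≤ h⁻¹ := by rw [le_inv_comm₀ two_pos hpos]; linarith
  have hEm : MeasurableSet E := (measurableSet_le measurable_const hF.meas).inter
    (measurableSet_le hF.meas measurable_const)
  have hint : Integrable (fun ξ => (1 + j ξ ^ 2) ^ (s - 2) *
      (2 * Real.sin ((q - r) * j ξ / 2)) ^ 2) ν := by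
    refine ((hF.integrable (2 - s) (by linarith)).const_mul 4).mono' ?_
      (Eventually.of_forall fun ξ => ?_)
    · have := hF.meas
      exact Measurable.aestronglyMeasurable (by fun_prop)
    · rw [Real.norm_of_nonneg (by positivity), neg_sub]
      have := Real.sin_sq_le_one ((q - r) * j ξ / 2)
      have h0 : (0 : ℝ) ≤ (1 + j ξ ^ 2) ^ (s - 2) := by positivity
      nlinarith
  have hlow : ∀ ξ ∈ E, (5 : ℝ) ^ (s - 2) * (1 / 4) * h ^ (4 - 2 * s) ≤ (1 + j ξ ^ 2) ^ (s - 2) *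
      (2 * Real.sin ((q - r) * j ξ / 2)) ^ 2 := by
    rintro ξ ⟨h1, h2⟩
    have h3 : 1 ≤ h * j ξ := by
      have := mul_le_mul_of_nonneg_left h1 hpos.le
      rwa [mul_inv_cancel₀ hpos.ne'] at this
    have h4 : h * j ξ ≤ 2 := by
      have := mul_le_mul_of_nonneg_left h2 hpos.le
      rwa [mul_left_comm, mul_inv_cancel₀ hpos.ne', mul_one] at this
    have h5 : (2 * Real.sin ((q - r) * j ξ / 2)) ^ 2 = (2 * Real.sin (h * j ξ / 2)) ^ 2 := by
      rcases abs_choice (q - r) with h6 | h6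
      · rw [hh_def, h6]
      · rw [hh_def, h6, neg_mul, neg_div, Real.sin_neg]; ring
    have h6 : 1 / 4 ≤ (2 * Real.sin (h * j ξ / 2)) ^ 2 := by
      have h7 := Real.mul_le_sin (x := h * j ξ / 2) (by linarith)
        (by linarith [Real.pi_gt_three])
      have h8 : 1 / 2 ≤ 2 / Real.pi := by
        rw [div_le_div_iff₀ two_pos Real.pi_pos]; linarith [Real.pi_le_four]
      have h9 : 1 / 4 ≤ Real.sin (h * j ξ / 2) := by nlinarith
      nlinarith
    have h7 : (5 : ℝ) ^ (s - 2) * h ^ (4 - 2 * s) ≤ (1 + j ξ ^ 2) ^ (s - 2) := by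
      have h8 : (5 : ℝ) ^ (s - 2) * h ^ (4 - 2 * s) = (5 * (h⁻¹) ^ 2) ^ (s - 2) := by
        rw [Real.mul_rpow (by norm_num) (by positivity), inv_pow, Real.inv_rpow (by positivity),
          ← Real.rpow_neg (by positivity), ← Real.rpow_natCast h 2, ← Real.rpow_mul hpos.le]
        congr 2; push_cast; ring
      rw [h8]
      refine Real.rpow_le_rpow_of_nonpos (by positivity) ?_ (by linarith)
      nlinarith
    rw [h5]
    calc (5 : ℝ) ^ (s - 2) * (1 / 4) * h ^ (4 - 2 * s)
        = (5 : ℝ) ^ (s - 2) * h ^ (4 - 2 * s) * (1 / 4) := by ring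
      _ ≤ _ := by gcongr
  -- Only a lower bound for the mass of the block is assumed. It is finite because an integrable
  -- function is bounded below by a positive constant there.
  have hEfin : ν E ≠ ⊤ := by
    have hK : (0 : ℝ) < (5 : ℝ) ^ (s - 2) * (1 / 4) * h ^ (4 - 2 * s) := by positivity
    refine ((measure_mono fun ξ hξ => ?_).trans_lt (hint.measure_ge_lt_top hK)).ne
    exact hlow ξ hξ
  have hEle : c * h⁻¹ ≤ ν.real E := by
    rw [Measure.real, ← ENNReal.toReal_ofReal (by positivity : 0 ≤ c * h⁻¹)]
    exact ENNReal.toReal_mono hEfin (hd _ hR)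
  calc (5 : ℝ) ^ (s - 2) * (1 / 4) * c * (h ^ (3 / 2 - s)) ^ 2
      = (5 : ℝ) ^ (s - 2) * (1 / 4) * h ^ (4 - 2 * s) * (c * h⁻¹) := by
        have : (h ^ (3 / 2 - s)) ^ 2 = h ^ (4 - 2 * s) * h⁻¹ := by
          rw [← Real.rpow_natCast, ← Real.rpow_mul hpos.le, ← Real.rpow_neg_one h,
            ← Real.rpow_add hpos]
          congr 1; push_cast; ring
        rw [this]; ring
    _ ≤ (5 : ℝ) ^ (s - 2) * (1 / 4) * h ^ (4 - 2 * s) * ν.real E := by gcongr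
    _ = ∫ _ in E, (5 : ℝ) ^ (s - 2) * (1 / 4) * h ^ (4 - 2 * s) ∂ν := by
        rw [setIntegral_const, smul_eq_mul, mul_comm]
    _ ≤ ∫ ξ in E, (1 + j ξ ^ 2) ^ (s - 2) * (2 * Real.sin ((q - r) * j ξ / 2)) ^ 2 ∂ν :=
        setIntegral_mono_on (integrableOn_const hEfin) hint.integrableOn hEm hlow
    _ ≤ _ := setIntegral_le_integral hint (Eventually.of_forall fun ξ => by positivity)

end Frequency

/-- The pair of peakons with amplitudes `p₁, p₂` and positions `q₁, q₂`, in `H^s`. -/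
def peakonPair {Ξ : Type} [MeasurableSpace Ξ] [AddGroup Ξ] [MeasurableNeg Ξ] {ν : Measure Ξ}
    [ν.IsNegInvariant] {j : Ξ → ℝ} (hj : Measurable j) (hF : FreqScale ν j) {s : ℝ}
    (hs : s < 3 / 2) (κ p₁ p₂ q₁ q₂ : ℝ) : realSobolev ν j hj s :=
  ⟨(p₁ : ℂ) • peakonLp hF hs κ q₁ + (p₂ : ℂ) • peakonLp hF hs κ q₂, by
    have hrep : ∀ᵐ ξ ∂ν, ((p₁ : ℂ) • peakonLp hF hs κ q₁ + (p₂ : ℂ) • peakonLp hF hs κ q₂ :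
        Lp ℂ 2 (freqMeasure ν j s)) ξ
          = p₁ * peakonSymbol κ j q₁ ξ + p₂ * peakonSymbol κ j q₂ ξ := by
      filter_upwards [coeFn_peakonLp hF hs κ q₁, coeFn_peakonLp hF hs κ q₂,
        ae_of_ae_freqMeasure ν hj s (Lp.coeFn_add ((p₁ : ℂ) • peakonLp hF hs κ q₁)
          ((p₂ : ℂ) • peakonLp hF hs κ q₂)),
        ae_of_ae_freqMeasure ν hj s (Lp.coeFn_smul (p₁ : ℂ) (peakonLp hF hs κ q₁)),
        ae_of_ae_freqMeasure ν hj s (Lp.coeFn_smul (p₂ : ℂ) (peakonLp hF hs κ q₂))]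
        with ξ h1 h2 h3 h4 h5
      rw [h3, Pi.add_apply, h4, h5, Pi.smul_apply, Pi.smul_apply, h1, h2, smul_eq_mul, smul_eq_mul]
    have hrep' := (Measure.measurePreserving_neg ν).quasiMeasurePreserving.ae hrep
    have hsym : ∀ q ξ, peakonSymbol κ j q (-ξ) = star (peakonSymbol κ j q ξ) := by
      intro q ξ
      simp only [peakonSymbol, hF.map_neg, Complex.star_def, map_mul, Complex.conj_ofReal,
        ← Complex.exp_conj, map_neg, Complex.conj_I]
      push_cast; ring_nf
    change ∀ᵐ ξ ∂ν, _ = _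
    filter_upwards [hrep, hrep'] with ξ h1 h2
    rw [h1, h2, hsym, hsym]
    simp⟩

/-! ### Pairs of peakons in the Sobolev space -/

section Pair

variable {Ξ : Type} [MeasurableSpace Ξ] [AddGroup Ξ] [MeasurableNeg Ξ] {ν : Measure Ξ}
  [ν.IsNegInvariant] {j : Ξ → ℝ} (hj : Measurable j) (hF : FreqScale ν j) {s : ℝ}
  (hs : s < 3 / 2) (κ : ℝ)

theorem coeFn_peakonPair (p₁ p₂ q₁ q₂ : ℝ) :
    ∀ᵐ ξ ∂ν, (peakonPair hj hF hs κ p₁ p₂ q₁ q₂).1 ξ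
      = p₁ * peakonSymbol κ j q₁ ξ + p₂ * peakonSymbol κ j q₂ ξ := by
  filter_upwards [coeFn_peakonLp hF hs κ q₁, coeFn_peakonLp hF hs κ q₂,
    ae_of_ae_freqMeasure ν hj s (Lp.coeFn_add ((p₁ : ℂ) • peakonLp hF hs κ q₁)
      ((p₂ : ℂ) • peakonLp hF hs κ q₂)),
    ae_of_ae_freqMeasure ν hj s (Lp.coeFn_smul (p₁ : ℂ) (peakonLp hF hs κ q₁)),
    ae_of_ae_freqMeasure ν hj s (Lp.coeFn_smul (p₂ : ℂ) (peakonLp hF hs κ q₂))]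
    with ξ h1 h2 h3 h4 h5
  rw [peakonPair, h3, Pi.add_apply, h4, h5, Pi.smul_apply, Pi.smul_apply, h1, h2, smul_eq_mul,
    smul_eq_mul]

theorem peakonPair_swap (p₁ p₂ q₁ q₂ : ℝ) :
    peakonPair hj hF hs κ p₁ p₂ q₁ q₂ = peakonPair hj hF hs κ p₂ p₁ q₂ q₁ :=
  Subtype.ext (add_comm _ _)

/-- Splits the pair into a peakon carrying the total amplitude and a dipole. In a collision the
total amplitude stays bounded, and all singular behaviour sits in the dipole. -/
theorem peakonPair_eq_add (p₁ p₂ q₁ q₂ : ℝ) :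
    (peakonPair hj hF hs κ p₁ p₂ q₁ q₂).1 = ((p₁ + p₂ : ℝ) : ℂ) • peakonLp hF hs κ q₁
      + (p₂ : ℂ) • (peakonLp hF hs κ q₂ - peakonLp hF hs κ q₁) := by
  simp only [peakonPair]; push_cast; module

theorem peakonPair_zero (q₁ q₂ : ℝ) : peakonPair hj hF hs κ 0 0 q₁ q₂ = 0 := by
  refine Subtype.ext ?_
  simp [peakonPair]

theorem continuousOn_peakonPair {T : Set ℝ} {p₁ p₂ q₁ q₂ : ℝ → ℝ} (h1 : ContinuousOn p₁ T)
    (h2 : ContinuousOn p₂ T) (h3 : ContinuousOn q₁ T) (h4 : ContinuousOn q₂ T) :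
    ContinuousOn (fun t => peakonPair hj hF hs κ (p₁ t) (p₂ t) (q₁ t) (q₂ t)) T := by
  have hc := continuous_peakonLp hF hs κ
  refine Topology.IsInducing.subtypeVal.continuousOn_iff.2 ?_
  exact ((Complex.continuous_ofReal.comp_continuousOn h1).smul (hc.comp_continuousOn h3)).add
    ((Complex.continuous_ofReal.comp_continuousOn h2).smul (hc.comp_continuousOn h4))

theorem norm_peakonPair_le (p₁ p₂ q₁ q₂ : ℝ) :
    ‖peakonPair hj hF hs κ p₁ p₂ q₁ q₂‖ ≤ |p₁ + p₂| * ‖peakonLp hF hs κ 0‖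
      + |p₂| * ‖peakonLp hF hs κ q₂ - peakonLp hF hs κ q₁‖ := by
  change ‖(peakonPair hj hF hs κ p₁ p₂ q₁ q₂).1‖ ≤ _
  rw [peakonPair_eq_add]
  refine (norm_add_le _ _).trans (le_of_eq ?_)
  rw [norm_smul, norm_smul, norm_peakonLp_eq hF hs κ q₁ 0, Complex.norm_real, Complex.norm_real,
    Real.norm_eq_abs, Real.norm_eq_abs]

theorem le_norm_peakonPair (p₁ p₂ q₁ q₂ : ℝ) :
    |p₂| * ‖peakonLp hF hs κ q₂ - peakonLp hF hs κ q₁‖ - |p₁ + p₂| * ‖peakonLp hF hs κ 0‖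
      ≤ ‖peakonPair hj hF hs κ p₁ p₂ q₁ q₂‖ := by
  change _ ≤ ‖(peakonPair hj hF hs κ p₁ p₂ q₁ q₂).1‖
  rw [peakonPair_eq_add]
  refine le_trans (le_of_eq ?_) (norm_sub_le_norm_add _ _ |>.trans_eq (by rw [add_comm]))
  rw [norm_smul, norm_smul, norm_peakonLp_eq hF hs κ q₁ 0, Complex.norm_real, Complex.norm_real,
    Real.norm_eq_abs, Real.norm_eq_abs]

/-- At frequency zero the transform of a pair is $\kappa(p_1+p_2)$, and the transform is continuous
in the frequency. -/
theorem add_eq_add_of_peakonPair_eq (hκ : κ ≠ 0) {p₁ p₂ q₁ q₂ p₁' p₂' q₁' q₂' : ℝ}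
    (h : peakonPair hj hF hs κ p₁ p₂ q₁ q₂ = peakonPair hj hF hs κ p₁' p₂' q₁' q₂') :
    p₁ + p₂ = p₁' + p₂' := by
  have h1 := hF.eval_zero (fun x => p₁ * peakonSymbol κ id q₁ x + p₂ * peakonSymbol κ id q₂ x
      - (p₁' * peakonSymbol κ id q₁' x + p₂' * peakonSymbol κ id q₂' x)) (by
        have : ∀ q, Continuous (peakonSymbol κ (id : ℝ → ℝ) q) := fun q => by
          unfold peakonSymbol
          refine (Complex.continuous_ofReal.comp (continuous_const.div (by fun_prop)
            fun x => ?_)).mul (by fun_prop)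
          have : (0 : ℝ) < 1 + id x ^ 2 := by positivity
          exact this.ne'
        fun_prop) (by
        filter_upwards [coeFn_peakonPair hj hF hs κ p₁ p₂ q₁ q₂,
          coeFn_peakonPair hj hF hs κ p₁' p₂' q₁' q₂'] with ξ h1 h2
        rw [h, h2] at h1
        simp only [peakonSymbol, id] at h1 ⊢
        rw [← h1, sub_self])
  simp only [peakonSymbol, id] at h1
  norm_num at h1
  have h2 : ((p₁ + p₂ - (p₁' + p₂') : ℝ) : ℂ) * κ = 0 := by push_cast; linear_combination h1
  have h3 : (p₁ + p₂ - (p₁' + p₂')) * κ = 0 := by exact_mod_cast h2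
  rcases mul_eq_zero.1 h3 with h4 | h4
  · linarith
  · exact absurd h4 hκ

/-- Colliding peakons do not converge in `H^s`, unless their difference tends to zero there. -/
theorem tendsto_of_tendsto_peakonPair {p₁ p₂ q₁ q₂ : ℕ → ℝ} {S q : ℝ} {W : realSobolev ν j hj s}
    (hS : Tendsto (fun n => p₁ n + p₂ n) atTop (𝓝 S)) (hq : Tendsto q₁ atTop (𝓝 q))
    (hpq : Tendsto (fun n => p₂ n * (q₂ n - q₁ n)) atTop (𝓝 0))
    (hW : Tendsto (fun n => peakonPair hj hF hs κ (p₁ n) (p₂ n) (q₁ n) (q₂ n)) atTop (𝓝 W)) :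
    Tendsto (fun n => |p₂ n| * ‖peakonLp hF hs κ (q₂ n) - peakonLp hF hs κ (q₁ n)‖) atTop
      (𝓝 0) := by
  set R : ℕ → Lp ℂ 2 (freqMeasure ν j s) :=
    fun n => (p₂ n : ℂ) • (peakonLp hF hs κ (q₂ n) - peakonLp hF hs κ (q₁ n)) with hR
  set L : Lp ℂ 2 (freqMeasure ν j s) := W.1 - (S : ℂ) • peakonLp hF hs κ q with hL
  have hlim : Tendsto R atTop (𝓝 L) := by
    have h1 := (continuous_subtype_val.tendsto W).comp hW
    have h2 := ((Complex.continuous_ofReal.tendsto S).comp hS).smul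
      (((continuous_peakonLp hF hs κ).tendsto q).comp hq)
    refine (h1.sub h2).congr fun n => ?_
    simp only [Function.comp_apply, peakonPair_eq_add, hR]
    abel
  -- Norm convergence gives convergence almost everywhere along a subsequence, and each Fourier mode
  -- of the dipole is at most $|\kappa||\xi||p_2(q_2-q_1)|\to0$. So zero is the only possible limit.
  have hL0 : L = 0 := by
    obtain ⟨ns, hns, hae⟩ := (tendstoInMeasure_of_tendsto_Lp hlim).exists_seq_tendsto_ae
    refine Lp.ext ?_
    have hc : ∀ᵐ ξ ∂(freqMeasure ν j s), ∀ n, R n ξ = p₂ n *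
        (peakonSymbol κ j (q₂ n) ξ - peakonSymbol κ j (q₁ n) ξ) := by
      refine ae_all_iff.2 fun n => ?_
      filter_upwards [Lp.coeFn_smul (p₂ n : ℂ) (peakonLp hF hs κ (q₂ n) - peakonLp hF hs κ (q₁ n)),
        Lp.coeFn_sub (peakonLp hF hs κ (q₂ n)) (peakonLp hF hs κ (q₁ n)),
        MemLp.coeFn_toLp (hF.memLp hs κ (q₂ n)), MemLp.coeFn_toLp (hF.memLp hs κ (q₁ n))]
        with ξ h1 h2 h3 h4
      rw [hR, h1, Pi.smul_apply, h2, Pi.sub_apply, smul_eq_mul]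
      simp only [peakonLp]
      rw [h3, h4]
    filter_upwards [hae, hc, Lp.coeFn_zero ℂ 2 (freqMeasure ν j s)] with ξ h1 h2 h3
    rw [h3, Pi.zero_apply]
    refine tendsto_nhds_unique h1 ?_
    refine (squeeze_zero_norm (a := fun n => |κ| * |j ξ| * |p₂ n * (q₂ n - q₁ n)|) (fun n => ?_)
      ?_ : Tendsto (fun n => R n ξ) atTop (𝓝 0)).comp hns.tendsto_atTop
    · rw [h2, norm_mul, norm_peakonSymbol_sub, Complex.norm_real, Real.norm_eq_abs, abs_mul (p₂ n)]
      have h4 : |κ| / (1 + j ξ ^ 2) ≤ |κ| :=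
        div_le_self (abs_nonneg _) (by nlinarith [sq_nonneg (j ξ)])
      have h5 : |2 * Real.sin ((q₂ n - q₁ n) * j ξ / 2)| ≤ |q₂ n - q₁ n| * |j ξ| := by
        rw [abs_mul, abs_two]
        have := Real.abs_sin_le_abs (x := (q₂ n - q₁ n) * j ξ / 2)
        rw [abs_div, abs_mul, abs_two] at this
        linarith
      calc |p₂ n| * (|κ| / (1 + j ξ ^ 2) * |2 * Real.sin ((q₂ n - q₁ n) * j ξ / 2)|)
          ≤ |p₂ n| * (|κ| * (|q₂ n - q₁ n| * |j ξ|)) := by gcongr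
        _ = _ := by ring
    · simpa using (hpq.abs).const_mul (|κ| * |j ξ|)
  rw [hL0] at hlim
  have := hlim.norm
  rw [norm_zero] at this
  refine this.congr fun n => ?_
  rw [hR, norm_smul, Complex.norm_real, Real.norm_eq_abs]

end Pair

/-! ### The ordinary differential equations of two peakons -/

/-- The value at distance `r` of the peakon with value `c` at its crest. -/
def crestProfile (c r : ℝ) : ℝ := c * Real.cosh r - Real.sinh r

/-- The slope, up to sign, at distance `r` of the peakon with value `c` at its crest. -/
def slopeProfile (c r : ℝ) : ℝ := Real.cosh r - c * Real.sinh r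

theorem hasDerivAt_crestProfile (c r : ℝ) :
    HasDerivAt (crestProfile c) (-slopeProfile c r) r := by
  have h := ((Real.hasDerivAt_cosh r).const_mul c).sub (Real.hasDerivAt_sinh r)
  exact h.congr_deriv (by rw [slopeProfile]; ring)

/-- The profile leaves its crest with slope $-1$: $c-a=\sinh r-c(\cosh r-1)$. The smallness of $cr$
keeps the quadratic term $cr^2$ below a quarter of the linear one. -/
theorem crestProfile_bounds {c r : ℝ} (hc : 1 ≤ c) (hr : 0 < r) (hrc : 4 * c * r ≤ 1) :
    r / 2 ≤ c - crestProfile c r ∧ c - crestProfile c r ≤ 2 * r ∧ 0 ≤ crestProfile c r := by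
  have hr4 : r ≤ 1 / 4 := by nlinarith
  have h1 : r ≤ Real.sinh r := Real.self_le_sinh_iff.2 hr.le
  have h3 := Real.cosh_sub_sinh r
  have h7 := Real.cosh_add_sinh r
  have h8 : Real.exp (-r) * Real.exp r = 1 := by rw [← Real.exp_add]; simp
  have h9 : Real.exp (-r) ≤ 1 - r + r ^ 2 / 2 := by
    have h11 : 1 + r + r ^ 2 / 2 ≤ Real.exp r := Real.quadratic_le_exp_of_nonneg hr.le
    have h14 : 0 < 1 - r + r ^ 2 / 2 := by nlinarith
    nlinarith [mul_le_mul_of_nonneg_left h11 (Real.exp_pos (-r)).le, pow_pos hr 4]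
  have h10 : Real.exp r ≤ 1 + r + 4 / 3 * r ^ 2 := by
    have h11 : 1 - r ≤ Real.exp (-r) := by linarith [Real.add_one_le_exp (-r)]
    have h12 : Real.exp r * (1 - r) ≤ 1 := by nlinarith [Real.exp_pos r]
    have h13 : 1 ≤ (1 + r + 4 / 3 * r ^ 2) * (1 - r) := by nlinarith [pow_pos hr 2, pow_pos hr 3]
    exact le_of_mul_le_mul_right (h12.trans h13) (by linarith)
  have h20 : 1 ≤ Real.cosh r := Real.one_le_cosh r
  have h21 : Real.cosh r ≤ 1 + r ^ 2 := by nlinarith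
  have h22 : Real.sinh r ≤ 2 * r := by nlinarith
  unfold crestProfile
  refine ⟨?_, ?_, ?_⟩
  · nlinarith
  · nlinarith
  · nlinarith

/-- The amplitudes and positions of a pair of peakons that solves the Novikov equation for times
in `(0,T)`. -/
structure TwoPeakonFlow (c T : ℝ) (p₁ p₂ q₁ q₂ : ℝ → ℝ) : Prop where
  measurable : Measurable p₁ ∧ Measurable p₂ ∧ Measurable q₁ ∧ Measurable q₂
  sep : ∀ t ∈ Ioo 0 T, 0 < q₂ t - q₁ t ∧ q₂ t - q₁ t < 1
  -- The amplitudes may blow up at the ends of the time interval. These two bounds are what keeps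
  -- $u$ and $u_x$ in $L^3$.
  bound : ∃ B : ℝ, ∀ t ∈ Ioo 0 T, |p₁ t + p₂ t| ≤ B ∧ |p₂ t| ^ 3 * (q₂ t - q₁ t) ≤ B
  deriv_p₁ : ∀ t ∈ Ioo 0 T, HasDerivAt p₁ (-(p₁ t * p₂ t * slopeProfile c (q₂ t - q₁ t) *
    (c * p₁ t + crestProfile c (q₂ t - q₁ t) * p₂ t))) t
  deriv_p₂ : ∀ t ∈ Ioo 0 T, HasDerivAt p₂ (p₁ t * p₂ t * slopeProfile c (q₂ t - q₁ t) *
    (crestProfile c (q₂ t - q₁ t) * p₁ t + c * p₂ t)) t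
  -- The factor $p_1$ leaves the position of a peakon of amplitude zero free, so that single peakons
  -- are included.
  deriv_q₁ : ∀ t ∈ Ioo 0 T, ∃ d, HasDerivAt q₁ d t ∧
    p₁ t * d = p₁ t * (c * p₁ t + crestProfile c (q₂ t - q₁ t) * p₂ t) ^ 2
  deriv_q₂ : ∀ t ∈ Ioo 0 T, ∃ d, HasDerivAt q₂ d t ∧
    p₂ t * d = p₂ t * (crestProfile c (q₂ t - q₁ t) * p₁ t + c * p₂ t) ^ 2

/-- The equation is invariant under $(t,x)\mapsto(-t,-x)$. The reflection exchanges the left and the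
right peakon. -/
theorem TwoPeakonFlow.reverse {c T : ℝ} {p₁ p₂ q₁ q₂ : ℝ → ℝ} (h : TwoPeakonFlow c T p₁ p₂ q₁ q₂) :
    TwoPeakonFlow c T (fun t => p₂ (T - t)) (fun t => p₁ (T - t)) (fun t => -q₂ (T - t))
      (fun t => -q₁ (T - t)) := by
  have hT : ∀ t ∈ Ioo 0 T, T - t ∈ Ioo 0 T := fun t ht => ⟨by linarith [ht.2], by linarith [ht.1]⟩
  have hs : ∀ t, HasDerivAt (fun t => T - t) (-1) t := fun t => by
    simpa using (hasDerivAt_id t).const_sub T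
  have hq : ∀ t, -q₁ (T - t) - -q₂ (T - t) = q₂ (T - t) - q₁ (T - t) := fun t => by ring
  obtain ⟨m1, m2, m3, m4⟩ := h.measurable
  constructor
  · have : Measurable fun t : ℝ => T - t := measurable_const.sub measurable_id
    exact ⟨m2.comp this, m1.comp this, (m4.comp this).neg, (m3.comp this).neg⟩
  · intro t ht; rw [hq]; exact h.sep _ (hT t ht)
  · obtain ⟨B, hB⟩ := h.bound
    have hB0 : ∀ t ∈ Ioo 0 T, 0 ≤ B := fun t ht => (abs_nonneg _).trans (hB t ht).1
    -- The bound must now hold for the other amplitude: $|p_1|\le B+|p_2|$, hence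
    -- $|p_1|^3\le8(B^3+|p_2|^3)$, and the distance is below one.
    refine ⟨B + 8 * (B ^ 3 + B), fun t ht => ?_⟩
    obtain ⟨b1, b2⟩ := hB _ (hT t ht)
    obtain ⟨s1, s2⟩ := h.sep _ (hT t ht)
    have b0 := hB0 t ht
    rw [hq, add_comm]
    refine ⟨b1.trans (by nlinarith [pow_nonneg b0 3]), ?_⟩
    set r := q₂ (T - t) - q₁ (T - t)
    set x := |p₂ (T - t)|
    have hx : 0 ≤ x := abs_nonneg _
    have h1 : |p₁ (T - t)| ≤ B + x := by
      have := abs_sub (p₁ (T - t) + p₂ (T - t)) (p₂ (T - t))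
      rw [add_sub_cancel_right] at this
      linarith
    have h2 : |p₁ (T - t)| ^ 3 ≤ (B + x) ^ 3 := pow_le_pow_left₀ (abs_nonneg _) h1 3
    have h3 : (B + x) ^ 3 ≤ 8 * (B ^ 3 + x ^ 3) := by
      nlinarith [mul_nonneg (add_nonneg b0 hx) (sq_nonneg (B - x)), pow_nonneg b0 3, pow_nonneg hx 3]
    calc |p₁ (T - t)| ^ 3 * r ≤ 8 * (B ^ 3 + x ^ 3) * r := by gcongr; exact h2.trans h3
      _ = 8 * (B ^ 3 * r + x ^ 3 * r) := by ring
      _ ≤ 8 * (B ^ 3 * 1 + B) := by gcongr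
      _ ≤ _ := by linarith
  · intro t ht
    refine ((h.deriv_p₂ _ (hT t ht)).comp t (hs t)).congr_deriv ?_
    rw [hq]; ring
  · intro t ht
    refine ((h.deriv_p₁ _ (hT t ht)).comp t (hs t)).congr_deriv ?_
    rw [hq]; ring
  · intro t ht
    obtain ⟨d, h1, h2⟩ := h.deriv_q₂ _ (hT t ht)
    refine ⟨d, ((h1.comp t (hs t)).neg).congr_deriv (by ring), ?_⟩
    rw [hq, h2]; ring
  · intro t ht
    obtain ⟨d, h1, h2⟩ := h.deriv_q₁ _ (hT t ht)
    refine ⟨d, ((h1.comp t (hs t)).neg).congr_deriv (by ring), ?_⟩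
    rw [hq, h2]; ring

theorem TwoPeakonFlow.mono {c T T' : ℝ} {p₁ p₂ q₁ q₂ : ℝ → ℝ} (h : TwoPeakonFlow c T p₁ p₂ q₁ q₂)
    (hT : T' ≤ T) : TwoPeakonFlow c T' p₁ p₂ q₁ q₂ := by
  have hs : ∀ t ∈ Ioo 0 T', t ∈ Ioo 0 T := fun t ht => ⟨ht.1, ht.2.trans_le hT⟩
  obtain ⟨B, hB⟩ := h.bound
  exact ⟨h.measurable, fun t ht => h.sep t (hs t ht), ⟨B, fun t ht => hB t (hs t ht)⟩,
    fun t ht => h.deriv_p₁ t (hs t ht), fun t ht => h.deriv_p₂ t (hs t ht),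
    fun t ht => h.deriv_q₁ t (hs t ht), fun t ht => h.deriv_q₂ t (hs t ht)⟩

/-- A peakon travels with the square of its height $cA$. The companion of amplitude zero rides along
at distance $1/2$ only to meet the separation condition. -/
theorem twoPeakonFlow_single (c A T : ℝ) :
    TwoPeakonFlow c T (fun _ => A) (fun _ => 0) (fun t => (c * A) ^ 2 * t)
      (fun t => (c * A) ^ 2 * t + 1 / 2) := by
  have hd : ∀ t, HasDerivAt (fun t : ℝ => (c * A) ^ 2 * t) ((c * A) ^ 2) t := fun t => by
    simpa using (hasDerivAt_id t).const_mul ((c * A) ^ 2)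
  refine ⟨⟨by fun_prop, by fun_prop, by fun_prop, by fun_prop⟩, fun t _ => by norm_num,
    ⟨|A|, fun t _ => by simp⟩, fun t _ => ?_, fun t _ => ?_, fun t _ => ⟨_, hd t, by ring⟩,
    fun t _ => ⟨_, (hd t).add_const _, by ring⟩⟩
  · exact (hasDerivAt_const t A).congr_deriv (by ring)
  · exact (hasDerivAt_const t 0).congr_deriv (by ring)

/-- A solution of `q' = F(q)` that leaves the equilibrium `0` at time `0`, where `F` vanishes there
only to the order `3/4`. -/
theorem exists_leaving_solution {F : ℝ → ℝ} {R κ r₀ : ℝ} (hF : ContinuousOn F (Ioo 0 R))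
    (hκ : 0 < κ) (hlow : ∀ r ∈ Ioo 0 R, κ * r ^ (3 / 4 : ℝ) ≤ F r) (hr₀ : r₀ ∈ Ioo 0 R) :
    ∃ T T₁ : ℝ, 0 < T ∧ T < T₁ ∧ T ≤ 4 / κ * r₀ ^ (1 / 4 : ℝ) ∧ ∃ q : ℝ → ℝ, Continuous q ∧
      StrictMono q ∧ q 0 = 0 ∧ q T = r₀ ∧
      ∀ t ∈ Ioo 0 T₁, q t ∈ Ioo 0 R ∧ HasDerivAt q (F (q t)) t := by
  classical
  have hR : 0 < R := hr₀.1.trans hr₀.2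
  have hFpos : ∀ r ∈ Ioo 0 R, 0 < F r := fun r hr =>
    lt_of_lt_of_le (mul_pos hκ (Real.rpow_pos_of_pos hr.1 _)) (hlow r hr)
  -- Separation of variables: $1/F$ is the time spent per unit of distance. The value $1$ outside
  -- the interval makes its primitive `τ` an increasing bijection of the whole line.
  set f : ℝ → ℝ := (Ioo 0 R).piecewise (fun r => (F r)⁻¹) (fun _ => 1) with hf
  have hfin : ∀ r ∈ Ioo 0 R, f r = (F r)⁻¹ := fun r hr => piecewise_eq_of_mem _ _ _ hr
  have hfout : ∀ r, r ∉ Ioo 0 R → f r = 1 := fun r hr => piecewise_eq_of_notMem _ _ _ hr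
  have hfpos : ∀ r, 0 < f r := fun r => by
    by_cases hr : r ∈ Ioo 0 R
    · rw [hfin r hr]; exact inv_pos.2 (hFpos r hr)
    · rw [hfout r hr]; exact one_pos
  have hfcont : ContinuousOn (fun r => (F r)⁻¹) (Ioo 0 R) :=
    hF.inv₀ fun r hr => (hFpos r hr).ne'
  have hfm : Measurable f :=
    hfcont.measurable_piecewise continuousOn_const measurableSet_Ioo
  have hfle : ∀ r ∈ Ioo 0 R, f r ≤ κ⁻¹ * r ^ (-(3 / 4) : ℝ) := fun r hr => by
    rw [hfin r hr, Real.rpow_neg hr.1.le, ← mul_inv]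
    exact inv_anti₀ (mul_pos hκ (Real.rpow_pos_of_pos hr.1 _)) (hlow r hr)
  -- This is where the order $3/4$ matters: $r^{-3/4}$ is integrable at $0$, so leaving the
  -- equilibrium takes finite time.
  have hint : ∀ a b, IntervalIntegrable f volume a b := fun a b => by
    have h1 : IntervalIntegrable (fun r : ℝ => κ⁻¹ * ‖r ^ (-(3 / 4) : ℝ)‖ + 1) volume a b :=
      (((intervalIntegral.intervalIntegrable_rpow' (by norm_num)).norm).const_mul _).add
        intervalIntegrable_const
    refine h1.mono_fun hfm.aestronglyMeasurable (Eventually.of_forall fun r => ?_)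
    have h2 : 0 ≤ κ⁻¹ * ‖r ^ (-(3 / 4) : ℝ)‖ := by positivity
    simp only []
    rw [Real.norm_of_nonneg (hfpos r).le, Real.norm_of_nonneg (by linarith)]
    by_cases hr : r ∈ Ioo 0 R
    · refine (hfle r hr).trans ?_
      rw [Real.norm_of_nonneg (Real.rpow_nonneg hr.1.le _)]
      linarith
    · rw [hfout r hr]; linarith
  set τ : ℝ → ℝ := fun r => ∫ x in (0 : ℝ)..r, f x with hτ
  have hτc : Continuous τ := intervalIntegral.continuous_primitive hint 0
  have hsub : ∀ a b, τ b - τ a = ∫ x in a..b, f x := fun a b =>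
    intervalIntegral.integral_interval_sub_left (hint _ _) (hint _ _)
  have hτm : StrictMono τ := fun a b hab => by
    have := intervalIntegral.intervalIntegral_pos_of_pos (hint a b) hfpos hab
    rw [← hsub] at this
    linarith
  have hτ0 : τ 0 = 0 := by simp [hτ]
  have hτneg : ∀ r ≤ 0, τ r = r := fun r hr => by
    have : ∫ x in (0 : ℝ)..r, f x = ∫ x in (0 : ℝ)..r, (1 : ℝ) := by
      refine intervalIntegral.integral_congr fun x hx => hfout x fun h => ?_
      rw [uIcc_of_ge hr] at hx
      exact absurd h.1 (not_lt.2 hx.2)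
    simp only [hτ, this]; simp
  have hτR : ∀ r, R ≤ r → τ r = τ R + (r - R) := fun r hr => by
    have : ∫ x in R..r, f x = ∫ x in R..r, (1 : ℝ) := by
      refine intervalIntegral.integral_congr fun x hx => hfout x fun h => ?_
      rw [uIcc_of_le hr] at hx
      exact absurd h.2 (not_lt.2 hx.1)
    rw [← hsub] at this
    simp at this
    linarith
  have hsurj : Function.Surjective τ := by
    refine hτc.surjective ?_ ?_
    · refine tendsto_atTop_mono' _ ?_ (tendsto_atTop_add_const_right _ (τ R - R) tendsto_id)
      filter_upwards [eventually_ge_atTop R] with r hr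
      rw [hτR r hr, id]; linarith
    · refine tendsto_atBot_mono' _ ?_ tendsto_id
      filter_upwards [eventually_le_atBot 0] with r hr
      rw [hτneg r hr, id]
  set e : ℝ ≃o ℝ := hτm.orderIsoOfSurjective _ hsurj with he
  have heτ : ∀ r, e r = τ r := fun r => rfl
  -- The solution is the inverse of `τ`; it reaches $r_0$ at time `τ r₀` and $R$ at time `τ R`.
  refine ⟨τ r₀, τ R, ?_, hτm hr₀.2, ?_, e.symm, e.symm.continuous, e.symm.strictMono, ?_, ?_, ?_⟩
  · rw [← hτ0]; exact hτm hr₀.1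
  · have h1 : τ r₀ ≤ ∫ x in (0 : ℝ)..r₀, κ⁻¹ * x ^ (-(3 / 4) : ℝ) := by
      refine intervalIntegral.integral_mono_on_of_le_Ioo hr₀.1.le (hint _ _)
        ((intervalIntegral.intervalIntegrable_rpow' (by norm_num)).const_mul _) fun x hx => ?_
      exact hfle x ⟨hx.1, hx.2.trans hr₀.2⟩
    rw [intervalIntegral.integral_const_mul, integral_rpow (Or.inl (by norm_num))] at h1
    norm_num at h1
    refine h1.trans (le_of_eq ?_)
    field_simp
  · exact e.symm_apply_eq.2 hτ0.symm
  · rw [← heτ, e.symm_apply_apply]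
  · intro t ht
    have hmem : e.symm t ∈ Ioo 0 R := by
      constructor
      · rw [← hτm.lt_iff_lt, hτ0, ← heτ, e.apply_symm_apply]; exact ht.1
      · rw [← hτm.lt_iff_lt, ← heτ (e.symm t), e.apply_symm_apply]; exact ht.2
    refine ⟨hmem, ?_⟩
    have hev : f =ᶠ[𝓝 (e.symm t)] fun r => (F r)⁻¹ := by
      filter_upwards [isOpen_Ioo.mem_nhds hmem] with r hr using hfin r hr
    have hca : ContinuousAt f (e.symm t) :=
      (hfcont.continuousAt (isOpen_Ioo.mem_nhds hmem)).congr hev.symm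
    have hd : HasDerivAt τ (f (e.symm t)) (e.symm t) :=
      intervalIntegral.integral_hasDerivAt_right (hint _ _)
        hfm.stronglyMeasurable.stronglyMeasurableAtFilter hca
    have := HasDerivAt.of_local_left_inverse e.symm.continuous.continuousAt hd (hfpos _).ne'
      (Eventually.of_forall fun y => e.apply_symm_apply y)
    rwa [hfin _ hmem, inv_inv] at this

/-- Minus the product of the amplitudes of two peakons at distance `r`, by conservation of
`p₁² p₂² (c² - a²)`, where `a` is the crest profile. -/
def pairProduct (c m r : ℝ) : ℝ := m ^ 2 / √(c ^ 2 - crestProfile c r ^ 2)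

/-- The square of the sum of the amplitudes of two peakons at distance `r` that emanate from a
peakon of amplitude `S₀`, by conservation of energy. -/
def pairSumSq (c S₀ m r : ℝ) : ℝ := S₀ ^ 2 - 2 / c * ((c - crestProfile c r) * pairProduct c m r)

/-- The sum of the amplitudes. -/
def pairSum (c S₀ m r : ℝ) : ℝ := √(pairSumSq c S₀ m r)

/-- The difference of the amplitudes. -/
def pairGap (c S₀ m r : ℝ) : ℝ := √(pairSumSq c S₀ m r + 4 * pairProduct c m r)

/-! ### Bounds and derivatives of the conserved-quantity formulas -/

theorem crestProfile_sq_bounds {c r : ℝ} (hc : 1 ≤ c) (hr : 0 < r) (hrc : 4 * c * r ≤ 1) :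
    r / 2 ≤ c ^ 2 - crestProfile c r ^ 2 ∧ c ^ 2 - crestProfile c r ^ 2 ≤ 4 * c * r := by
  obtain ⟨h1, h2, h3⟩ := crestProfile_bounds hc hr hrc
  constructor <;> nlinarith

theorem pairProduct_pos {c m r : ℝ} (hc : 1 ≤ c) (hm : 0 < m) (hr : 0 < r)
    (hrc : 4 * c * r ≤ 1) : 0 < pairProduct c m r := by
  have := (crestProfile_sq_bounds hc hr hrc).1
  have : 0 < √(c ^ 2 - crestProfile c r ^ 2) := Real.sqrt_pos.2 (by linarith)
  unfold pairProduct
  positivity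

/-- Although the product $N$ of the amplitudes blows up as $r\to0$, the energy defect
$(c-a)N=m^2(c-a)/\sqrt{c^2-a^2}$ is at most $m^2\sqrt{c-a}$, which is of order $\sqrt r$. So the sum
of the amplitudes returns to $S_0$. -/
theorem pairSumSq_bounds {c S₀ m r : ℝ} (hc : 1 ≤ c) (hm : 0 < m) (hr : 0 < r)
    (hrc : 4 * c * r ≤ 1) :
    S₀ ^ 2 - 4 * m ^ 2 * √r ≤ pairSumSq c S₀ m r ∧ pairSumSq c S₀ m r < S₀ ^ 2 := by
  obtain ⟨h1, h2, h3⟩ := crestProfile_bounds hc hr hrc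
  have hN := pairProduct_pos hc hm hr hrc
  set W := c ^ 2 - crestProfile c r ^ 2 with hW
  have hd : 0 < c - crestProfile c r := by linarith
  have hdW : c - crestProfile c r ≤ W := by nlinarith
  have hWpos : 0 < W := hd.trans_le hdW
  have h4 : (c - crestProfile c r) / √W ≤ 2 * √r := by
    rw [div_le_iff₀ (Real.sqrt_pos.2 hWpos)]
    have h5 : c - crestProfile c r = √(c - crestProfile c r) * √(c - crestProfile c r) :=
      (Real.mul_self_sqrt hd.le).symm
    have h6 : √(c - crestProfile c r) ≤ 2 * √r := by
      rw [Real.sqrt_le_iff]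
      refine ⟨by positivity, ?_⟩
      rw [mul_pow, Real.sq_sqrt hr.le]; linarith
    rw [h5]
    gcongr
  have h7 : (c - crestProfile c r) * pairProduct c m r
      = m ^ 2 * ((c - crestProfile c r) / √W) := by
    rw [pairProduct]; ring
  have h8 : 2 / c ≤ 2 := by
    rw [div_le_iff₀ (by linarith)]; linarith
  have h9 : 0 < 2 / c := by positivity
  unfold pairSumSq
  constructor
  · have h10 : (c - crestProfile c r) * pairProduct c m r ≤ m ^ 2 * (2 * √r) := by
      rw [h7]; gcongr
    have h11 : 0 ≤ m ^ 2 * (2 * √r) := by positivity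
    have := mul_le_mul h8 h10 (by positivity) (by norm_num)
    linarith
  · have : 0 < 2 / c * ((c - crestProfile c r) * pairProduct c m r) := by positivity
    linarith

theorem hasDerivAt_pairProduct {c m r : ℝ} (hc : 1 ≤ c) (hr : 0 < r)
    (hrc : 4 * c * r ≤ 1) :
    HasDerivAt (pairProduct c m) (-(pairProduct c m r * crestProfile c r * slopeProfile c r
      / (c ^ 2 - crestProfile c r ^ 2))) r := by
  have hW := (crestProfile_sq_bounds hc hr hrc).1
  have hWpos : 0 < c ^ 2 - crestProfile c r ^ 2 := by linarith
  have h1 := ((((hasDerivAt_crestProfile c r).pow 2).const_sub (c ^ 2)).sqrt hWpos.ne')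
  have h2 := (hasDerivAt_const r (m ^ 2)).div h1 (Real.sqrt_pos.2 hWpos).ne'
  refine h2.congr_deriv ?_
  have h3 : 0 < √(c ^ 2 - crestProfile c r ^ 2) := Real.sqrt_pos.2 hWpos
  have h4 : c ^ 2 - crestProfile c r ^ 2 = √(c ^ 2 - crestProfile c r ^ 2) ^ 2 :=
    (Real.sq_sqrt hWpos.le).symm
  simp only [pairProduct, Pi.pow_apply]
  set x := √(c ^ 2 - crestProfile c r ^ 2)
  rw [h4]
  field_simp
  push_cast
  ring

theorem hasDerivAt_pairSumSq {c S₀ m r : ℝ} (hc : 1 ≤ c) (hr : 0 < r)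
    (hrc : 4 * c * r ≤ 1) :
    HasDerivAt (pairSumSq c S₀ m) (-(2 * slopeProfile c r * pairProduct c m r
      / (c + crestProfile c r))) r := by
  obtain ⟨h1, h2, h3⟩ := crestProfile_bounds hc hr hrc
  have h := ((((hasDerivAt_crestProfile c r).const_sub c).mul
    (hasDerivAt_pairProduct (m := m) hc hr hrc)).const_mul (2 / c)).const_sub (S₀ ^ 2)
  refine h.congr_deriv ?_
  have h4 : c - crestProfile c r ≠ 0 := by linarith
  have h5 : c + crestProfile c r ≠ 0 := by linarith
  have h6 : c ^ 2 - crestProfile c r ^ 2 = (c - crestProfile c r) * (c + crestProfile c r) := by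
    ring
  have h7 : c ≠ 0 := by linarith
  rw [h6]
  field_simp
  ring

/-- The speed at which the distance of the peakons grows. -/
def pairSpeed (c S₀ m r : ℝ) : ℝ :=
  (c ^ 2 - crestProfile c r ^ 2) * pairGap c S₀ m r * pairSum c S₀ m r

/-- The product form is ready for the chain rule: along $r'$ equal to `pairSpeed`, the right-hand
side is the value of $p_1'+p_2'$ that the peakon equations prescribe. -/
theorem hasDerivAt_pairSum {c S₀ m r : ℝ} (hc : 1 ≤ c) (hr : 0 < r) (hrc : 4 * c * r ≤ 1)
    (hS : 0 < pairSumSq c S₀ m r) :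
    ∃ d, HasDerivAt (pairSum c S₀ m) d r ∧ d * pairSpeed c S₀ m r
      = -(slopeProfile c r * pairProduct c m r * (c - crestProfile c r) * pairGap c S₀ m r) := by
  obtain ⟨h1, h2, h3⟩ := crestProfile_bounds hc hr hrc
  refine ⟨_, (hasDerivAt_pairSumSq hc hr hrc).sqrt hS.ne', ?_⟩
  have h4 : 0 < pairSum c S₀ m r := Real.sqrt_pos.2 hS
  have h5 : c + crestProfile c r ≠ 0 := by linarith
  rw [pairSpeed]
  change _ / (2 * pairSum c S₀ m r) * _ = _
  field_simp
  ring

/-- As for the sum: the right-hand side is the prescribed value of $p_2'-p_1'$. -/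
theorem hasDerivAt_pairGap {c S₀ m r : ℝ} (hc : 1 ≤ c) (hr : 0 < r)
    (hrc : 4 * c * r ≤ 1) (hS : 0 < pairSumSq c S₀ m r + 4 * pairProduct c m r) :
    ∃ d, HasDerivAt (pairGap c S₀ m) d r ∧ d * pairSpeed c S₀ m r
      = -(slopeProfile c r * pairProduct c m r * (c + crestProfile c r) * pairSum c S₀ m r) := by
  obtain ⟨h1, h2, h3⟩ := crestProfile_bounds hc hr hrc
  refine ⟨_, ((hasDerivAt_pairSumSq hc hr hrc).add
    ((hasDerivAt_pairProduct hc hr hrc).const_mul 4)).sqrt hS.ne', ?_⟩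
  have h4 : 0 < pairGap c S₀ m r := Real.sqrt_pos.2 hS
  have h5 : c + crestProfile c r ≠ 0 := by linarith
  have h7 : c - crestProfile c r ≠ 0 := by linarith
  have h6 : c ^ 2 - crestProfile c r ^ 2 = (c - crestProfile c r) * (c + crestProfile c r) := by
    ring
  rw [pairSpeed, h6]
  change _ / (2 * pairGap c S₀ m r) * _ = _
  field_simp
  ring

/-- Two peakons with amplitudes of opposite sign emanate from a single peakon. -/
theorem exists_emanating_pair {c S₀ m r₀ : ℝ} (hc : 1 ≤ c) (hS₀ : 0 < S₀) (hm : 0 < m)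
    (hr₀ : 0 < r₀) (hrc : 8 * c * r₀ ≤ 1) (hsmall : 8 * m ^ 2 * √r₀ ≤ S₀ ^ 2) :
    ∃ T > 0, T ≤ 8 / (m * S₀) * r₀ ^ (1 / 4 : ℝ) ∧ ∃ p₁ p₂ q₁ q₂ : ℝ → ℝ,
      TwoPeakonFlow c T p₁ p₂ q₁ q₂ ∧
      (ContinuousOn p₁ (Ioc 0 T) ∧ ContinuousOn p₂ (Ioc 0 T) ∧ Continuous q₁ ∧ Continuous q₂) ∧
      q₁ 0 = 0 ∧ q₂ 0 = 0 ∧ q₂ T - q₁ T = r₀ ∧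
      (∀ t ∈ Ioc 0 T, 0 < q₂ t - q₁ t ∧ q₂ t - q₁ t ≤ r₀ ∧
        0 < p₁ t + p₂ t ∧ p₁ t + p₂ t < S₀ ∧
        m * (4 * c * (q₂ t - q₁ t)) ^ (-(1 / 4) : ℝ) ≤ p₂ t ∧
        p₂ t ≤ S₀ + 2 * m * (q₂ t - q₁ t) ^ (-(1 / 4) : ℝ)) ∧
      Tendsto (fun t => p₁ t + p₂ t) (𝓝[>] 0) (𝓝 S₀) := by
  -- Room beyond $r_0$, so that the flow is still differentiable at the final time $T$.
  set R := 2 * r₀ with hR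
  have hgood : ∀ r ∈ Ioo 0 R, 0 < r ∧ 4 * c * r ≤ 1 := fun r hr => ⟨hr.1, by nlinarith [hr.2]⟩
  -- By the smallness hypothesis and $\sqrt2\le3/2$, the square of the sum loses at most
  -- $\tfrac34S_0^2$.
  have hSq : ∀ r ∈ Ioo 0 R, (S₀ / 2) ^ 2 ≤ pairSumSq c S₀ m r := fun r hr => by
    obtain ⟨h1, h2⟩ := hgood r hr
    have h3 := (pairSumSq_bounds (S₀ := S₀) hc hm h1 h2).1
    have h4 : √r ≤ √2 * √r₀ := by
      rw [← Real.sqrt_mul (by norm_num)]; exact Real.sqrt_le_sqrt hr.2.le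
    have h5 : √2 ≤ 3 / 2 := by rw [Real.sqrt_le_iff]; norm_num
    have h6 : √r ≤ 3 / 2 * √r₀ := h4.trans (by gcongr)
    have h7 : 4 * m ^ 2 * √r ≤ 4 * m ^ 2 * (3 / 2 * √r₀) := by gcongr
    nlinarith
  have hSqpos : ∀ r ∈ Ioo 0 R, 0 < pairSumSq c S₀ m r := fun r hr =>
    lt_of_lt_of_le (by positivity) (hSq r hr)
  have hSle : ∀ r ∈ Ioo 0 R, S₀ / 2 ≤ pairSum c S₀ m r := fun r hr =>
    Real.le_sqrt_of_sq_le (hSq r hr)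
  have hSlt : ∀ r ∈ Ioo 0 R, pairSum c S₀ m r < S₀ := fun r hr => by
    obtain ⟨h1, h2⟩ := hgood r hr
    rw [pairSum, Real.sqrt_lt' hS₀]
    exact (pairSumSq_bounds hc hm h1 h2).2
  have hNpos : ∀ r ∈ Ioo 0 R, 0 < pairProduct c m r := fun r hr =>
    pairProduct_pos hc hm (hgood r hr).1 (hgood r hr).2
  have hGpos : ∀ r ∈ Ioo 0 R, 0 < pairSumSq c S₀ m r + 4 * pairProduct c m r := fun r hr => by
    linarith [hSqpos r hr, hNpos r hr]
  have hNsqrt : ∀ r ∈ Ioo 0 R,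
      √(pairProduct c m r) = m * (c ^ 2 - crestProfile c r ^ 2) ^ (-(1 / 4) : ℝ) := fun r hr => by
    have hW := (crestProfile_sq_bounds hc (hgood r hr).1 (hgood r hr).2).1
    have hW0 : 0 ≤ c ^ 2 - crestProfile c r ^ 2 := by linarith [hr.1]
    rw [pairProduct, Real.sqrt_div (sq_nonneg m), Real.sqrt_sq hm.le, Real.sqrt_eq_rpow,
      Real.sqrt_eq_rpow, ← Real.rpow_mul hW0, Real.rpow_neg hW0, div_eq_mul_inv]
    norm_num
  have hNlow : ∀ r ∈ Ioo 0 R, m * (4 * c * r) ^ (-(1 / 4) : ℝ) ≤ √(pairProduct c m r) :=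
    fun r hr => by
      obtain ⟨hW1, hW2⟩ := crestProfile_sq_bounds hc (hgood r hr).1 (hgood r hr).2
      rw [hNsqrt r hr]
      exact mul_le_mul_of_nonneg_left
        (Real.rpow_le_rpow_of_nonpos (by linarith [hr.1]) hW2 (by norm_num)) hm.le
  have hNup : ∀ r ∈ Ioo 0 R, √(pairProduct c m r) ≤ 2 * m * r ^ (-(1 / 4) : ℝ) := fun r hr => by
    obtain ⟨hW1, hW2⟩ := crestProfile_sq_bounds hc (hgood r hr).1 (hgood r hr).2
    have hr0 := hr.1
    rw [hNsqrt r hr]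
    have h1 : (c ^ 2 - crestProfile c r ^ 2) ^ (-(1 / 4) : ℝ) ≤ (r / 2) ^ (-(1 / 4) : ℝ) :=
      Real.rpow_le_rpow_of_nonpos (by linarith) hW1 (by norm_num)
    have h2 : (r / 2) ^ (-(1 / 4) : ℝ) ≤ 2 * r ^ (-(1 / 4) : ℝ) := by
      rw [div_eq_mul_inv, mul_comm r, Real.mul_rpow (by norm_num) hr0.le]
      have h3 : ((2 : ℝ)⁻¹) ^ (-(1 / 4) : ℝ) ≤ 2 := by
        rw [Real.inv_rpow (by norm_num), ← Real.rpow_neg (by norm_num), neg_neg]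
        simpa using Real.rpow_le_rpow_of_exponent_le (x := (2 : ℝ)) (by norm_num)
          (show (1 / 4 : ℝ) ≤ 1 by norm_num)
      gcongr
    calc _ ≤ m * (2 * r ^ (-(1 / 4) : ℝ)) := by gcongr; exact h1.trans h2
      _ = _ := by ring
  have hGlow : ∀ r ∈ Ioo 0 R, 2 * √(pairProduct c m r) ≤ pairGap c S₀ m r := fun r hr => by
    have h1 := Real.sq_sqrt (hNpos r hr).le
    refine Real.le_sqrt_of_sq_le ?_
    nlinarith [hSqpos r hr]
  have hGup : ∀ r ∈ Ioo 0 R, pairGap c S₀ m r ≤ pairSum c S₀ m r + 2 * √(pairProduct c m r) :=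
    fun r hr => by
      have h1 := Real.sq_sqrt (hNpos r hr).le
      have h2 := Real.sq_sqrt (hSqpos r hr).le
      have h3 : 0 ≤ pairSum c S₀ m r := Real.sqrt_nonneg _
      have h4 := Real.sqrt_nonneg (pairProduct c m r)
      rw [pairGap, Real.sqrt_le_iff]
      refine ⟨by positivity, ?_⟩
      have h5 : pairSum c S₀ m r ^ 2 = pairSumSq c S₀ m r := h2
      nlinarith [mul_nonneg h3 h4]
  have hprod : ∀ r ∈ Ioo 0 R, pairSum c S₀ m r ^ 2 - pairGap c S₀ m r ^ 2
      = -4 * pairProduct c m r := fun r hr => by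
    rw [pairSum, pairGap, Real.sq_sqrt (hSqpos r hr).le, Real.sq_sqrt (hGpos r hr).le]; ring
  have hSd : ∀ r ∈ Ioo 0 R, _ := fun r hr =>
    hasDerivAt_pairSum hc (hgood r hr).1 (hgood r hr).2 (hSqpos r hr)
  have hGd : ∀ r ∈ Ioo 0 R, _ := fun r hr =>
    hasDerivAt_pairGap hc (hgood r hr).1 (hgood r hr).2 (hGpos r hr)
  have hScont : ContinuousOn (pairSum c S₀ m) (Ioo 0 R) := fun r hr => by
    obtain ⟨d, hd, -⟩ := hSd r hr
    exact hd.continuousAt.continuousWithinAt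
  have hGcont : ContinuousOn (pairGap c S₀ m) (Ioo 0 R) := fun r hr => by
    obtain ⟨d, hd, -⟩ := hGd r hr
    exact hd.continuousAt.continuousWithinAt
  have hAcont : Continuous (crestProfile c) := by unfold crestProfile; fun_prop
  have hFcont : ContinuousOn (pairSpeed c S₀ m) (Ioo 0 R) :=
    ((by fun_prop : Continuous fun r => c ^ 2 - crestProfile c r ^ 2).continuousOn.mul
      hGcont).mul hScont
  -- With $W=c^2-a^2$ the difference of the amplitudes is at least $2mW^{-1/4}$ and their sum at
  -- least $S_0/2$. So the speed is at least $mS_0W^{3/4}$, and $W\ge r/2$.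
  have hFlow : ∀ r ∈ Ioo 0 R, m * S₀ / 2 * r ^ (3 / 4 : ℝ) ≤ pairSpeed c S₀ m r := fun r hr => by
    have hW := (crestProfile_sq_bounds hc (hgood r hr).1 (hgood r hr).2).1
    have hr0 := hr.1
    set W := c ^ 2 - crestProfile c r ^ 2 with hWdef
    have hW0 : 0 < W := by linarith
    have h1 : m * (2 * W ^ (-(1 / 4) : ℝ)) ≤ pairGap c S₀ m r := by
      have := hGlow r hr
      rw [hNsqrt r hr] at this
      linarith
    have h2 : W * W ^ (-(1 / 4) : ℝ) = W ^ (3 / 4 : ℝ) := by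
      rw [← Real.rpow_one_add' hW0.le (by norm_num)]; norm_num
    have h3 : (r / 2) ^ (3 / 4 : ℝ) ≤ W ^ (3 / 4 : ℝ) :=
      Real.rpow_le_rpow (by positivity) hW (by norm_num)
    have h4 : 1 / 2 * r ^ (3 / 4 : ℝ) ≤ (r / 2) ^ (3 / 4 : ℝ) := by
      rw [div_eq_mul_inv r, mul_comm r, Real.mul_rpow (by norm_num) hr0.le]
      have h5 : (1 / 2 : ℝ) ≤ (2⁻¹ : ℝ) ^ (3 / 4 : ℝ) := by
        simpa using Real.rpow_le_rpow_of_exponent_ge (x := (2⁻¹ : ℝ)) (by norm_num) (by norm_num)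
          (show (3 / 4 : ℝ) ≤ 1 by norm_num)
      gcongr
    calc m * S₀ / 2 * r ^ (3 / 4 : ℝ) = 2 * m * (1 / 2 * r ^ (3 / 4 : ℝ)) * (S₀ / 2) := by ring
      _ ≤ 2 * m * W ^ (3 / 4 : ℝ) * (S₀ / 2) := by gcongr; exact h4.trans h3
      _ = W * (m * (2 * W ^ (-(1 / 4) : ℝ))) * (S₀ / 2) := by rw [← h2]; ring
      _ ≤ W * pairGap c S₀ m r * pairSum c S₀ m r := by
        have := hSle r hr
        gcongr
        exact (by positivity : 0 ≤ W * (m * (2 * W ^ (-(1 / 4) : ℝ)))).trans (by gcongr)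
  obtain ⟨T, T₁, hT, hT₁, hTle, q, hqc, hqm, hq0, hqT, hq⟩ := exists_leaving_solution hFcont
    (by positivity : 0 < m * S₀ / 2) hFlow (⟨hr₀, by linarith⟩ : r₀ ∈ Ioo 0 R)
  set S : ℝ → ℝ := fun t => pairSum c S₀ m (q t) with hSdef
  set Z : ℝ → ℝ := fun t => pairGap c S₀ m (q t) with hZdef
  -- The amplitudes are the two numbers with sum $S$ and product $-N$, since $Z^2=S^2+4N$.
  set p₁ : ℝ → ℝ := fun t => (S t - Z t) / 2 with hp₁
  set p₂ : ℝ → ℝ := fun t => (S t + Z t) / 2 with hp₂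
  set u₁ : ℝ → ℝ := fun t => c * p₁ t + crestProfile c (q t) * p₂ t with hu₁
  have hSt : ∀ t ∈ Ioo 0 T₁, HasDerivAt S (-(slopeProfile c (q t) * pairProduct c m (q t) *
      (c - crestProfile c (q t)) * Z t)) t := fun t ht => by
    obtain ⟨h1, h2⟩ := hq t ht
    obtain ⟨d, h3, h4⟩ := hSd _ h1
    exact (h3.comp t h2).congr_deriv h4
  have hZt : ∀ t ∈ Ioo 0 T₁, HasDerivAt Z (-(slopeProfile c (q t) * pairProduct c m (q t) *
      (c + crestProfile c (q t)) * S t)) t := fun t ht => by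
    obtain ⟨h1, h2⟩ := hq t ht
    obtain ⟨d, h3, h4⟩ := hGd _ h1
    exact (h3.comp t h2).congr_deriv h4
  have hPP : ∀ t ∈ Ioo 0 T₁, p₁ t * p₂ t = -pairProduct c m (q t) := fun t ht => by
    have := hprod _ (hq t ht).1
    simp only [hp₁, hp₂, hSdef, hZdef]
    linear_combination this / 4
  have hSm : Measurable S := by
    simp only [hSdef, pairSum, pairSumSq, pairProduct]
    have := hAcont.measurable
    have := hqc.measurable
    fun_prop
  have hZm : Measurable Z := by
    simp only [hZdef, pairGap, pairSumSq, pairProduct]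
    have := hAcont.measurable
    have := hqc.measurable
    fun_prop
  have hp₁m : Measurable p₁ := (hSm.sub hZm).div_const 2
  have hp₂m : Measurable p₂ := (hSm.add hZm).div_const 2
  have hu₁m : Measurable u₁ :=
    (hp₁m.const_mul c).add ((hAcont.comp hqc).measurable.mul hp₂m)
  have hsum : ∀ t, p₁ t + p₂ t = S t := fun t => by simp only [hp₁, hp₂]; ring
  have hp₂le : ∀ t ∈ Ioo 0 T₁, p₂ t ≤ S₀ + 2 * m * (q t) ^ (-(1 / 4) : ℝ) := fun t ht => by
    have h1 := (hq t ht).1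
    have h2 := hGup _ h1
    have h3 := hNup _ h1
    have h4 := hSlt _ h1
    simp only [hp₂, hSdef, hZdef]
    linarith
  have hp₂low : ∀ t ∈ Ioo 0 T₁, m * (4 * c * q t) ^ (-(1 / 4) : ℝ) ≤ p₂ t := fun t ht => by
    have h1 := (hq t ht).1
    have h2 := hGlow _ h1
    have h3 := hNlow _ h1
    have h4 := hSle _ h1
    simp only [hp₂, hSdef, hZdef]
    linarith
  have hq1 : ∀ t ∈ Ioo 0 T₁, q t ≤ 1 := fun t ht => by
    have h1 := hgood _ (hq t ht).1
    nlinarith [h1.1]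
  have hpow : ∀ x : ℝ, 0 < x → x ≤ 1 → x * (x ^ (-(1 / 4) : ℝ)) ^ 3 ≤ 1 ∧
      x * x ^ (-(1 / 4) : ℝ) ≤ 1 := fun x hx hx1 => by
    constructor
    · rw [← Real.rpow_natCast, ← Real.rpow_mul hx.le, ← Real.rpow_one_add' hx.le (by norm_num)]
      exact Real.rpow_le_one hx.le hx1 (by norm_num)
    · rw [← Real.rpow_one_add' hx.le (by norm_num)]
      exact Real.rpow_le_one hx.le hx1 (by norm_num)
  have hp₂pos : ∀ t ∈ Ioo 0 T₁, 0 ≤ p₂ t := fun t ht =>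
    le_trans (by have := (hq t ht).1.1; positivity) (hp₂low t ht)
  -- The height $u(q_1)=cS-(c-a)p_2$ stays bounded although $p_2$ grows like $r^{-1/4}$, because
  -- $c-a\le2r$. So the position can be integrated from time $0$.
  have hu₁b : ∀ t ∈ Ioo 0 T₁, |u₁ t| ≤ c * S₀ + 2 * (S₀ + 2 * m) := fun t ht => by
    have h1 := (hq t ht).1
    obtain ⟨h2, h3, h4⟩ := crestProfile_bounds hc (hgood _ h1).1 (hgood _ h1).2
    have h5 : u₁ t = c * S t - (c - crestProfile c (q t)) * p₂ t := by
      rw [← hsum]; simp only [hu₁]; ring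
    have h6 : 0 ≤ (c - crestProfile c (q t)) * p₂ t :=
      mul_nonneg (by linarith [h1.1]) (hp₂pos t ht)
    have h7 : (c - crestProfile c (q t)) * p₂ t ≤ 2 * (S₀ + 2 * m) := by
      calc (c - crestProfile c (q t)) * p₂ t
          ≤ (2 * q t) * (S₀ + 2 * m * (q t) ^ (-(1 / 4) : ℝ)) :=
            mul_le_mul h3 (hp₂le t ht) (hp₂pos t ht) (by linarith [h1.1])
        _ = 2 * (S₀ * q t + 2 * m * (q t * (q t) ^ (-(1 / 4) : ℝ))) := by ring
        _ ≤ 2 * (S₀ * 1 + 2 * m * 1) := by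
            have := (hpow _ h1.1 (hq1 t ht)).2
            have := hq1 t ht
            gcongr
        _ = _ := by ring
    have h8 : 0 ≤ c * S t := mul_nonneg (by linarith) (Real.sqrt_nonneg _)
    have h9 : c * S t ≤ c * S₀ := mul_le_mul_of_nonneg_left (hSlt _ h1).le (by linarith)
    rw [h5, abs_le]
    constructor <;> nlinarith
  -- The speed of the left peakon, cut off to the times where it is known to be bounded; its
  -- primitive vanishing at $0$ will be $q_1$.
  set h : ℝ → ℝ := (Ioo 0 T₁).indicator (fun t => u₁ t ^ 2) with hh
  have hhm : Measurable h := (hu₁m.pow_const 2).indicator measurableSet_Ioo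
  have hhint : ∀ a b, IntervalIntegrable h volume a b := fun a b => by
    refine (intervalIntegrable_const (c := (c * S₀ + 2 * (S₀ + 2 * m)) ^ 2)).mono_fun
      hhm.aestronglyMeasurable (Eventually.of_forall fun t => ?_)
    simp only [Real.norm_eq_abs]
    rw [abs_of_nonneg (sq_nonneg (c * S₀ + _))]
    by_cases ht : t ∈ Ioo 0 T₁
    · rw [hh, indicator_of_mem ht, abs_pow]
      exact pow_le_pow_left₀ (abs_nonneg _) (hu₁b t ht) 2
    · rw [hh, indicator_of_notMem ht, abs_zero]; positivity
  set q₁ : ℝ → ℝ := fun t => ∫ x in (0 : ℝ)..t, h x with hq₁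
  have hq₁c : Continuous q₁ := intervalIntegral.continuous_primitive hhint 0
  have hp₁t : ∀ t ∈ Ioo 0 T₁, HasDerivAt p₁ _ t := fun t ht =>
    ((hSt t ht).sub (hZt t ht)).div_const 2
  have hp₂t : ∀ t ∈ Ioo 0 T₁, HasDerivAt p₂ _ t := fun t ht =>
    ((hSt t ht).add (hZt t ht)).div_const 2
  have hq₁t : ∀ t ∈ Ioo 0 T₁, HasDerivAt q₁ (u₁ t ^ 2) t := fun t ht => by
    have hev : h =ᶠ[𝓝 t] fun t => u₁ t ^ 2 := by
      filter_upwards [isOpen_Ioo.mem_nhds ht] with x hx using indicator_of_mem hx _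
    have hu : ContinuousAt (fun t => u₁ t ^ 2) t :=
      ((continuousAt_const.mul (hp₁t t ht).continuousAt).add
        ((hAcont.comp hqc).continuousAt.mul (hp₂t t ht).continuousAt)).pow 2
    have := intervalIntegral.integral_hasDerivAt_right (hhint 0 t)
      hhm.stronglyMeasurable.stronglyMeasurableAtFilter (hu.congr hev.symm)
    rwa [hev.eq_of_nhds] at this
  have hsubT : ∀ t ∈ Ioc 0 T, t ∈ Ioo 0 T₁ := fun t ht => ⟨ht.1, ht.2.trans_lt hT₁⟩
  have hqd : ∀ t, q₁ t + q t - q₁ t = q t := fun t => by ring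
  refine ⟨T, hT, hTle.trans (le_of_eq ?_), p₁, p₂, q₁, fun t => q₁ t + q t, ?_, ?_, ?_, ?_, ?_, ?_,
    ?_⟩
  · congr 1; field_simp; norm_num
  · have hs : ∀ t ∈ Ioo 0 T, t ∈ Ioo 0 T₁ := fun t ht => hsubT t ⟨ht.1, ht.2.le⟩
    constructor
    · exact ⟨hp₁m, hp₂m, hq₁c.measurable, (hq₁c.add hqc).measurable⟩
    · intro t ht
      rw [hqd]
      have h1 := hgood _ (hq t (hs t ht)).1
      exact ⟨h1.1, by nlinarith [h1.1]⟩
    · refine ⟨S₀ + 8 * (S₀ ^ 3 + 8 * m ^ 3), fun t ht => ?_⟩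
      have ht' := hs t ht
      have h1 := (hq t ht').1
      have hSnn : 0 ≤ S t := Real.sqrt_nonneg _
      rw [hqd, hsum, abs_of_nonneg hSnn, abs_of_nonneg (hp₂pos t ht')]
      constructor
      · have : 0 ≤ 8 * (S₀ ^ 3 + 8 * m ^ 3) := by positivity
        exact (hSlt _ h1).le.trans (by linarith)
      · set y := q t ^ (-(1 / 4) : ℝ) with hy
        have hy0 : 0 ≤ y := Real.rpow_nonneg h1.1.le _
        have h2 : p₂ t ^ 3 ≤ (S₀ + 2 * m * y) ^ 3 :=
          pow_le_pow_left₀ (hp₂pos t ht') (hp₂le t ht') 3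
        have h3 : (S₀ + 2 * m * y) ^ 3 ≤ 8 * (S₀ ^ 3 + (2 * m * y) ^ 3) := by
          have : 0 ≤ 2 * m * y := by positivity
          nlinarith [mul_nonneg (add_nonneg hS₀.le this) (sq_nonneg (S₀ - 2 * m * y)),
            pow_nonneg hS₀.le 3, pow_nonneg this 3]
        have h4 := (hpow _ h1.1 (hq1 t ht')).1
        calc p₂ t ^ 3 * q t ≤ 8 * (S₀ ^ 3 + (2 * m * y) ^ 3) * q t :=
              mul_le_mul_of_nonneg_right (h2.trans h3) h1.1.le
          _ = 8 * (S₀ ^ 3 * q t + 8 * m ^ 3 * (q t * y ^ 3)) := by ring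
          _ ≤ 8 * (S₀ ^ 3 * 1 + 8 * m ^ 3 * 1) := by
              have := hq1 t ht'
              gcongr
          _ ≤ _ := by linarith
    · intro t ht
      refine (hp₁t t (hs t ht)).congr_deriv ?_
      rw [hqd, hPP t (hs t ht)]
      simp only [hp₁, hp₂]
      ring
    · intro t ht
      refine (hp₂t t (hs t ht)).congr_deriv ?_
      rw [hqd, hPP t (hs t ht)]
      simp only [hp₁, hp₂]
      ring
    · intro t ht
      exact ⟨_, hq₁t t (hs t ht), by rw [hqd]⟩
    · intro t ht
      refine ⟨_, (hq₁t t (hs t ht)).add (hq t (hs t ht)).2, ?_⟩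
      rw [hqd, pairSpeed]
      simp only [hu₁, hp₁, hp₂]
      change _ * (_ + _ * Z t * S t) = _
      ring
  · refine ⟨fun t ht => (hp₁t t (hsubT t ht)).continuousAt.continuousWithinAt,
      fun t ht => (hp₂t t (hsubT t ht)).continuousAt.continuousWithinAt, hq₁c, hq₁c.add hqc⟩
  · simp [hq₁]
  · simp [hq₁, hq0]
  · rw [hqd, hqT]
  · intro t ht
    have ht' := hsubT t ht
    have h1 := (hq t ht').1
    rw [hqd, hsum]
    refine ⟨h1.1, ?_, ?_, hSlt _ h1, hp₂low t ht', hp₂le t ht'⟩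
    · rw [← hqT]; exact hqm.monotone ht.2
    · exact lt_of_lt_of_le (by positivity) (hSle _ h1)
  · simp only [hsum]
    have hlow : Tendsto (fun t => √(S₀ ^ 2 - 4 * m ^ 2 * √(q t))) (𝓝[>] 0) (𝓝 S₀) := by
      have : Continuous fun t => √(S₀ ^ 2 - 4 * m ^ 2 * √(q t)) := by fun_prop
      have := this.tendsto 0
      simp only [hq0, Real.sqrt_zero, mul_zero, sub_zero, Real.sqrt_sq hS₀.le] at this
      exact this.mono_left nhdsWithin_le_nhds
    refine tendsto_of_tendsto_of_tendsto_of_le_of_le' hlow tendsto_const_nhds ?_ ?_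
    · filter_upwards [Ioo_mem_nhdsGT (hT.trans hT₁)] with t ht
      have h1 := (hq t ht).1
      exact Real.sqrt_le_sqrt (pairSumSq_bounds hc hm (hgood _ h1).1 (hgood _ h1).2).1
    · filter_upwards [Ioo_mem_nhdsGT (hT.trans hT₁)] with t ht
      exact (hSlt _ (hq t ht).1).le

/-! ### Ill-posedness from the two-peakon solutions -/

section IllPosed

variable {Ξ : Type} [MeasurableSpace Ξ] [AddGroup Ξ] [MeasurableNeg Ξ] {ν : Measure Ξ}
  [ν.IsNegInvariant] {j : Ξ → ℝ} {hj : Measurable j} (hF : FreqScale ν j) {s : ℝ}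
  (hs : s < 3 / 2) {κ c : ℝ}

/-- A notion of solution on `[0,T]` that admits the solutions made of two peakons. -/
structure AdmitsPeakons (κ c : ℝ) (Sol : ℝ → (ℝ → realSobolev ν j hj s) → Prop) : Prop where
  continuousOn : ∀ T U, Sol T U → ContinuousOn U (Icc 0 T)
  mono : ∀ T T' U, T' ≤ T → Sol T U → Sol T' U
  -- Agreement is required only on the open interval. At an endpoint the crests may coincide and the
  -- amplitudes blow up, and the value of `U` is then fixed by continuity.
  flow : ∀ T p₁ p₂ q₁ q₂ (U : ℝ → realSobolev ν j hj s), 0 < T →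
    TwoPeakonFlow c T p₁ p₂ q₁ q₂ →
    ContinuousOn U (Icc 0 T) →
    (∀ t ∈ Ioo 0 T, U t = peakonPair hj hF hs κ (p₁ t) (p₂ t) (q₁ t) (q₂ t)) → Sol T U

variable {Sol : ℝ → (ℝ → realSobolev ν j hj s) → Prop}

/-- A peakon of amplitude one may travel on unchanged or split. Below $5/4$ the splitting is
continuous at time $0$ because the dipole vanishes there, and afterwards the total amplitude is
strictly less than one. -/
theorem not_uniqueSolutions (hκ : κ ≠ 0) (hc : 1 ≤ c) (hSol : AdmitsPeakons hF hs κ c Sol)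
    (hs' : s < 5 / 4) : ¬ UniqueSolutions Sol := by
  intro huniq
  -- This separation makes both $8cr_0\le1$ and $8\sqrt{r_0}\le1$, as needed for $m=S_0=1$.
  have hr₀ : (0 : ℝ) < 1 / (64 * c) := by positivity
  have hsq : √(1 / (64 * c)) ≤ 1 / 8 := by
    rw [Real.sqrt_le_iff, div_le_iff₀ (by positivity)]
    constructor
    · norm_num
    · linarith
  obtain ⟨T, hT, -, p₁, p₂, q₁, q₂, hflow, ⟨c1, c2, c3, c4⟩, hq₁0, hq₂0, -, hb, hlim⟩ :=
    exists_emanating_pair hc one_pos one_pos hr₀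
      (by field_simp; norm_num) (by linarith)
  set V : ℝ → realSobolev ν j hj s := fun t =>
    peakonPair hj hF hs κ 1 0 ((c * 1) ^ 2 * t) ((c * 1) ^ 2 * t + 1 / 2) with hV
  set P : ℝ → realSobolev ν j hj s := fun t =>
    peakonPair hj hF hs κ (p₁ t) (p₂ t) (q₁ t) (q₂ t) with hP
  have hVc : Continuous V := by
    rw [← continuousOn_univ]
    exact continuousOn_peakonPair hj hF hs κ continuousOn_const continuousOn_const
      (by fun_prop) (by fun_prop)
  have hVsol : Sol T V :=
    hSol.flow T _ _ _ _ V hT (twoPeakonFlow_single c 1 T) hVc.continuousOn fun t _ => rfl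
  have hdiff : Icc 0 T \ {0} = Ioc (0 : ℝ) T := by
    ext t; simp only [Set.mem_sdiff, mem_Icc, mem_singleton_iff, mem_Ioc]
    constructor
    · rintro ⟨⟨h1, h2⟩, h3⟩; exact ⟨lt_of_le_of_ne h1 (Ne.symm h3), h2⟩
    · rintro ⟨h1, h2⟩; exact ⟨⟨h1.le, h2⟩, h1.ne'⟩
  have hqlim : Tendsto (fun t => q₂ t - q₁ t) (𝓝[>] 0) (𝓝 0) := by
    have : Tendsto (fun t => q₂ t - q₁ t) (𝓝 0) (𝓝 (q₂ 0 - q₁ 0)) := (c4.sub c3).tendsto 0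
    rw [hq₁0, hq₂0, sub_zero] at this
    exact this.mono_left nhdsWithin_le_nhds
  have hIoc : ∀ᶠ t in 𝓝[>] (0 : ℝ), t ∈ Ioc 0 T := Ioc_mem_nhdsGT hT
  have hPlim : Tendsto P (𝓝[>] 0) (𝓝 (V 0)) := by
    rw [tendsto_subtype_rng]
    -- The decay $r^\theta$ must beat the growth $r^{-1/4}$ of the amplitude, so $1/4<\theta<3/2-s$
    -- is needed; this is possible because $s<5/4$.
    set θ := min 1 ((1 / 4 + (3 / 2 - s)) / 2) with hθ
    have hθ1 : 1 / 4 < θ := lt_min (by norm_num) (by linarith)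
    obtain ⟨C, hC0, hC⟩ := exists_norm_peakonLp_sub_le hF hs κ (by linarith : 0 < θ)
      (min_le_left _ _) ((min_le_right _ _).trans_lt (by linarith))
    have h1 : Tendsto (fun t => ((p₁ t + p₂ t : ℝ) : ℂ) • peakonLp hF hs κ (q₁ t)) (𝓝[>] 0)
        (𝓝 (((1 : ℝ) : ℂ) • peakonLp hF hs κ 0)) := by
      refine ((Complex.continuous_ofReal.tendsto 1).comp hlim).smul ?_
      have := ((continuous_peakonLp hF hs κ).comp c3).tendsto 0
      simp only [Function.comp_apply, hq₁0] at this
      exact this.mono_left nhdsWithin_le_nhds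
    have h2 : Tendsto (fun t => (p₂ t : ℂ) • (peakonLp hF hs κ (q₂ t) - peakonLp hF hs κ (q₁ t)))
        (𝓝[>] 0) (𝓝 0) := by
      refine squeeze_zero_norm' (a := fun t => C * ((q₂ t - q₁ t) ^ θ +
        2 * (q₂ t - q₁ t) ^ (θ - 1 / 4))) ?_ ?_
      · filter_upwards [hIoc] with t ht
        obtain ⟨b1, b2, b3, b4, b5, b6⟩ := hb t ht
        have h3 : 0 ≤ p₂ t := le_trans (by positivity) b5
        rw [norm_smul, Complex.norm_real, Real.norm_of_nonneg h3]
        have h4 := hC (q₂ t) (q₁ t)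
        rw [abs_of_pos b1] at h4
        calc p₂ t * ‖peakonLp hF hs κ (q₂ t) - peakonLp hF hs κ (q₁ t)‖
            ≤ (1 + 2 * 1 * (q₂ t - q₁ t) ^ (-(1 / 4) : ℝ)) * (C * (q₂ t - q₁ t) ^ θ) := by
              gcongr
          _ = C * ((q₂ t - q₁ t) ^ θ +
              2 * ((q₂ t - q₁ t) ^ (-(1 / 4) : ℝ) * (q₂ t - q₁ t) ^ θ)) := by ring
          _ = _ := by rw [← Real.rpow_add b1]; ring_nf
      · have h3 := hqlim.rpow_const (p := θ) (Or.inr (by linarith))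
        have h4 := hqlim.rpow_const (p := θ - 1 / 4) (Or.inr (by linarith))
        rw [Real.zero_rpow (by linarith)] at h3 h4
        simpa using (h3.add (h4.const_mul 2)).const_mul C
    have h3 : ((V 0).1 : Lp ℂ 2 (freqMeasure ν j s)) = ((1 : ℝ) : ℂ) • peakonLp hF hs κ 0 + 0 := by
      simp [hV, peakonPair]
    rw [h3]
    refine (h1.add h2).congr fun t => ?_
    rw [hP, peakonPair_eq_add]
  -- At $t=0$ the amplitudes carry no information, so the limit is inserted as the value.
  have hU : ContinuousOn (Function.update P 0 (V 0)) (Icc 0 T) := by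
    rw [continuousOn_update_iff, hdiff]
    refine ⟨continuousOn_peakonPair hj hF hs κ c1 c2 c3.continuousOn c4.continuousOn, fun _ => ?_⟩
    exact hPlim.mono_left (nhdsWithin_mono _ Ioc_subset_Ioi_self)
  have hUsol : Sol T (Function.update P 0 (V 0)) :=
    hSol.flow T p₁ p₂ q₁ q₂ _ hT hflow hU fun t ht => Function.update_of_ne ht.1.ne' _ _
  have h := huniq T hT _ _ hUsol hVsol (Function.update_self _ _ _) T ⟨hT.le, le_rfl⟩
  rw [Function.update_of_ne hT.ne'] at h
  -- The two solutions are told apart at time $T$ by frequency zero.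
  have h1 := add_eq_add_of_peakonPair_eq hj hF hs κ hκ h
  have h2 := (hb T ⟨hT, le_rfl⟩).2.2.2.1
  linarith

/-- The choice $m=r^{1/4-\theta/2}$ balances the requirements: the singular part of the dipole and
the lifetime are of order $r^{\theta/2}$, the energy defect of order $r^{1-\theta}$, and all tend to
zero with $r$. -/
theorem exists_small_parameters {c η ε C θ : ℝ} (hη : 0 < η) (hε : 0 < ε)
    (hθ : 0 < θ) (hθ1 : θ < 1) :
    ∃ r > 0, ∃ m > 0, 8 * c * r ≤ 1 ∧ 8 * m ^ 2 * √r ≤ η ^ 2 ∧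
      8 / (m * η) * r ^ (1 / 4 : ℝ) < ε ∧
      (η + 2 * m * r ^ (-(1 / 4) : ℝ)) * (C * r ^ θ) < ε := by
  have hlim : ∀ a : ℝ, 0 < a → Tendsto (fun r : ℝ => r ^ a) (𝓝[>] 0) (𝓝 0) := fun a ha => by
    have := (tendsto_id (x := 𝓝 (0 : ℝ))).rpow_const (p := a) (Or.inr ha.le)
    rw [Real.zero_rpow ha.ne'] at this
    exact this.mono_left nhdsWithin_le_nhds
  have e1 : ∀ᶠ r : ℝ in 𝓝[>] 0, 8 * c * r < 1 := by
    have : Tendsto (fun r : ℝ => 8 * c * r) (𝓝[>] 0) (𝓝 0) := by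
      have : Continuous fun r : ℝ => 8 * c * r := by fun_prop
      simpa using (this.tendsto 0).mono_left nhdsWithin_le_nhds
    exact this.eventually_lt_const one_pos
  have e2 : ∀ᶠ r : ℝ in 𝓝[>] 0, 8 * r ^ (1 - θ) < η ^ 2 := by
    have := (hlim (1 - θ) (by linarith)).const_mul 8
    rw [mul_zero] at this
    exact this.eventually_lt_const (by positivity)
  have e3 : ∀ᶠ r : ℝ in 𝓝[>] 0, 8 / η * r ^ (θ / 2) < ε := by
    have := (hlim (θ / 2) (by linarith)).const_mul (8 / η)
    rw [mul_zero] at this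
    exact this.eventually_lt_const hε
  have e4 : ∀ᶠ r : ℝ in 𝓝[>] 0, C * (η * r ^ θ + 2 * r ^ (θ / 2)) < ε := by
    have := (((hlim θ hθ).const_mul η).add ((hlim (θ / 2) (by linarith)).const_mul 2)).const_mul C
    rw [mul_zero, mul_zero, add_zero, mul_zero] at this
    exact this.eventually_lt_const hε
  obtain ⟨r, h1, h2, h3, h4, h0⟩ := (e1.and (e2.and (e3.and (e4.and self_mem_nhdsWithin)))).exists
  have hr : 0 < r := h0
  refine ⟨r, hr, r ^ (1 / 4 - θ / 2), by positivity, h1.le, ?_, ?_, ?_⟩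
  · have : (r ^ (1 / 4 - θ / 2)) ^ 2 * √r = r ^ (1 - θ) := by
      rw [Real.sqrt_eq_rpow, ← Real.rpow_natCast, ← Real.rpow_mul hr.le, ← Real.rpow_add hr]
      congr 1; push_cast; ring
    rw [mul_assoc, this]; exact h2.le
  · have : r ^ (1 / 4 : ℝ) = r ^ (1 / 4 - θ / 2) * r ^ (θ / 2) := by
      rw [← Real.rpow_add hr]; ring_nf
    have h5 : 0 < r ^ (1 / 4 - θ / 2) := by positivity
    rw [this]
    refine lt_of_eq_of_lt ?_ h3
    field_simp
  · have : r ^ (1 / 4 - θ / 2) * r ^ (-(1 / 4) : ℝ) * r ^ θ = r ^ (θ / 2) := by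
      rw [← Real.rpow_add hr, ← Real.rpow_add hr]; ring_nf
    refine lt_of_eq_of_lt ?_ h4
    rw [← this]; ring

/-- The splitting pair run backwards. It starts at separation $r$ with a small $m$, hence with a
small datum. Near the collision the dipole has norm at least a constant times $(q_2-q_1)^{5/4-s}$,
which is unbounded above the critical exponent and bounded away from zero at it; the latter already
excludes a limit. -/
theorem exists_colliding_pair (hκ : κ ≠ 0) (hc : 1 ≤ c) (hSol : AdmitsPeakons hF hs κ c Sol)
    (hs' : 5 / 4 ≤ s) {ε : ℝ} (hε : 0 < ε) :
    ∃ T : ℝ, 0 < T ∧ T < ε ∧ ∃ U : ℝ → realSobolev ν j hj s, (∀ T' ∈ Ioo 0 T, Sol T' U) ∧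
      ‖U 0‖ < ε ∧ (5 / 4 < s → Tendsto (fun t => ‖U t‖) (𝓝[<] T) atTop) ∧
      ∀ W, ¬ Tendsto U (𝓝[<] T) (𝓝 W) := by
  set θ := (3 / 2 - s) / 2 with hθ
  have hθ0 : 0 < θ := by linarith
  obtain ⟨C, hC0, hC⟩ := exists_norm_peakonLp_sub_le hF hs κ hθ0 (by linarith) (by linarith)
  obtain ⟨d, hd0, hd⟩ := exists_le_norm_peakonLp_sub hF hs κ hκ
  set M := ‖peakonLp hF hs κ 0‖ with hM
  have hM0 : 0 ≤ M := norm_nonneg _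
  -- The peakon with the total amplitude gets half of $\varepsilon$, the dipole the other half.
  set η := ε / (2 * (M + 1)) with hη
  have hη0 : 0 < η := by positivity
  have hηM : η * M ≤ ε / 2 := by
    rw [hη, div_mul_eq_mul_div, div_le_div_iff₀ (by positivity) two_pos]
    nlinarith
  obtain ⟨r, hr0, m, hm0, k1, k2, k3, k4⟩ := exists_small_parameters (c := c) (C := C) hη0
    (half_pos hε) hθ0 (by linarith)
  obtain ⟨T, hT, hTle, p₁, p₂, q₁, q₂, hflow, ⟨c1, c2, c3, c4⟩, hq₁0, hq₂0, hqT, hb, hlim⟩ :=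
    exists_emanating_pair hc hη0 hm0 hr0 k1 k2
  have hr4 : r ≤ 1 / 8 := by nlinarith
  have hTmem : T ∈ Ioc 0 T := ⟨hT, le_rfl⟩
  have hp₂ : ∀ t ∈ Ioc 0 T, 0 ≤ p₂ t := fun t ht =>
    le_trans (by have := (hb t ht).1; positivity) (hb t ht).2.2.2.2.1
  set U : ℝ → realSobolev ν j hj s := fun t =>
    peakonPair hj hF hs κ (p₂ (T - t)) (p₁ (T - t)) (-q₂ (T - t)) (-q₁ (T - t)) with hU
  have hU' : ∀ t, U t =
      peakonPair hj hF hs κ (p₁ (T - t)) (p₂ (T - t)) (-q₁ (T - t)) (-q₂ (T - t)) :=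
    fun t => peakonPair_swap _ _ _ _ _ _ _ _
  -- The amplitude contributes $r^{-1/4}$, the translation difference $r^{3/2-s}$.
  have hlow : ∀ t ∈ Ioc 0 T, m * (4 * c) ^ (-(1 / 4) : ℝ) * d * (q₂ t - q₁ t) ^ (5 / 4 - s)
      ≤ |p₂ t| * ‖peakonLp hF hs κ (-q₂ t) - peakonLp hF hs κ (-q₁ t)‖ := fun t ht => by
    obtain ⟨b1, b2, b3, b4, b5, b6⟩ := hb t ht
    have h1 : |(-q₂ t) - (-q₁ t)| = q₂ t - q₁ t := by
      rw [← abs_neg, show -(-q₂ t - -q₁ t) = q₂ t - q₁ t by ring, abs_of_pos b1]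
    have h2 := hd (-q₂ t) (-q₁ t) (fun h => by linarith) (by rw [h1]; linarith)
    rw [h1] at h2
    rw [abs_of_nonneg (hp₂ t ht)]
    calc m * (4 * c) ^ (-(1 / 4) : ℝ) * d * (q₂ t - q₁ t) ^ (5 / 4 - s)
        = m * ((4 * c) ^ (-(1 / 4) : ℝ) * (q₂ t - q₁ t) ^ (-(1 / 4) : ℝ)) *
          (d * (q₂ t - q₁ t) ^ (3 / 2 - s)) := by
          rw [show 5 / 4 - s = -(1 / 4) + (3 / 2 - s) by ring, Real.rpow_add b1]; ring
      _ = m * (4 * c * (q₂ t - q₁ t)) ^ (-(1 / 4) : ℝ) * (d * (q₂ t - q₁ t) ^ (3 / 2 - s)) := by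
          rw [← Real.mul_rpow (by positivity) b1.le]
      _ ≤ _ := mul_le_mul b5 h2 (by positivity) (hp₂ t ht)
  have hKpos : 0 < m * (4 * c) ^ (-(1 / 4) : ℝ) * d := by positivity
  have hqlim : Tendsto (fun t => q₂ t - q₁ t) (𝓝[>] 0) (𝓝 0) := by
    have : Tendsto (fun t => q₂ t - q₁ t) (𝓝 0) (𝓝 (q₂ 0 - q₁ 0)) := (c4.sub c3).tendsto 0
    rw [hq₁0, hq₂0, sub_zero] at this
    exact this.mono_left nhdsWithin_le_nhds
  have hrev : Tendsto (fun t => T - t) (𝓝[<] T) (𝓝[>] 0) := by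
    refine tendsto_nhdsWithin_iff.2 ⟨?_, ?_⟩
    · have : Continuous fun t => T - t := by fun_prop
      simpa using (this.tendsto T).mono_left nhdsWithin_le_nhds
    · filter_upwards [self_mem_nhdsWithin] with t ht
      exact sub_pos.2 (mem_Iio.1 ht)
  have hIoc : ∀ᶠ t in 𝓝[>] (0 : ℝ), t ∈ Ioc 0 T := Ioc_mem_nhdsGT hT
  refine ⟨T, hT, hTle.trans_lt (k3.trans (by linarith)), U, ?_, ?_, ?_, ?_⟩
  · intro T' hT'
    refine hSol.flow T' _ _ _ _ U hT'.1 (hflow.reverse.mono hT'.2.le) ?_ fun t _ => rfl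
    have hmaps : MapsTo (fun t => T - t) (Icc 0 T') (Ioc 0 T) := fun t ht =>
      ⟨by linarith [ht.2, hT'.2], by linarith [ht.1]⟩
    have hsub : ContinuousOn (fun t => T - t) (Icc 0 T') := by fun_prop
    exact continuousOn_peakonPair hj hF hs κ (c2.comp hsub hmaps) (c1.comp hsub hmaps)
      (by fun_prop) (by fun_prop)
  · obtain ⟨b1, b2, b3, b4, b5, b6⟩ := hb T hTmem
    rw [hU', sub_zero]
    refine (norm_peakonPair_le hj hF hs κ _ _ _ _).trans_lt ?_
    have h1 := hC (-q₂ T) (-q₁ T)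
    rw [← abs_neg (-q₂ T - -q₁ T), show -(-q₂ T - -q₁ T) = r by rw [← hqT]; ring,
      abs_of_pos hr0] at h1
    rw [hqT] at b6
    rw [abs_of_pos b3, abs_of_nonneg (hp₂ T hTmem)]
    have h2 := mul_le_mul b6 h1 (norm_nonneg _) (by positivity)
    have h3 : (p₁ T + p₂ T) * M ≤ η * M := by gcongr
    linarith
  · intro hs''
    have h1 : Tendsto (fun t => m * (4 * c) ^ (-(1 / 4) : ℝ) * d * (q₂ t - q₁ t) ^ (5 / 4 - s)
        - η * M) (𝓝[>] 0) atTop := by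
      refine tendsto_atTop_add_const_right _ _ (Tendsto.const_mul_atTop hKpos ?_)
      refine (tendsto_rpow_neg_nhdsGT_zero (by linarith : 5 / 4 - s < 0)).comp
        (tendsto_nhdsWithin_iff.2 ⟨hqlim, ?_⟩)
      filter_upwards [hIoc] with t ht using (hb t ht).1
    refine tendsto_atTop_mono' _ ?_ (h1.comp hrev)
    filter_upwards [hrev.eventually hIoc] with t ht
    rw [hU']
    refine le_trans ?_ (le_norm_peakonPair hj hF hs κ _ _ _ _)
    obtain ⟨b1, b2, b3, b4, b5, b6⟩ := hb _ ht
    have h2 := hlow _ ht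
    rw [abs_of_pos b3]
    have h3 : (p₁ (T - t) + p₂ (T - t)) * M ≤ η * M := by gcongr
    simp only [Function.comp_apply]
    linarith
  · intro W hW
    -- A sequence of times is taken because the nonconvergence argument extracts an almost
    -- everywhere convergent subsequence.
    set τ : ℕ → ℝ := fun n => T * (1 / ((n : ℝ) + 1)) with hτ
    have hτIoc : ∀ n, τ n ∈ Ioc 0 T := fun n => by
      refine ⟨by positivity, mul_le_of_le_one_right hT.le ?_⟩
      rw [div_le_one (by positivity)]
      linarith [(Nat.cast_nonneg n : (0 : ℝ) ≤ n)]
    have hτlim : Tendsto τ atTop (𝓝[>] 0) := by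
      refine tendsto_nhdsWithin_iff.2 ⟨?_, Eventually.of_forall fun n => (hτIoc n).1⟩
      have := (tendsto_one_div_add_atTop_nhds_zero_nat (𝕜 := ℝ)).const_mul T
      rwa [mul_zero] at this
    have hTτ : Tendsto (fun n => T - τ n) atTop (𝓝[<] T) := by
      refine tendsto_nhdsWithin_iff.2 ⟨?_, Eventually.of_forall fun n =>
        by have := (hτIoc n).1; simp only [mem_Iio]; linarith⟩
      simpa using (tendsto_nhdsWithin_iff.1 hτlim).1.const_sub T
    have h1 : Tendsto (fun n => p₂ (τ n) * (-q₂ (τ n) - -q₁ (τ n))) atTop (𝓝 0) := by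
      refine Tendsto.comp (g := fun t => p₂ t * (-q₂ t - -q₁ t)) ?_ hτlim
      refine squeeze_zero_norm' (a := fun t => η * (q₂ t - q₁ t) +
        2 * m * (q₂ t - q₁ t) ^ (3 / 4 : ℝ)) ?_ ?_
      · filter_upwards [hIoc] with t ht
        obtain ⟨b1, b2, b3, b4, b5, b6⟩ := hb t ht
        rw [show -q₂ t - -q₁ t = -(q₂ t - q₁ t) by ring, mul_neg, norm_neg, norm_mul,
          Real.norm_of_nonneg b1.le, Real.norm_of_nonneg (hp₂ t ht)]
        calc p₂ t * (q₂ t - q₁ t)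
            ≤ (η + 2 * m * (q₂ t - q₁ t) ^ (-(1 / 4) : ℝ)) * (q₂ t - q₁ t) := by gcongr
          _ = η * (q₂ t - q₁ t) +
              2 * m * ((q₂ t - q₁ t) * (q₂ t - q₁ t) ^ (-(1 / 4) : ℝ)) := by ring
          _ = _ := by rw [← Real.rpow_one_add' b1.le (by norm_num)]; norm_num
      · have h4 := hqlim.rpow_const (p := 3 / 4) (Or.inr (by norm_num))
        rw [Real.zero_rpow (by norm_num)] at h4
        simpa using (hqlim.const_mul η).add (h4.const_mul (2 * m))
    have h2 := tendsto_of_tendsto_peakonPair hj hF hs κ (p₁ := fun n => p₁ (τ n))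
      (p₂ := fun n => p₂ (τ n)) (q₁ := fun n => -q₁ (τ n)) (q₂ := fun n => -q₂ (τ n)) (W := W)
      (hlim.comp hτlim)
      ((c3.neg.tendsto 0).comp (hτlim.mono_right nhdsWithin_le_nhds)) h1 (by
        refine (hW.comp hTτ).congr fun n => ?_
        simp only [Function.comp_apply, hU']
        congr 2 <;> ring_nf)
    -- A limit would force the dipole to zero, but its norm is at least this constant: the distance
    -- is below one and $5/4-s\le0$.
    have h3 : m * (4 * c) ^ (-(1 / 4) : ℝ) * d ≤ 0 := by
      refine ge_of_tendsto' h2 fun n => le_trans ?_ (hlow _ (hτIoc n))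
      obtain ⟨b1, b2, -⟩ := hb _ (hτIoc n)
      refine le_mul_of_one_le_right hKpos.le
        (Real.one_le_rpow_of_pos_of_le_one_of_nonpos b1 (by linarith) (by linarith))
    linarith

/-- For $s\ge5/4$, a common existence time near the zero datum gives a solution that starts like a
colliding pair and exists beyond the collision. Uniqueness identifies the two before the collision,
and then continuity in time provides the limit that the pair does not have. Continuity of the
solution map in the datum plays no role in this contradiction. The alternative at $s=5/4$ restates
the failure of well-posedness. -/
theorem ill_posed (hκ : κ ≠ 0) (hc : 1 ≤ c) (hSol : AdmitsPeakons hF hs κ c Sol) :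
    ¬ WellPosed Sol ∧
      (5 / 4 < s → NormInflation Sol ∧
        ∀ T > 0, Sol T (fun _ => 0) ∧ ¬ SolutionMapContinuousAt Sol T (fun _ => 0)) ∧
      (s < 5 / 4 → ¬ UniqueSolutions Sol) ∧
      (s = 5 / 4 → ¬ HasContinuousSolutionMap Sol ∨ ¬ UniqueSolutions Sol) := by
  have hlow : s < 5 / 4 → ¬ UniqueSolutions Sol := not_uniqueSolutions hF hs hκ hc hSol
  have hwp : ¬ WellPosed Sol := by
    rintro ⟨huniq, hmap⟩
    rcases lt_or_ge s (5 / 4) with h | h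
    · exact hlow h huniq
    obtain ⟨T, hT, r, hr, S, hS, -⟩ := hmap 0
    obtain ⟨T₁, hT₁, hTlt, U, hU, hU0, -, hnot⟩ :=
      exists_colliding_pair hF hs hκ hc hSol h (lt_min hT hr)
    obtain ⟨hV, hV0⟩ := hS (U 0) (by
      rw [mem_ball_zero_iff]; exact hU0.trans_le (min_le_right _ _))
    have hT₁T : T₁ < T := hTlt.trans_le (min_le_left _ _)
    refine hnot (S (U 0) T₁) ?_
    have hc1 := (hSol.continuousOn _ _ hV T₁ ⟨hT₁.le, hT₁T.le⟩).tendsto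
    have hc2 : Tendsto (S (U 0)) (𝓝[<] T₁) (𝓝 (S (U 0) T₁)) := by
      refine hc1.mono_left (nhdsWithin_le_of_mem ?_)
      filter_upwards [Ioo_mem_nhdsLT hT₁] with t ht
      exact ⟨ht.1.le, ht.2.le.trans hT₁T.le⟩
    refine hc2.congr' ?_
    filter_upwards [Ioo_mem_nhdsLT hT₁] with t ht
    -- The pair is a solution only on intervals ending before $T_1$, so uniqueness is applied up to
    -- a time between $t$ and $T_1$.
    have hmid : (t + T₁) / 2 ∈ Ioo 0 T₁ := ⟨by linarith [ht.1], by linarith [ht.2]⟩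
    exact huniq _ hmid.1 _ _ (hSol.mono _ _ _ (hmid.2.trans hT₁T).le hV) (hU _ hmid) hV0 t
      ⟨ht.1.le, by linarith [ht.2]⟩
  refine ⟨hwp, fun h => ⟨fun ε hε => ?_, fun T hT => ⟨?_, fun hcont => ?_⟩⟩, hlow, fun _ => ?_⟩
  · obtain ⟨T, hT, hTε, U, hU, hU0, hinf, -⟩ := exists_colliding_pair hF hs hκ hc hSol h.le hε
    exact ⟨T, hT, hTε, U, hU, hU0, hinf h⟩
  · refine hSol.flow T _ _ _ _ _ hT (twoPeakonFlow_single c 0 T) continuousOn_const fun t _ => ?_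
    exact (peakonPair_zero hj hF hs κ _ _).symm
  · obtain ⟨δ, hδ, hδ'⟩ := hcont 1 one_pos
    obtain ⟨T₁, hT₁, hTlt, U, hU, hU0, hinf, -⟩ :=
      exists_colliding_pair hF hs hκ hc hSol h.le (lt_min hT hδ)
    obtain ⟨t, ht1, ht2⟩ := (((hinf h).eventually_ge_atTop 1).and (Ioo_mem_nhdsLT hT₁)).exists
    have hmid : (t + T₁) / 2 ∈ Ioo 0 T₁ := ⟨by linarith [ht2.1], by linarith [ht2.2]⟩
    have := hδ' ((t + T₁) / 2) ⟨hmid.1, (hmid.2.trans (hTlt.trans_le (min_le_left _ _))).le⟩ U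
      (hU _ hmid) (by rw [sub_zero]; exact hU0.trans_le (min_le_right _ _)) t
      ⟨ht2.1.le, by linarith [ht2.2]⟩
    rw [sub_zero] at this
    linarith
  · by_contra! hboth
    exact hwp ⟨hboth.2, hboth.1⟩

end IllPosed

/-! ### Pairs of peakons as weak solutions -/

/-- The superposition of two translates of the profile `k`. -/
def pairField (k : ℝ → ℝ) (p₁ p₂ q₁ q₂ x : ℝ) : ℝ := p₁ * k (x - q₁) + p₂ * k (x - q₂)

/-- The properties of a domain `X` (the line, or a period of the circle) with Green function `G`
that make pairs of peakons with profile `2 * G`, whose derivative is `dg`, weak solutions. The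
predicate `Adm` singles out the smooth functions of the space variable that are admissible for
testing. -/
structure PeakonGeometry (X : Set ℝ) (G dg : ℝ → ℝ) (Test : ℝ → (ℝ → ℝ → ℝ) → Prop)
    (Adm : (ℝ → ℝ) → Prop) (c : ℝ) : Prop where
  measurable_G : Measurable G
  measurable_dg : Measurable dg
  bdd : ∃ M : ℝ, ∀ x, |2 * G x| ≤ M ∧ |dg x| ≤ M
  lintegral_le : ∃ C : ℝ, 0 ≤ C ∧ ∀ q, ∫⁻ x in X, ‖2 * G (x - q)‖ₑ ≤ ENNReal.ofReal C ∧
    ∫⁻ x in X, ‖dg (x - q)‖ₑ ≤ ENNReal.ofReal C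
  -- In $L^1$ a translation costs its length even for the discontinuous slope: the jump contributes
  -- its height times $r-q$.
  lintegral_sub_le : ∃ C : ℝ, 0 ≤ C ∧ ∀ q r, q < r → r < q + 1 →
    ∫⁻ x in X, ‖2 * G (x - r) - 2 * G (x - q)‖ₑ ≤ ENNReal.ofReal (C * (r - q)) ∧
    ∫⁻ x in X, ‖dg (x - r) - dg (x - q)‖ₑ ≤ ENNReal.ofReal (C * (r - q))
  even : ∀ x, G (-x) = G x
  adm_continuous : ∀ h, Adm h → Continuous h
  adm_integrable : ∀ h, Adm h → IntegrableOn h X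
  adm_bdd : ∀ h, Adm h → ∃ B, ∀ x, |h x| ≤ B
  -- In this form the dependence on $q$ sits in the smooth factor and can be differentiated.
  conv : ∀ h, Adm h → ∀ q, invD2 X G h q = ∫ y in X, G y * h (q - y)
  weak : ∀ h, Adm h → ∀ q,
    ∫ x in X, 2 * G (x - q) * deriv h x = -∫ x in X, dg (x - q) * h x
  -- The spatial part of the equation at a fixed time, with both potentials moved onto the test
  -- function; the right-hand side collects the jumps at the two crests.
  jump : ∀ h, Adm h → Adm (deriv h) → ∀ p₁ p₂ q₁ q₂ : ℝ, q₁ < q₂ → q₂ < q₁ + 1 →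
    ∫ x in X, (pairField (fun x => 2 * G x) p₁ p₂ q₁ q₂ x ^ 2 * pairField dg p₁ p₂ q₁ q₂ x * h x
      - (pairField (fun x => 2 * G x) p₁ p₂ q₁ q₂ x ^ 3 + 3 / 2 *
          pairField (fun x => 2 * G x) p₁ p₂ q₁ q₂ x * pairField dg p₁ p₂ q₁ q₂ x ^ 2)
        * invD2 X G (deriv h) x
      + 1 / 2 * pairField dg p₁ p₂ q₁ q₂ x ^ 3 * invD2 X G h x)
    = 2 * p₁ * ((c * p₁ + crestProfile c (q₂ - q₁) * p₂) *
          (p₂ * slopeProfile c (q₂ - q₁)) * invD2 X G h q₁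
        - (c * p₁ + crestProfile c (q₂ - q₁) * p₂) ^ 2 * invD2 X G (deriv h) q₁)
      + 2 * p₂ * (-(crestProfile c (q₂ - q₁) * p₁ + c * p₂) *
          (p₁ * slopeProfile c (q₂ - q₁)) * invD2 X G h q₂
        - (crestProfile c (q₂ - q₁) * p₁ + c * p₂) ^ 2 * invD2 X G (deriv h) q₂)
  test_smooth : ∀ T φ, Test T φ → ContDiff ℝ ∞ (fun z : ℝ × ℝ => φ z.1 z.2)
  test_support : ∀ T φ, Test T φ → ∃ a b : ℝ, ∃ Y : Set ℝ, 0 < a ∧ b < T ∧ IsClosed Y ∧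
    volume (Y ∩ X) < ⊤ ∧ ∀ t x, φ t x ≠ 0 → t ∈ Icc a b ∧ x ∈ Y
  test_bdd : ∀ T φ, Test T φ → ∃ B : ℝ, ∀ z, |φ z.1 z.2| ≤ B ∧
    ‖fderiv ℝ (fun z : ℝ × ℝ => φ z.1 z.2) z‖ ≤ B
  test_adm : ∀ T φ, Test T φ → ∀ t, Adm (φ t) ∧ Adm (deriv (φ t)) ∧
    Adm (fun x => deriv (fun τ => φ τ x) t)

/-! ### Measurability and integrability of peakon fields -/

theorem pairField_eq_add (k : ℝ → ℝ) (p₁ p₂ q₁ q₂ x : ℝ) :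
    pairField k p₁ p₂ q₁ q₂ x = (p₁ + p₂) * k (x - q₁) + p₂ * (k (x - q₂) - k (x - q₁)) := by
  rw [pairField]; ring

theorem measurable_pairField {k : ℝ → ℝ} (hk : Measurable k) {p₁ p₂ q₁ q₂ : ℝ → ℝ}
    (h : Measurable p₁ ∧ Measurable p₂ ∧ Measurable q₁ ∧ Measurable q₂) :
    Measurable fun z : ℝ × ℝ => pairField k (p₁ z.1) (p₂ z.1) (q₁ z.1) (q₂ z.1) z.2 := by
  obtain ⟨h1, h2, h3, h4⟩ := h
  unfold pairField
  fun_prop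

/-- Splits into total amplitude and dipole and uses boundedness of $k$ to lower the cubes to first
powers. The difference then has $L^1$ norm of the order of the distance, so only $|p_2|^3(q_2-q_1)$
has to be controlled. -/
theorem abs_pairField_pow_three_le {k : ℝ → ℝ} {M B : ℝ} (hM : ∀ x, |k x| ≤ M)
    {p₁ p₂ q₁ q₂ : ℝ} (hB : |p₁ + p₂| ≤ B) (x : ℝ) :
    |pairField k p₁ p₂ q₁ q₂ x| ^ 3 ≤ 4 * B ^ 3 * M ^ 2 * |k (x - q₁)|
      + 16 * M ^ 2 * |p₂| ^ 3 * |k (x - q₂) - k (x - q₁)| := by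
  set y := |k (x - q₁)| with hy
  set z := |k (x - q₂) - k (x - q₁)| with hz
  have hy0 : 0 ≤ y := abs_nonneg _
  have hz0 : 0 ≤ z := abs_nonneg _
  have hyM : y ≤ M := hM _
  have hzM : z ≤ 2 * M := by
    have := abs_sub (k (x - q₂)) (k (x - q₁))
    linarith [hM (x - q₂), hM (x - q₁)]
  have h1 : |pairField k p₁ p₂ q₁ q₂ x| ≤ B * y + |p₂| * z := by
    rw [pairField_eq_add]
    refine (abs_add_le _ _).trans ?_
    rw [abs_mul, abs_mul]
    gcongr
  have hB0 : 0 ≤ B := (abs_nonneg _).trans hB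
  have h2 : |pairField k p₁ p₂ q₁ q₂ x| ^ 3 ≤ (B * y + |p₂| * z) ^ 3 :=
    pow_le_pow_left₀ (abs_nonneg _) h1 3
  have h3 : (B * y + |p₂| * z) ^ 3 ≤ 4 * ((B * y) ^ 3 + (|p₂| * z) ^ 3) := by
    have h4 : 0 ≤ B * y := by positivity
    have h5 : 0 ≤ |p₂| * z := by positivity
    nlinarith [mul_nonneg (add_nonneg h4 h5) (sq_nonneg (B * y - |p₂| * z))]
  have h4 : y ^ 3 ≤ M ^ 2 * y := by
    have : y ^ 2 ≤ M ^ 2 := pow_le_pow_left₀ hy0 hyM 2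
    nlinarith
  have h5 : z ^ 3 ≤ 4 * M ^ 2 * z := by
    have : z ^ 2 ≤ (2 * M) ^ 2 := pow_le_pow_left₀ hz0 hzM 2
    nlinarith
  calc |pairField k p₁ p₂ q₁ q₂ x| ^ 3 ≤ 4 * (B ^ 3 * y ^ 3 + |p₂| ^ 3 * z ^ 3) := by
        refine (h2.trans h3).trans (le_of_eq ?_); ring
    _ ≤ 4 * (B ^ 3 * (M ^ 2 * y) + |p₂| ^ 3 * (4 * M ^ 2 * z)) := by gcongr
    _ = _ := by ring

/-- Each time slice has the same bound for its $L^3$ norm, even where the amplitudes blow up, by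
`TwoPeakonFlow.bound`. -/
theorem memLp_pairField {X : Set ℝ} {k : ℝ → ℝ} (hk : Measurable k) {M C C' : ℝ}
    (hM : ∀ x, |k x| ≤ M) (hC0 : 0 ≤ C) (hC : ∀ q, ∫⁻ x in X, ‖k (x - q)‖ₑ ≤ ENNReal.ofReal C)
    (hC0' : 0 ≤ C') (hC' : ∀ q r, q < r → r < q + 1 →
      ∫⁻ x in X, ‖k (x - r) - k (x - q)‖ₑ ≤ ENNReal.ofReal (C' * (r - q)))
    {c T : ℝ} {p₁ p₂ q₁ q₂ : ℝ → ℝ} (hflow : TwoPeakonFlow c T p₁ p₂ q₁ q₂) :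
    MemLp (fun z : ℝ × ℝ => pairField k (p₁ z.1) (p₂ z.1) (q₁ z.1) (q₂ z.1) z.2) 3
      (volume.restrict (Ioo 0 T ×ˢ X)) := by
  have hm := measurable_pairField hk hflow.measurable
  obtain ⟨B, hB⟩ := hflow.bound
  refine ⟨hm.aestronglyMeasurable, ?_⟩
  rw [eLpNorm_lt_top_iff_lintegral_rpow_enorm_lt_top (by norm_num) (by norm_num),
    Measure.volume_eq_prod, ← Measure.prod_restrict, lintegral_prod _ (hm.enorm.pow_const _).aemeasurable]
  have hM0 : 0 ≤ M := (abs_nonneg _).trans (hM 0)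
  set K := 4 * B ^ 3 * M ^ 2 * C + 16 * M ^ 2 * (C' * B) with hK
  have hslice : ∀ t ∈ Ioo 0 T, ∫⁻ x in X, ‖pairField k (p₁ t) (p₂ t) (q₁ t) (q₂ t) x‖ₑ ^
      (3 : ℝ≥0∞).toReal ≤ ENNReal.ofReal K := by
    intro t ht
    obtain ⟨b1, b2⟩ := hB t ht
    obtain ⟨s1, s2⟩ := hflow.sep t ht
    have hB0 : 0 ≤ B := (abs_nonneg _).trans b1
    calc ∫⁻ x in X, ‖pairField k (p₁ t) (p₂ t) (q₁ t) (q₂ t) x‖ₑ ^ (3 : ℝ≥0∞).toReal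
        ≤ ∫⁻ x in X, (ENNReal.ofReal (4 * B ^ 3 * M ^ 2) * ‖k (x - q₁ t)‖ₑ
          + ENNReal.ofReal (16 * M ^ 2 * |p₂ t| ^ 3) * ‖k (x - q₂ t) - k (x - q₁ t)‖ₑ) := by
          refine lintegral_mono fun x => ?_
          have h3 : (3 : ℝ≥0∞).toReal = ((3 : ℕ) : ℝ) := by norm_num
          simp only [h3, ENNReal.rpow_natCast]
          rw [← ofReal_norm, ← ofReal_norm, ← ofReal_norm,
            ← ENNReal.ofReal_pow (norm_nonneg _), ← ENNReal.ofReal_mul (by positivity),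
            ← ENNReal.ofReal_mul (by positivity), ← ENNReal.ofReal_add (by positivity)
            (by positivity)]
          exact ENNReal.ofReal_le_ofReal (abs_pairField_pow_three_le hM b1 x)
      _ = ENNReal.ofReal (4 * B ^ 3 * M ^ 2) * (∫⁻ x in X, ‖k (x - q₁ t)‖ₑ)
          + ENNReal.ofReal (16 * M ^ 2 * |p₂ t| ^ 3) *
            ∫⁻ x in X, ‖k (x - q₂ t) - k (x - q₁ t)‖ₑ := by
          rw [lintegral_add_left (by fun_prop), lintegral_const_mul _ (by fun_prop),
            lintegral_const_mul _ (by fun_prop)]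
      _ ≤ ENNReal.ofReal (4 * B ^ 3 * M ^ 2) * ENNReal.ofReal C
          + ENNReal.ofReal (16 * M ^ 2 * |p₂ t| ^ 3) * ENNReal.ofReal (C' * (q₂ t - q₁ t)) := by
          gcongr
          · exact hC _
          · exact hC' _ _ (by linarith) (by linarith)
      _ ≤ _ := by
          rw [← ENNReal.ofReal_mul (by positivity), ← ENNReal.ofReal_mul (by positivity),
            ← ENNReal.ofReal_add (by positivity) (by positivity)]
          refine ENNReal.ofReal_le_ofReal ?_
          have : 16 * M ^ 2 * |p₂ t| ^ 3 * (C' * (q₂ t - q₁ t))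
              = 16 * M ^ 2 * (C' * (|p₂ t| ^ 3 * (q₂ t - q₁ t))) := by ring
          rw [this, hK]
          gcongr
  calc ∫⁻ t in Ioo 0 T, ∫⁻ x in X, ‖pairField k (p₁ t) (p₂ t) (q₁ t) (q₂ t) x‖ₑ ^
      (3 : ℝ≥0∞).toReal ≤ ∫⁻ _ in Ioo 0 T, ENNReal.ofReal K :=
        setLIntegral_mono measurable_const hslice
    _ < ⊤ := by
      rw [setLIntegral_const, Real.volume_Ioo]
      exact ENNReal.mul_lt_top ENNReal.ofReal_lt_top ENNReal.ofReal_lt_top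

/-! ### Integrability on space-time and Bessel potentials -/

theorem integrable_of_bdd_support {X Y : Set ℝ} (hY : MeasurableSet Y) (hYX : volume (Y ∩ X) < ⊤)
    {a b T K : ℝ} {f : ℝ × ℝ → ℝ} (hf : Measurable f) (hK : ∀ t ∈ Icc a b, ∀ x, |f (t, x)| ≤ K)
    (h0 : ∀ z, f z ≠ 0 → z.1 ∈ Icc a b ∧ z.2 ∈ Y) :
    Integrable f (volume.restrict (Ioo 0 T ×ˢ X)) := by
  have h1 : (Icc a b ×ˢ Y).indicator f = f := by
    refine indicator_eq_self.2 fun z hz => ?_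
    exact h0 z hz
  have hmeas : MeasurableSet (Icc a b ×ˢ Y) := measurableSet_Icc.prod hY
  rw [← h1, integrable_indicator_iff hmeas, IntegrableOn, Measure.restrict_restrict hmeas,
    prod_inter_prod]
  refine Measure.integrableOn_of_bounded (M := K) ?_ hf.aestronglyMeasurable ?_
  · rw [Measure.volume_eq_prod, Measure.prod_prod]
    refine (ENNReal.mul_lt_top ((measure_mono inter_subset_left).trans_lt ?_) hYX).ne
    exact measure_Icc_lt_top
  · have hle : volume.restrict ((Icc a b ∩ Ioo 0 T) ×ˢ (Y ∩ X))
        ≤ volume.restrict (Icc a b ×ˢ Y) :=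
      Measure.restrict_mono (prod_mono inter_subset_left inter_subset_left) le_rfl
    refine (ae_mono hle) ?_
    filter_upwards [ae_restrict_mem hmeas] with z hz
    exact hK z.1 hz.1 z.2

/-- The operator $D^{-2}$ is symmetric, by Fubini and the evenness of $G$. -/
theorem integral_invD2_mul {X : Set ℝ} {G : ℝ → ℝ} (hG : Measurable G) {M : ℝ}
    (hM : ∀ x, |G x| ≤ M) (heven : ∀ x, G (-x) = G x) {f k : ℝ → ℝ} (hf : IntegrableOn f X)
    (hk : IntegrableOn k X) :
    ∫ x in X, invD2 X G f x * k x = ∫ y in X, f y * invD2 X G k y := by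
  have h1 : ∀ x, invD2 X G f x * k x = ∫ y in X, G (x - y) * f y * k x := fun x => by
    rw [invD2, integral_mul_const]
  have h2 : ∀ y, f y * invD2 X G k y = ∫ x in X, G (x - y) * f y * k x := fun y => by
    rw [invD2, ← integral_const_mul]
    refine integral_congr_ae (Eventually.of_forall fun x => ?_)
    simp only []
    rw [← heven (y - x), neg_sub]; ring
  simp only [h1, h2]
  refine integral_integral_swap (f := fun x y => G (x - y) * f y * k x) ?_
  have h3 := (hk.mul_prod hf).bdd_mul (c := M) (f := fun z : ℝ × ℝ => G (z.1 - z.2))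
    (hG.comp (measurable_fst.sub measurable_snd)).aestronglyMeasurable
    (Eventually.of_forall fun z => hM _)
  refine h3.congr (Eventually.of_forall fun z => ?_)
  simp only [Function.uncurry]; ring

theorem measurable_invD2 {X : Set ℝ} {G : ℝ → ℝ} (hG : Measurable G) {f : ℝ × ℝ → ℝ}
    (hf : Measurable f) : Measurable fun z : ℝ × ℝ => invD2 X G (fun y => f (z.1, y)) z.2 := by
  have h : StronglyMeasurable fun w : (ℝ × ℝ) × ℝ => G (w.1.2 - w.2) * f (w.1.1, w.2) :=
    Measurable.stronglyMeasurable (by fun_prop)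
  exact (h.integral_prod_right' (ν := volume.restrict X)).measurable

theorem abs_invD2_le {X : Set ℝ} {G : ℝ → ℝ} {M : ℝ} (hM : ∀ x, |G x| ≤ M) {f : ℝ → ℝ}
    (hf : IntegrableOn f X) (x : ℝ) : |invD2 X G f x| ≤ M * ∫ y in X, |f y| := by
  rw [invD2, ← integral_const_mul]
  rw [← Real.norm_eq_abs]
  refine norm_integral_le_of_norm_le (hf.abs.const_mul M) (Eventually.of_forall fun y => ?_)
  rw [Real.norm_eq_abs, abs_mul]
  exact mul_le_mul_of_nonneg_right (hM _) (abs_nonneg _)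

theorem hasDerivAt_fst {φ : ℝ → ℝ → ℝ} (hφ : ContDiff ℝ ∞ (fun z : ℝ × ℝ => φ z.1 z.2))
    (t x : ℝ) : HasDerivAt (fun τ => φ τ x)
      (fderiv ℝ (fun z : ℝ × ℝ => φ z.1 z.2) (t, x) (1, 0)) t := by
  have h := (hφ.differentiable (by simp)).differentiableAt.hasFDerivAt (x := (t, x))
  exact h.comp_hasDerivAt t ((hasDerivAt_id t).prodMk (hasDerivAt_const t x))

theorem hasDerivAt_snd {φ : ℝ → ℝ → ℝ} (hφ : ContDiff ℝ ∞ (fun z : ℝ × ℝ => φ z.1 z.2))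
    (t x : ℝ) : HasDerivAt (φ t) (fderiv ℝ (fun z : ℝ × ℝ => φ z.1 z.2) (t, x) (0, 1)) x := by
  have h := (hφ.differentiable (by simp)).differentiableAt.hasFDerivAt (x := (t, x))
  exact h.comp_hasDerivAt x ((hasDerivAt_const x t).prodMk (hasDerivAt_id x))

theorem abs_apply_basis_le {L : ℝ × ℝ →L[ℝ] ℝ} {B : ℝ} (hL : ‖L‖ ≤ B) :
    |L (0, 1)| ≤ B ∧ |L (1, 0)| ≤ B := by
  have h1 := L.le_opNorm (0, 1)
  have h2 := L.le_opNorm (1, 0)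
  rw [show ‖((0 : ℝ), (1 : ℝ))‖ = 1 by simp [Prod.norm_def], mul_one] at h1
  rw [show ‖((1 : ℝ), (0 : ℝ))‖ = 1 by simp [Prod.norm_def], mul_one] at h2
  exact ⟨h1.trans hL, h2.trans hL⟩

theorem integrableOn_of_lintegral_le {X : Set ℝ} {k : ℝ → ℝ} (hk : Measurable k) {C : ℝ}
    (hC0 : 0 ≤ C) (hC : ∫⁻ x in X, ‖k x‖ₑ ≤ ENNReal.ofReal C) :
    IntegrableOn k X ∧ ∫ x in X, |k x| ≤ C := by
  refine ⟨⟨hk.aestronglyMeasurable, hC.trans_lt ENNReal.ofReal_lt_top⟩, ?_⟩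
  have h : ∫ x in X, |k x| = (∫⁻ x in X, ‖k x‖ₑ).toReal :=
    integral_norm_eq_lintegral_enorm hk.aestronglyMeasurable
  rw [h]
  exact ENNReal.toReal_le_of_le_ofReal hC0 hC

theorem integrableOn_pairField {X : Set ℝ} {k : ℝ → ℝ} (hk : Measurable k) {C : ℝ}
    (hC0 : 0 ≤ C) (hC : ∀ q, ∫⁻ x in X, ‖k (x - q)‖ₑ ≤ ENNReal.ofReal C) (p₁ p₂ q₁ q₂ : ℝ) :
    IntegrableOn (pairField k p₁ p₂ q₁ q₂) X ∧
      ∫ x in X, |pairField k p₁ p₂ q₁ q₂ x| ≤ (|p₁| + |p₂|) * C := by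
  obtain ⟨h1, h2⟩ := integrableOn_of_lintegral_le (k := fun x => k (x - q₁)) (by fun_prop) hC0
    (hC q₁)
  obtain ⟨h3, h4⟩ := integrableOn_of_lintegral_le (k := fun x => k (x - q₂)) (by fun_prop) hC0
    (hC q₂)
  have h5 : IntegrableOn (pairField k p₁ p₂ q₁ q₂) X := (h1.const_mul p₁).add (h3.const_mul p₂)
  refine ⟨h5, ?_⟩
  calc ∫ x in X, |pairField k p₁ p₂ q₁ q₂ x|
      ≤ ∫ x in X, (|p₁| * |k (x - q₁)| + |p₂| * |k (x - q₂)|) := by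
        refine integral_mono h5.abs ((h1.abs.const_mul _).add (h3.abs.const_mul _)) fun x => ?_
        refine (abs_add_le _ _).trans (le_of_eq ?_)
        rw [abs_mul, abs_mul]
    _ = |p₁| * (∫ x in X, |k (x - q₁)|) + |p₂| * ∫ x in X, |k (x - q₂)| := by
        rw [integral_add (h1.abs.const_mul _) (h3.abs.const_mul _), integral_const_mul,
          integral_const_mul]
    _ ≤ |p₁| * C + |p₂| * C := by gcongr
    _ = _ := by ring

theorem abs_pairField_le {k : ℝ → ℝ} {M K : ℝ} (hM : ∀ x, |k x| ≤ M) {p₁ p₂ : ℝ}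
    (h1 : |p₁| ≤ K) (h2 : |p₂| ≤ K) (q₁ q₂ x : ℝ) : |pairField k p₁ p₂ q₁ q₂ x| ≤ 2 * K * M := by
  have hK : 0 ≤ K := (abs_nonneg _).trans h1
  refine (abs_add_le _ _).trans ?_
  rw [abs_mul, abs_mul]
  have := mul_le_mul h1 (hM (x - q₁)) (abs_nonneg _) hK
  have := mul_le_mul h2 (hM (x - q₂)) (abs_nonneg _) hK
  linarith

/-- The density `u³ + (3/2) u u_x²`. -/
def cubicFlux (u v : ℝ) : ℝ := u ^ 3 + 3 / 2 * u * v ^ 2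

theorem abs_cubicFlux_le {u v K : ℝ} (hu : |u| ≤ K) (hv : |v| ≤ K) :
    |cubicFlux u v| ≤ 3 * K ^ 2 * |u| := by
  have h1 : u ^ 2 ≤ K ^ 2 := by rw [← sq_abs]; exact pow_le_pow_left₀ (abs_nonneg _) hu 2
  have h2 : v ^ 2 ≤ K ^ 2 := by rw [← sq_abs]; exact pow_le_pow_left₀ (abs_nonneg _) hv 2
  rw [cubicFlux, show u ^ 3 + 3 / 2 * u * v ^ 2 = (u ^ 2 + 3 / 2 * v ^ 2) * u by ring, abs_mul,
    abs_of_nonneg (by positivity)]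
  exact mul_le_mul_of_nonneg_right (by nlinarith [sq_nonneg K]) (abs_nonneg _)

theorem abs_half_pow_three_le {v K : ℝ} (hv : |v| ≤ K) : |1 / 2 * v ^ 3| ≤ 3 * K ^ 2 * |v| := by
  have h2 : v ^ 2 ≤ K ^ 2 := by rw [← sq_abs]; exact pow_le_pow_left₀ (abs_nonneg _) hv 2
  rw [show 1 / 2 * v ^ 3 = (1 / 2 * v ^ 2) * v by ring, abs_mul, abs_of_nonneg (by positivity)]
  exact mul_le_mul_of_nonneg_right (by nlinarith [sq_nonneg K]) (abs_nonneg _)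

/-! ### The weak formulation for a peakon flow -/

section Weak

variable {X : Set ℝ} {G dg : ℝ → ℝ} {Test : ℝ → (ℝ → ℝ → ℝ) → Prop} {Adm : (ℝ → ℝ) → Prop}
  {c : ℝ}

theorem PeakonGeometry.integrableOn_G (hG : PeakonGeometry X G dg Test Adm c) (q : ℝ) :
    IntegrableOn (fun x => G (x - q)) X := by
  obtain ⟨C, hC0, hC⟩ := hG.lintegral_le
  have hm := hG.measurable_G
  have h := (integrableOn_of_lintegral_le (k := fun x => 2 * G (x - q)) (by fun_prop) hC0
    (hC q).1).1.const_mul (1 / 2)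
  exact h.congr (Eventually.of_forall fun x => by ring)

/-- In the form $\int G(y)\varphi(t,q-y)\,dy$ all derivatives fall on $\varphi$. So the corner or
jump of the kernel does no harm, and the chain rule applies along $t\mapsto(t,q(t))$. -/
theorem PeakonGeometry.hasDerivAt_invD2 (hG : PeakonGeometry X G dg Test Adm c) {T : ℝ}
    {φ : ℝ → ℝ → ℝ} (hφ : Test T φ) {q : ℝ → ℝ} {d t : ℝ} (hq : HasDerivAt q d t) :
    HasDerivAt (fun t => invD2 X G (φ t) (q t))
      (invD2 X G (fun x => deriv (fun τ => φ τ x) t) (q t)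
        + d * invD2 X G (deriv (φ t)) (q t)) t := by
  have hs := hG.test_smooth T φ hφ
  obtain ⟨B, hB⟩ := hG.test_bdd T φ hφ
  set F : ℝ × ℝ → ℝ := fun z => φ z.1 z.2 with hF
  have hadm := hG.test_adm T φ hφ
  have hGm := hG.measurable_G
  have hGint : IntegrableOn G X := by simpa using hG.integrableOn_G 0
  have hFc : Continuous F := hs.continuous
  have hF'c : Continuous (fderiv ℝ F) := hs.continuous_fderiv (by simp)
  have hbd : Integrable (fun y => G y • fderiv ℝ F (t, q t - y)) (volume.restrict X) := by
    refine (hGint.norm.mul_const B).mono' ?_ (Eventually.of_forall fun y => ?_)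
    · refine (hGm.aestronglyMeasurable).smul (Continuous.aestronglyMeasurable ?_)
      fun_prop
    · rw [norm_smul]; exact mul_le_mul_of_nonneg_left (hB _).2 (norm_nonneg _)
  have key : HasFDerivAt (fun z : ℝ × ℝ => ∫ y in X, G y * F (z.1, z.2 - y))
      (∫ y in X, G y • fderiv ℝ F (t, q t - y)) (t, q t) := by
    refine hasFDerivAt_integral_of_dominated_of_fderiv_le (s := univ)
      (x₀ := (t, q t)) (F := fun (z : ℝ × ℝ) y => G y * F (z.1, z.2 - y))
      (F' := fun z y => G y • fderiv ℝ F (z.1, z.2 - y)) (bound := fun y => ‖G y‖ * B) univ_mem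
      (Eventually.of_forall fun z => ?_) ?_ ?_ ?_ (hGint.norm.mul_const B) ?_
    · refine (hGm.aestronglyMeasurable).mul (Continuous.aestronglyMeasurable ?_)
      fun_prop
    · refine (hGint.norm.mul_const B).mono' ?_ (Eventually.of_forall fun y => ?_)
      · refine (hGm.aestronglyMeasurable).mul (Continuous.aestronglyMeasurable ?_)
        fun_prop
      · rw [norm_mul]; exact mul_le_mul_of_nonneg_left (hB _).1 (norm_nonneg _)
    · exact hbd.aestronglyMeasurable
    · refine Eventually.of_forall fun y z _ => ?_
      rw [norm_smul]; exact mul_le_mul_of_nonneg_left (hB _).2 (norm_nonneg _)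
    · refine Eventually.of_forall fun y z _ => ?_
      have h1 : HasFDerivAt F (fderiv ℝ F (z.1, z.2 - y)) (z.1, z.2 - y) :=
        (hs.differentiable (by simp)).differentiableAt.hasFDerivAt
      have h2 : HasFDerivAt (fun z : ℝ × ℝ => (z.1, z.2 - y)) (ContinuousLinearMap.id ℝ (ℝ × ℝ)) z := by
        have h := (hasFDerivAt_id (𝕜 := ℝ) z).sub_const ((0 : ℝ), y)
        refine h.congr_of_eventuallyEq (Eventually.of_forall fun w => ?_)
        simp [Prod.ext_iff]
      have h3 := (h1.comp z h2).const_mul (G y)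
      rwa [ContinuousLinearMap.comp_id] at h3
  have hcomp := key.comp_hasDerivAt t ((hasDerivAt_id t).prodMk hq)
  have hfun : (fun t => invD2 X G (φ t) (q t))
      = (fun z : ℝ × ℝ => ∫ y in X, G y * F (z.1, z.2 - y)) ∘ fun t => (id t, q t) := by
    ext τ
    rw [hG.conv _ (hadm τ).1]
    rfl
  rw [hfun]
  refine hcomp.congr_deriv ?_
  rw [ContinuousLinearMap.integral_apply hbd, hG.conv _ (hadm t).2.1, hG.conv _ (hadm t).2.2,
    ← integral_const_mul, ← integral_add]
  · refine integral_congr_ae (Eventually.of_forall fun y => ?_)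
    simp only [_root_.smul_apply, smul_eq_mul]
    rw [(hasDerivAt_fst hs t (q t - y)).deriv, (hasDerivAt_snd hs t (q t - y)).deriv]
    have : ((1 : ℝ), d) = (1, 0) + d • ((0 : ℝ), (1 : ℝ)) := by simp
    rw [this, map_add, map_smul, smul_eq_mul]
    ring
  · obtain ⟨K, hK⟩ := hG.adm_bdd _ (hadm t).2.2
    refine hGint.mul_bdd (c := K) ?_ (Eventually.of_forall fun y => hK _)
    exact ((hG.adm_continuous _ (hadm t).2.2).comp (by fun_prop)).aestronglyMeasurable
  · obtain ⟨K, hK⟩ := hG.adm_bdd _ (hadm t).2.1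
    refine Integrable.const_mul (hGint.mul_bdd (c := K) ?_ (Eventually.of_forall fun y => hK _)) _
    exact ((hG.adm_continuous _ (hadm t).2.1).comp (by fun_prop)).aestronglyMeasurable

theorem PeakonGeometry.integral_pairField_mul (hG : PeakonGeometry X G dg Test Adm c)
    {h : ℝ → ℝ} (hh : Adm h) (p₁ p₂ q₁ q₂ : ℝ) :
    ∫ x in X, pairField (fun x => 2 * G x) p₁ p₂ q₁ q₂ x * h x
      = 2 * p₁ * invD2 X G h q₁ + 2 * p₂ * invD2 X G h q₂ := by
  obtain ⟨K, hK⟩ := hG.adm_bdd h hh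
  have hint : ∀ q, IntegrableOn (fun x => G (x - q) * h x) X := fun q =>
    (hG.integrableOn_G q).mul_bdd (c := K) (hG.adm_continuous _ hh).aestronglyMeasurable
      (Eventually.of_forall fun y => hK _)
  have hinv : ∀ q, invD2 X G h q = ∫ x in X, G (x - q) * h x := fun q => by
    rw [invD2]
    refine integral_congr_ae (Eventually.of_forall fun x => ?_)
    simp only []
    rw [← hG.even, neg_sub]
  rw [hinv, hinv, ← integral_const_mul, ← integral_const_mul,
    ← integral_add ((hint q₁).const_mul _) ((hint q₂).const_mul _)]
  refine integral_congr_ae (Eventually.of_forall fun x => ?_)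
  simp only [pairField]
  ring

/-- The left-hand side of the Novikov equation, tested with `φ`, at a fixed time and point. -/
def testedNovikov (X : Set ℝ) (G u v φ φt φx : ℝ → ℝ) (x : ℝ) : ℝ :=
  - u x * φt x + u x ^ 2 * v x * φ x - invD2 X G (fun y => u y ^ 3 + 3 / 2 * u y * v y ^ 2) x * φx x
    + invD2 X G (fun y => 1 / 2 * v y ^ 3) x * φ x

/-- Symmetry of $D^{-2}$ brings the integrand into the form required by `PeakonGeometry.jump`. -/
theorem PeakonGeometry.integral_testedNovikov (hG : PeakonGeometry X G dg Test Adm c)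
    {h ht : ℝ → ℝ} (hh : Adm h) (hh' : Adm (deriv h)) (hht : Adm ht) {p₁ p₂ q₁ q₂ : ℝ}
    (hq : q₁ < q₂) (hq' : q₂ < q₁ + 1) :
    ∫ x in X, testedNovikov X G (pairField (fun x => 2 * G x) p₁ p₂ q₁ q₂)
        (pairField dg p₁ p₂ q₁ q₂) h ht (deriv h) x
      = -(2 * p₁ * invD2 X G ht q₁ + 2 * p₂ * invD2 X G ht q₂) +
        (2 * p₁ * ((c * p₁ + crestProfile c (q₂ - q₁) * p₂) *
          (p₂ * slopeProfile c (q₂ - q₁)) * invD2 X G h q₁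
        - (c * p₁ + crestProfile c (q₂ - q₁) * p₂) ^ 2 * invD2 X G (deriv h) q₁)
      + 2 * p₂ * (-(crestProfile c (q₂ - q₁) * p₁ + c * p₂) *
          (p₁ * slopeProfile c (q₂ - q₁)) * invD2 X G h q₂
        - (crestProfile c (q₂ - q₁) * p₁ + c * p₂) ^ 2 * invD2 X G (deriv h) q₂)) := by
  have hGm := hG.measurable_G
  have hdm := hG.measurable_dg
  obtain ⟨C, hC0, hC⟩ := hG.lintegral_le
  obtain ⟨M, hM⟩ := hG.bdd
  have hGM : ∀ x, |G x| ≤ M := fun x => by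
    have := (hM x).1
    rw [abs_mul, abs_two] at this
    linarith [abs_nonneg (G x)]
  set u := pairField (fun x => 2 * G x) p₁ p₂ q₁ q₂ with hu
  set v := pairField dg p₁ p₂ q₁ q₂ with hv
  have hum : Measurable u := by rw [hu]; unfold pairField; fun_prop
  have hvm : Measurable v := by rw [hv]; unfold pairField; fun_prop
  have hui : IntegrableOn u X := (integrableOn_pairField (by fun_prop) hC0 (fun q => (hC q).1)
    p₁ p₂ q₁ q₂).1
  have hvi : IntegrableOn v X := (integrableOn_pairField hdm hC0 (fun q => (hC q).2)
    p₁ p₂ q₁ q₂).1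
  set L := 2 * (|p₁| + |p₂|) * M with hL
  have huL : ∀ x, |u x| ≤ L := abs_pairField_le (fun x => (hM x).1)
    (le_add_of_nonneg_right (abs_nonneg _)) (le_add_of_nonneg_left (abs_nonneg _)) q₁ q₂
  have hvL : ∀ x, |v x| ≤ L := abs_pairField_le (fun x => (hM x).2)
    (le_add_of_nonneg_right (abs_nonneg _)) (le_add_of_nonneg_left (abs_nonneg _)) q₁ q₂
  have hfi : IntegrableOn (fun x => u x ^ 3 + 3 / 2 * u x * v x ^ 2) X := by
    refine (hui.abs.const_mul (3 * L ^ 2)).mono' (by fun_prop) (Eventually.of_forall fun x => ?_)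
    exact abs_cubicFlux_le (huL x) (hvL x)
  have hgi : IntegrableOn (fun x => 1 / 2 * v x ^ 3) X := by
    refine (hvi.abs.const_mul (3 * L ^ 2)).mono' (by fun_prop) (Eventually.of_forall fun x => ?_)
    exact abs_half_pow_three_le (hvL x)
  have hbm : ∀ {f : ℝ → ℝ}, Measurable f → IntegrableOn f X → ∀ {k : ℝ → ℝ}, Adm k →
      IntegrableOn (fun x => f x * k x) X := fun {f} hf hfi {k} hk => by
    obtain ⟨K, hK⟩ := hG.adm_bdd k hk
    exact hfi.mul_bdd (c := K) (hG.adm_continuous _ hk).aestronglyMeasurable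
      (Eventually.of_forall fun y => hK _)
  have hinvm : ∀ {f : ℝ → ℝ}, Measurable f → Measurable (invD2 X G f) := fun {f} hf =>
    (measurable_invD2 (X := X) hGm (f := fun z => f z.2) (by fun_prop)).comp
      (measurable_const.prodMk measurable_id : Measurable fun x : ℝ => ((0 : ℝ), x))
  have hinv : ∀ {f : ℝ → ℝ}, Measurable f → IntegrableOn f X → ∀ {k : ℝ → ℝ}, Adm k →
      IntegrableOn (fun x => invD2 X G f x * k x) X := fun {f} hf hfi {k} hk =>
    (hG.adm_integrable _ hk).bdd_mul (hinvm hf).aestronglyMeasurable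
      (Eventually.of_forall fun y => abs_invD2_le hGM hfi y)
  have hinv' : ∀ {f : ℝ → ℝ}, IntegrableOn f X → ∀ {k : ℝ → ℝ}, Adm k →
      IntegrableOn (fun x => f x * invD2 X G k x) X := fun {f} hfi {k} hk =>
    Integrable.mul_bdd hfi (hinvm (hG.adm_continuous _ hk).measurable).aestronglyMeasurable
      (Eventually.of_forall fun y => abs_invD2_le hGM (hG.adm_integrable _ hk) y)
  have i1 := hbm hum hui hht
  have i2 : IntegrableOn (fun x => u x ^ 2 * v x * h x) X := by
    refine hbm (by fun_prop) ?_ hh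
    refine (hvi.abs.const_mul (L ^ 2)).mono' (by fun_prop) (Eventually.of_forall fun x => ?_)
    rw [Real.norm_eq_abs, abs_mul, abs_pow]
    gcongr
    exact huL x
  have i3 := hinv (by fun_prop) hfi hh'
  have i4 := hinv (by fun_prop) hgi hh
  have i5 := hinv' hfi hh'
  have i6 := hinv' hgi hh
  have e1 : ∫ x in X, testedNovikov X G u v h ht (deriv h) x
      = -(∫ x in X, u x * ht x) + ((∫ x in X, u x ^ 2 * v x * h x)
        - (∫ x in X, invD2 X G (fun y => u y ^ 3 + 3 / 2 * u y * v y ^ 2) x * deriv h x)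
        + ∫ x in X, invD2 X G (fun y => 1 / 2 * v y ^ 3) x * h x) := by
    have i23 : IntegrableOn (fun x => u x ^ 2 * v x * h x
        - invD2 X G (fun y => u y ^ 3 + 3 / 2 * u y * v y ^ 2) x * deriv h x) X := i2.sub i3
    have i234 : IntegrableOn (fun x => u x ^ 2 * v x * h x
        - invD2 X G (fun y => u y ^ 3 + 3 / 2 * u y * v y ^ 2) x * deriv h x
        + invD2 X G (fun y => 1 / 2 * v y ^ 3) x * h x) X := i23.add i4
    have hne : IntegrableOn (fun x => -(u x * ht x)) X := i1.neg
    rw [← integral_sub i2 i3, ← integral_add i23 i4, ← integral_neg, ← integral_add hne i234]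
    refine integral_congr_ae (Eventually.of_forall fun x => ?_)
    simp only [testedNovikov]
    ring
  have i25 : IntegrableOn (fun x => u x ^ 2 * v x * h x
      - (u x ^ 3 + 3 / 2 * u x * v x ^ 2) * invD2 X G (deriv h) x) X := i2.sub i5
  rw [e1, hG.integral_pairField_mul hht, integral_invD2_mul hGm hGM hG.even hfi
    (hG.adm_integrable _ hh'), integral_invD2_mul hGm hGM hG.even hgi
    (hG.adm_integrable _ hh), ← integral_sub i2 i5, ← integral_add i25 i6,
    ← hG.jump h hh hh' p₁ p₂ q₁ q₂ hq hq']

/-- The peakon equations say that the time derivative of $\int u\varphi\,dx$ is minus the spatial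
integral of the tested equation. This pairing vanishes near both ends of the time interval, so the
space-time integral is zero. -/
theorem PeakonGeometry.isWeakNovikov (hG : PeakonGeometry X G dg Test Adm c)
    {T : ℝ} (hT : 0 < T) {p₁ p₂ q₁ q₂ : ℝ → ℝ} (hflow : TwoPeakonFlow c T p₁ p₂ q₁ q₂) :
    IsWeakNovikov X G (Test T) T
      (fun t => pairField (fun x => 2 * G x) (p₁ t) (p₂ t) (q₁ t) (q₂ t))
      (fun t => pairField dg (p₁ t) (p₂ t) (q₁ t) (q₂ t)) := by
  have hGm := hG.measurable_G
  have hgm : Measurable fun x => 2 * G x := by fun_prop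
  have hdm := hG.measurable_dg
  obtain ⟨C, hC0, hC⟩ := hG.lintegral_le
  obtain ⟨C', hC0', hC'⟩ := hG.lintegral_sub_le
  obtain ⟨M, hM⟩ := hG.bdd
  have hGM : ∀ x, |G x| ≤ M := fun x => by
    have := (hM x).1
    rw [abs_mul, abs_two] at this
    linarith [abs_nonneg (G x)]
  set u : ℝ → ℝ → ℝ := fun t => pairField (fun x => 2 * G x) (p₁ t) (p₂ t) (q₁ t) (q₂ t) with hu
  set v : ℝ → ℝ → ℝ := fun t => pairField dg (p₁ t) (p₂ t) (q₁ t) (q₂ t) with hv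
  have hum : Measurable fun z : ℝ × ℝ => u z.1 z.2 := measurable_pairField hgm hflow.measurable
  have hvm : Measurable fun z : ℝ × ℝ => v z.1 z.2 := measurable_pairField hdm hflow.measurable
  -- The amplitudes may blow up at the ends of $(0,T)$, but a test function only sees a compact
  -- interval of times inside.
  have hbound : ∀ a b : ℝ, 0 < a → b < T → ∃ K, 0 ≤ K ∧ ∀ t ∈ Icc a b, |p₁ t| ≤ K ∧ |p₂ t| ≤ K := by
    intro a b ha hb
    have hs : Icc a b ⊆ Ioo 0 T := fun t ht => ⟨ha.trans_le ht.1, ht.2.trans_lt hb⟩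
    have c1 : ContinuousOn p₁ (Icc a b) := fun t ht =>
      (hflow.deriv_p₁ t (hs ht)).continuousAt.continuousWithinAt
    have c2 : ContinuousOn p₂ (Icc a b) := fun t ht =>
      (hflow.deriv_p₂ t (hs ht)).continuousAt.continuousWithinAt
    obtain ⟨K₁, hK₁⟩ := isCompact_Icc.exists_bound_of_continuousOn c1
    obtain ⟨K₂, hK₂⟩ := isCompact_Icc.exists_bound_of_continuousOn c2
    exact ⟨max 0 (max K₁ K₂), le_max_left _ _, fun t ht =>
      ⟨(hK₁ t ht).trans ((le_max_left _ _).trans (le_max_right _ _)),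
        (hK₂ t ht).trans ((le_max_right _ _).trans (le_max_right _ _))⟩⟩
  have hderiv0 : ∀ φ, Test T φ → ∀ a b : ℝ, ∀ Y : Set ℝ, IsClosed Y →
      (∀ t x, φ t x ≠ 0 → t ∈ Icc a b ∧ x ∈ Y) → ∀ t x, ¬ (t ∈ Icc a b ∧ x ∈ Y) →
      φ t x = 0 ∧ fderiv ℝ (fun z : ℝ × ℝ => φ z.1 z.2) (t, x) = 0 := by
    intro φ hφ a b Y hY hsupp t x htx
    refine ⟨by_contra fun h => htx (hsupp t x h), ?_⟩
    have hopen : IsOpen (Icc a b ×ˢ Y)ᶜ := (isClosed_Icc.prod hY).isOpen_compl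
    have hev : (fun z : ℝ × ℝ => φ z.1 z.2) =ᶠ[𝓝 (t, x)] fun _ => 0 := by
      filter_upwards [hopen.mem_nhds (show (t, x) ∈ (Icc a b ×ˢ Y)ᶜ from htx)] with z hz
      exact by_contra fun h => hz (hsupp z.1 z.2 h)
    rw [hev.fderiv_eq]; simp
  refine ⟨memLp_pairField hgm (fun x => (hM x).1) hC0 (fun q => (hC q).1) hC0'
      (fun q r h1 h2 => (hC' q r h1 h2).1) hflow,
    memLp_pairField hdm (fun x => (hM x).2) hC0 (fun q => (hC q).2) hC0'
      (fun q r h1 h2 => (hC' q r h1 h2).2) hflow, fun φ hφ => ?_, fun φ hφ => ?_⟩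
  · have hs := hG.test_smooth T φ hφ
    obtain ⟨a, b, Y, ha, hb, hY, hYX, hsupp⟩ := hG.test_support T φ hφ
    obtain ⟨B, hB⟩ := hG.test_bdd T φ hφ
    obtain ⟨K, hK0, hK⟩ := hbound a b ha hb
    have hz := hderiv0 φ hφ a b Y hY hsupp
    have hF'c : Continuous (fderiv ℝ fun z : ℝ × ℝ => φ z.1 z.2) := hs.continuous_fderiv (by simp)
    have hφc : Continuous fun z : ℝ × ℝ => φ z.1 z.2 := hs.continuous
    have hdx : ∀ t x, deriv (φ t) x = fderiv ℝ (fun z : ℝ × ℝ => φ z.1 z.2) (t, x) (0, 1) :=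
      fun t x => (hasDerivAt_snd hs t x).deriv
    have hdxB : ∀ t x, |deriv (φ t) x| ≤ B := fun t x => by
      rw [hdx]
      exact (abs_apply_basis_le (hB _).2).1
    have hdxm : Measurable fun z : ℝ × ℝ => deriv (φ z.1) z.2 := by
      simp only [hdx]
      exact Continuous.measurable (by fun_prop)
    have hB0 : 0 ≤ B := (abs_nonneg _).trans (hB 0).1
    have hM0 : 0 ≤ M := (abs_nonneg _).trans (hM 0).1
    have i1 : Integrable (fun z : ℝ × ℝ => u z.1 z.2 * deriv (φ z.1) z.2)
        (volume.restrict (Ioo 0 T ×ˢ X)) := by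
      refine integrable_of_bdd_support hY.measurableSet hYX (a := a) (b := b)
        (K := 2 * K * M * B) (hum.mul hdxm) (fun t ht x => ?_) fun z hz0 => ?_
      · rw [abs_mul]
        exact mul_le_mul (abs_pairField_le (fun x => (hM x).1) (hK t ht).1 (hK t ht).2 _ _ _)
          (hdxB _ _) (abs_nonneg _) (by positivity)
      · by_contra hcon
        exact hz0 (by rw [hdx, (hz z.1 z.2 hcon).2]; simp)
    have i2 : Integrable (fun z : ℝ × ℝ => v z.1 z.2 * φ z.1 z.2)
        (volume.restrict (Ioo 0 T ×ˢ X)) := by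
      refine integrable_of_bdd_support hY.measurableSet hYX (a := a) (b := b)
        (K := 2 * K * M * B) (hvm.mul hφc.measurable) (fun t ht x => ?_) fun z hz0 => ?_
      · rw [abs_mul]
        exact mul_le_mul (abs_pairField_le (fun x => (hM x).2) (hK t ht).1 (hK t ht).2 _ _ _)
          (hB (t, x)).1 (abs_nonneg _) (by positivity)
      · by_contra hcon
        exact hz0 (by rw [(hz z.1 z.2 hcon).1, mul_zero])
    rw [Measure.volume_eq_prod, setIntegral_prod _ (by
      rwa [IntegrableOn, ← Measure.volume_eq_prod]), setIntegral_prod _ (by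
      rwa [IntegrableOn, ← Measure.volume_eq_prod]), ← integral_neg]
    refine integral_congr_ae (Eventually.of_forall fun t => ?_)
    have hadm := hG.test_adm T φ hφ t
    obtain ⟨K₁, hK₁⟩ := hG.adm_bdd _ hadm.1
    obtain ⟨K₂, hK₂⟩ := hG.adm_bdd _ hadm.2.1
    have hdgi : ∀ q, IntegrableOn (fun x => dg (x - q) * φ t x) X := fun q =>
      ((integrableOn_of_lintegral_le (k := fun x => dg (x - q)) (by fun_prop) hC0
        (hC q).2).1).mul_bdd (c := K₁) (hG.adm_continuous _ hadm.1).aestronglyMeasurable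
        (Eventually.of_forall fun y => hK₁ _)
    have hGi : ∀ q, IntegrableOn (fun x => 2 * G (x - q) * deriv (φ t) x) X := fun q =>
      ((hG.integrableOn_G q).const_mul 2).mul_bdd (c := K₂)
        (hG.adm_continuous _ hadm.2.1).aestronglyMeasurable (Eventually.of_forall fun y => hK₂ _)
    have e1 : ∫ x in X, u t x * deriv (φ t) x
        = p₁ t * (∫ x in X, 2 * G (x - q₁ t) * deriv (φ t) x)
          + p₂ t * ∫ x in X, 2 * G (x - q₂ t) * deriv (φ t) x := by
      rw [← integral_const_mul, ← integral_const_mul,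
        ← integral_add ((hGi _).const_mul _) ((hGi _).const_mul _)]
      refine integral_congr_ae (Eventually.of_forall fun x => ?_)
      simp only [hu, pairField]; ring
    have e2 : ∫ x in X, v t x * φ t x
        = p₁ t * (∫ x in X, dg (x - q₁ t) * φ t x) + p₂ t * ∫ x in X, dg (x - q₂ t) * φ t x := by
      rw [← integral_const_mul, ← integral_const_mul,
        ← integral_add ((hdgi _).const_mul _) ((hdgi _).const_mul _)]
      refine integral_congr_ae (Eventually.of_forall fun x => ?_)
      simp only [hv, pairField]; ring
    simp only []
    rw [e1, e2, hG.weak _ hadm.1, hG.weak _ hadm.1]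
    ring
  · have hs := hG.test_smooth T φ hφ
    obtain ⟨a, b, Y, ha, hb, hY, hYX, hsupp⟩ := hG.test_support T φ hφ
    obtain ⟨B, hB⟩ := hG.test_bdd T φ hφ
    obtain ⟨K, hK0, hK⟩ := hbound a b ha hb
    have hz := hderiv0 φ hφ a b Y hY hsupp
    have hF'c : Continuous (fderiv ℝ fun z : ℝ × ℝ => φ z.1 z.2) := hs.continuous_fderiv (by simp)
    have hφm : Measurable fun z : ℝ × ℝ => φ z.1 z.2 := hs.continuous.measurable
    have hdx : ∀ t x, deriv (φ t) x = fderiv ℝ (fun z : ℝ × ℝ => φ z.1 z.2) (t, x) (0, 1) :=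
      fun t x => (hasDerivAt_snd hs t x).deriv
    have hdt : ∀ t x, deriv (fun τ => φ τ x) t
        = fderiv ℝ (fun z : ℝ × ℝ => φ z.1 z.2) (t, x) (1, 0) :=
      fun t x => (hasDerivAt_fst hs t x).deriv
    have hdxB : ∀ t x, |deriv (φ t) x| ≤ B := fun t x => by
      rw [hdx]
      exact (abs_apply_basis_le (hB _).2).1
    have hdtB : ∀ t x, |deriv (fun τ => φ τ x) t| ≤ B := fun t x => by
      rw [hdt]
      exact (abs_apply_basis_le (hB _).2).2
    have hdxm : Measurable fun z : ℝ × ℝ => deriv (φ z.1) z.2 := by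
      simp only [hdx]
      exact Continuous.measurable (by fun_prop)
    have hdtm : Measurable fun z : ℝ × ℝ => deriv (fun τ => φ τ z.2) z.1 := by
      simp only [hdt]
      exact Continuous.measurable (by fun_prop)
    have hB0 : 0 ≤ B := (abs_nonneg _).trans (hB 0).1
    have hM0 : 0 ≤ M := (abs_nonneg _).trans (hM 0).1
    set L := 2 * K * M with hL
    have hL0 : 0 ≤ L := by positivity
    have huL : ∀ t ∈ Icc a b, ∀ x, |u t x| ≤ L := fun t ht x =>
      abs_pairField_le (fun x => (hM x).1) (hK t ht).1 (hK t ht).2 _ _ _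
    have hvL : ∀ t ∈ Icc a b, ∀ x, |v t x| ≤ L := fun t ht x =>
      abs_pairField_le (fun x => (hM x).2) (hK t ht).1 (hK t ht).2 _ _ _
    have hAm : Measurable fun z : ℝ × ℝ =>
        invD2 X G (fun y => u z.1 y ^ 3 + 3 / 2 * u z.1 y * v z.1 y ^ 2) z.2 :=
      measurable_invD2 hGm (f := fun z => u z.1 z.2 ^ 3 + 3 / 2 * u z.1 z.2 * v z.1 z.2 ^ 2)
        (by fun_prop)
    have hDm : Measurable fun z : ℝ × ℝ => invD2 X G (fun y => 1 / 2 * v z.1 y ^ 3) z.2 :=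
      measurable_invD2 hGm (f := fun z => 1 / 2 * v z.1 z.2 ^ 3) (by fun_prop)
    have hfield : ∀ {k : ℝ → ℝ}, Measurable k → (∀ q, ∫⁻ x in X, ‖k (x - q)‖ₑ ≤ ENNReal.ofReal C) →
        ∀ t ∈ Icc a b, IntegrableOn (pairField k (p₁ t) (p₂ t) (q₁ t) (q₂ t)) X ∧
        ∫ x in X, |pairField k (p₁ t) (p₂ t) (q₁ t) (q₂ t) x| ≤ 2 * K * C := by
      intro k hk hkC t ht
      obtain ⟨h1, h2⟩ := integrableOn_pairField hk hC0 hkC (p₁ t) (p₂ t) (q₁ t) (q₂ t)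
      refine ⟨h1, h2.trans (mul_le_mul_of_nonneg_right ?_ hC0)⟩
      linarith [(hK t ht).1, (hK t ht).2]
    have hpot : ∀ {w f : ℝ → ℝ}, Measurable f → IntegrableOn w X → ∫ x in X, |w x| ≤ 2 * K * C →
        (∀ x, |f x| ≤ 3 * L ^ 2 * |w x|) → ∀ x, |invD2 X G f x| ≤ M * (3 * L ^ 2 * (2 * K * C)) := by
      intro w f hf hw hwK hfw x
      have hfi : IntegrableOn f X :=
        (hw.abs.const_mul (3 * L ^ 2)).mono' hf.aestronglyMeasurable (Eventually.of_forall hfw)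
      refine (abs_invD2_le hGM hfi x).trans (mul_le_mul_of_nonneg_left ?_ hM0)
      refine (integral_mono hfi.abs (hw.abs.const_mul _) hfw).trans ?_
      rw [integral_const_mul]
      gcongr
    have hut : ∀ t, Measurable (u t) := fun t => hum.comp measurable_prodMk_left
    have hvt : ∀ t, Measurable (v t) := fun t => hvm.comp measurable_prodMk_left
    have hAB : ∀ t ∈ Icc a b, ∀ x,
        |invD2 X G (fun y => u t y ^ 3 + 3 / 2 * u t y * v t y ^ 2) x|
          ≤ M * (3 * L ^ 2 * (2 * K * C)) := fun t ht x => by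
      obtain ⟨h1, h2⟩ := hfield hgm (fun q => (hC q).1) t ht
      exact hpot (f := fun y => u t y ^ 3 + 3 / 2 * u t y * v t y ^ 2)
        (((hut t).pow_const 3).add (((hut t).const_mul _).mul ((hvt t).pow_const 2))) h1 h2
        (fun x => abs_cubicFlux_le (huL t ht x) (hvL t ht x)) x
    have hDB : ∀ t ∈ Icc a b, ∀ x, |invD2 X G (fun y => 1 / 2 * v t y ^ 3) x|
          ≤ M * (3 * L ^ 2 * (2 * K * C)) := fun t ht x => by
      obtain ⟨h1, h2⟩ := hfield hdm (fun q => (hC q).2) t ht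
      exact hpot (f := fun y => 1 / 2 * v t y ^ 3) (((hvt t).pow_const 3).const_mul _) h1 h2
        (fun x => abs_half_pow_three_le (hvL t ht x)) x
    set E : ℝ × ℝ → ℝ := fun z => testedNovikov X G (u z.1) (v z.1) (φ z.1)
      (fun x => deriv (fun τ => φ τ x) z.1) (deriv (φ z.1)) z.2 with hE
    have hEint : Integrable E (volume.restrict (Ioo 0 T ×ˢ X)) := by
      set Q := M * (3 * L ^ 2 * (2 * K * C)) with hQ
      have hQ0 : 0 ≤ Q := by positivity
      refine integrable_of_bdd_support hY.measurableSet hYX (a := a) (b := b)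
        (K := L * B + L ^ 2 * L * B + Q * B + Q * B) ?_ (fun t ht x => ?_) fun z hz0 => ?_
      · simp only [hE, testedNovikov]
        exact ((((hum.neg).mul hdtm).add (((hum.pow_const 2).mul hvm).mul hφm)).sub
          (hAm.mul hdxm)).add (hDm.mul hφm)
      · simp only [hE, testedNovikov]
        have k1 : |-u t x * deriv (fun τ => φ τ x) t| ≤ L * B := by
          rw [abs_mul, abs_neg]
          exact mul_le_mul (huL t ht x) (hdtB t x) (abs_nonneg _) hL0
        have k2 : |u t x ^ 2 * v t x * φ t x| ≤ L ^ 2 * L * B := by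
          rw [abs_mul, abs_mul, abs_pow]
          have := huL t ht x
          have := hvL t ht x
          have := (hB (t, x)).1
          gcongr
        have k3 := mul_le_mul (hAB t ht x) (hdxB t x) (abs_nonneg _) hQ0
        have k4 := mul_le_mul (hDB t ht x) (hB (t, x)).1 (abs_nonneg _) hQ0
        rw [← abs_mul] at k3 k4
        refine (abs_add_le _ _).trans (add_le_add ((abs_sub _ _).trans (add_le_add
          ((abs_add_le _ _).trans (add_le_add k1 k2)) k3)) k4)
      · by_contra hcon
        obtain ⟨h1, h2⟩ := hz z.1 z.2 hcon
        refine hz0 ?_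
        simp only [hE, testedNovikov]
        rw [h1, hdx, hdt, h2]
        simp
    change ∫ z in Ioo 0 T ×ˢ X, E z = 0
    have hEint' : IntegrableOn E (Ioo 0 T ×ˢ X) ((volume : Measure ℝ).prod volume) := by
      rwa [IntegrableOn, ← Measure.volume_eq_prod]
    -- The pairing $\int u\varphi\,dx$ at time $t$.
    set N : ℝ → ℝ := fun t => 2 * p₁ t * invD2 X G (φ t) (q₁ t) + 2 * p₂ t * invD2 X G (φ t) (q₂ t)
      with hN
    have hNd : ∀ t ∈ Ioo 0 T, HasDerivAt N (-∫ x in X, E (t, x)) t := by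
      intro t ht
      obtain ⟨d₁, hd₁, hpd₁⟩ := hflow.deriv_q₁ t ht
      obtain ⟨d₂, hd₂, hpd₂⟩ := hflow.deriv_q₂ t ht
      obtain ⟨s1, s2⟩ := hflow.sep t ht
      obtain ⟨m1, m2, m3⟩ := hG.test_adm T φ hφ t
      have h1 := (((hflow.deriv_p₁ t ht).const_mul 2).mul (hG.hasDerivAt_invD2 hφ hd₁)).add
        (((hflow.deriv_p₂ t ht).const_mul 2).mul (hG.hasDerivAt_invD2 hφ hd₂))
      refine h1.congr_deriv ?_
      have h2 := hG.integral_testedNovikov m1 m2 m3 (p₁ := p₁ t) (p₂ := p₂ t)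
        (q₁ := q₁ t) (q₂ := q₂ t) (by linarith) (by linarith)
      simp only [hE]
      rw [h2]
      -- The velocities occur only multiplied by their amplitudes, which is all that the flow
      -- prescribes.
      linear_combination 2 * invD2 X G (deriv (φ t)) (q₁ t) * hpd₁ +
        2 * invD2 X G (deriv (φ t)) (q₂ t) * hpd₂
    have hN0 : ∀ t, t ∉ Icc a b → N t = 0 := fun t ht => by
      have : φ t = fun _ => 0 := funext fun x => by_contra fun h => ht (hsupp t x h).1
      simp [hN, this, invD2]
    have hNc : ContinuousOn N (Icc 0 T) := fun t ht => by
      refine ContinuousAt.continuousWithinAt ?_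
      by_cases htab : t ∈ Icc a b
      · exact (hNd t ⟨ha.trans_le htab.1, htab.2.trans_lt hb⟩).continuousAt
      · have : N =ᶠ[𝓝 t] fun _ => 0 := by
          filter_upwards [isClosed_Icc.isOpen_compl.mem_nhds htab] with τ hτ using hN0 τ hτ
        exact continuousAt_const.congr this.symm
    have hint : IntervalIntegrable (fun t => -∫ x in X, E (t, x)) volume 0 T := by
      rw [intervalIntegrable_iff_integrableOn_Ioo_of_le hT.le]
      have : Integrable E ((volume.restrict (Ioo 0 T)).prod (volume.restrict X)) := by
        rwa [Measure.prod_restrict, ← Measure.volume_eq_prod]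
      exact this.integral_prod_left.neg
    have hftc := intervalIntegral.integral_eq_sub_of_hasDerivAt_of_le hT.le hNc hNd hint
    rw [hN0 T (fun h => by linarith [h.2]), hN0 0 (fun h => by linarith [h.1]), sub_zero,
      intervalIntegral.integral_of_le hT.le, integral_Ioc_eq_integral_Ioo, integral_neg,
      neg_eq_zero] at hftc
    rw [Measure.volume_eq_prod, setIntegral_prod _ hEint', hftc]

end Weak

/-- The integrand of the tested equation is an exact derivative where `u'' = u`. -/
theorem hasDerivAt_boundaryTerm {w w' ψ ψ' h : ℝ → ℝ} {x : ℝ} (h1 : HasDerivAt w (w' x) x)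
    (h2 : HasDerivAt w' (w x) x) (h3 : HasDerivAt ψ (ψ' x) x)
    (h4 : HasDerivAt ψ' (ψ x - h x) x) :
    HasDerivAt (fun x => -(w x ^ 2 * w' x * ψ' x) + 1 / 2 * w x * w' x ^ 2 * ψ x)
      (w x ^ 2 * w' x * h x - (w x ^ 3 + 3 / 2 * w x * w' x ^ 2) * ψ' x
        + 1 / 2 * w' x ^ 3 * ψ x) x := by
  have e := ((((h1.pow 2).mul h2).mul h4).neg).add
    (((h1.const_mul (1 / 2)).mul (h2.pow 2)).mul h3)
  refine e.congr_deriv ?_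
  simp only [Pi.pow_apply, Pi.mul_apply]
  push_cast
  ring

/-- The jumps of the boundary term at the two crests. -/
theorem boundaryTerm_jumps (c a b p₁ p₂ ψ₁ ψ₁' ψ₂ ψ₂' : ℝ) :
    (-((c * p₁ + a * p₂) ^ 2 * (p₁ + b * p₂) * ψ₁')
        + 1 / 2 * (c * p₁ + a * p₂) * (p₁ + b * p₂) ^ 2 * ψ₁)
      - (-((c * p₁ + a * p₂) ^ 2 * (-p₁ + b * p₂) * ψ₁')
        + 1 / 2 * (c * p₁ + a * p₂) * (-p₁ + b * p₂) ^ 2 * ψ₁)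
      + (-((a * p₁ + c * p₂) ^ 2 * (-(b * p₁) + p₂) * ψ₂')
        + 1 / 2 * (a * p₁ + c * p₂) * (-(b * p₁) + p₂) ^ 2 * ψ₂)
      - (-((a * p₁ + c * p₂) ^ 2 * (-(b * p₁) - p₂) * ψ₂')
        + 1 / 2 * (a * p₁ + c * p₂) * (-(b * p₁) - p₂) ^ 2 * ψ₂)
    = 2 * p₁ * ((c * p₁ + a * p₂) * (p₂ * b) * ψ₁ - (c * p₁ + a * p₂) ^ 2 * ψ₁')
      + 2 * p₂ * (-(a * p₁ + c * p₂) * (p₁ * b) * ψ₂ - (a * p₁ + c * p₂) ^ 2 * ψ₂') := by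
  ring

/-! ### The line -/

/-- The derivative of `2 * lineKernel`. -/
def lineSlope (x : ℝ) : ℝ := if x ≤ 0 then Real.exp x else -Real.exp (-x)

/-- Smooth functions with compact support. -/
def IsLineAdm (h : ℝ → ℝ) : Prop := ContDiff ℝ ∞ h ∧ ∃ R : ℝ, ∀ x, h x ≠ 0 → |x| ≤ R

/-! ### Kernel and slope on the line -/

theorem two_mul_lineKernel (x : ℝ) :
    2 * lineKernel x = if x ≤ 0 then Real.exp x else Real.exp (-x) := by
  rw [lineKernel]
  split_ifs with h
  · rw [abs_of_nonpos h]; ring_nf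
  · rw [abs_of_pos (not_le.1 h)]; ring_nf

theorem two_mul_lineKernel' (x : ℝ) : 2 * lineKernel x = Real.exp (-|x|) := by
  rw [lineKernel]; ring

theorem abs_lineSlope (x : ℝ) : |lineSlope x| = Real.exp (-|x|) := by
  rw [lineSlope]
  split_ifs with h
  · rw [abs_of_pos (Real.exp_pos _), abs_of_nonpos h, neg_neg]
  · rw [abs_neg, abs_of_pos (Real.exp_pos _), abs_of_pos (not_le.1 h)]

theorem integrable_exp_neg_abs : Integrable fun x : ℝ => Real.exp (-|x|) := by
  rw [← integrableOn_univ, ← Iic_union_Ioi (a := (0 : ℝ))]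
  refine IntegrableOn.union ?_ ?_
  · refine (integrableOn_exp_Iic 0).congr_fun (fun x hx => ?_) measurableSet_Iic
    simp only [abs_of_nonpos (mem_Iic.1 hx), neg_neg]
  · refine (integrableOn_exp_neg_Ioi 0).congr_fun (fun x hx => ?_) measurableSet_Ioi
    simp only [abs_of_pos (mem_Ioi.1 hx)]

theorem measurable_lineSlope : Measurable lineSlope :=
  Measurable.ite measurableSet_Iic Real.measurable_exp (by fun_prop)

theorem exp_sub_exp_le {x y : ℝ} (h : x ≤ y) : |Real.exp x - Real.exp y| ≤ (y - x) * Real.exp y := by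
  rw [abs_of_nonpos (by linarith [Real.exp_le_exp.2 h])]
  have h1 : Real.exp x = Real.exp y * Real.exp (x - y) := by rw [← Real.exp_add]; ring_nf
  have h2 := Real.add_one_le_exp (x - y)
  nlinarith [Real.exp_pos y]

/-- Outside $(q,r]$ both arguments lie on the same smooth branch and the mean value estimate
applies; inside, the difference is at most $2$. The sign $\sigma$ treats the kernel and its slope at
once. -/
theorem line_profile_sub_le {k : ℝ → ℝ} (h1 : ∀ x ≤ 0, k x = Real.exp x) (σ : ℝ) (hσ : |σ| = 1)
    (h2 : ∀ x, 0 < x → k x = σ * Real.exp (-x)) {q r : ℝ} (hqr : q < r) (x : ℝ) :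
    |k (x - r) - k (x - q)| ≤ (r - q) * (Real.exp (-|x - q|) + Real.exp (-|x - r|))
      + (Ioc q r).indicator (fun _ => 2) x := by
  have hk : ∀ y, |k y| ≤ 1 := fun y => by
    rcases le_or_gt y 0 with h | h
    · rw [h1 y h, abs_of_pos (Real.exp_pos _)]; exact Real.exp_le_one_iff.2 h
    · rw [h2 y h, abs_mul, hσ, one_mul, abs_of_pos (Real.exp_pos _)]
      exact Real.exp_le_one_iff.2 (by linarith)
  have hpos : 0 ≤ (r - q) * (Real.exp (-|x - q|) + Real.exp (-|x - r|)) := by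
    have : 0 < r - q := sub_pos.2 hqr
    positivity
  by_cases hx : x ∈ Ioc q r
  · rw [indicator_of_mem hx]
    have := abs_sub (k (x - r)) (k (x - q))
    linarith [hk (x - r), hk (x - q)]
  · rw [indicator_of_notMem hx, add_zero]
    have hmul : ∀ y z : ℝ, (r - q) * Real.exp y ≤ (r - q) * (Real.exp y + Real.exp z) ∧
        (r - q) * Real.exp y ≤ (r - q) * (Real.exp z + Real.exp y) := fun y z => by
      have : 0 < r - q := sub_pos.2 hqr
      constructor <;> gcongr <;> linarith [Real.exp_pos z]
    rcases le_or_gt x q with h | h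
    · rw [h1 _ (by linarith), h1 _ (by linarith)]
      refine (exp_sub_exp_le (by linarith)).trans ?_
      rw [show x - q - (x - r) = r - q by ring, abs_of_nonpos (by linarith : x - q ≤ 0), neg_neg]
      exact (hmul _ _).1
    · have h3 : r < x := by by_contra h4; exact hx ⟨h, not_lt.1 h4⟩
      rw [h2 _ (by linarith), h2 _ (by linarith), ← mul_sub, abs_mul, hσ, one_mul, abs_sub_comm]
      refine (exp_sub_exp_le (by linarith)).trans ?_
      rw [show -(x - r) - -(x - q) = r - q by ring, abs_of_pos (by linarith : 0 < x - r)]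
      exact (hmul _ _).2

theorem lintegral_line_profile_sub_le {k : ℝ → ℝ} {q r : ℝ} (hqr : q < r)
    (hle : ∀ x, |k (x - r) - k (x - q)| ≤ (r - q) * (Real.exp (-|x - q|) + Real.exp (-|x - r|))
      + (Ioc q r).indicator (fun _ => 2) x) :
    ∫⁻ x in univ, ‖k (x - r) - k (x - q)‖ₑ
      ≤ ENNReal.ofReal ((2 * (∫ x : ℝ, Real.exp (-|x|)) + 2) * (r - q)) := by
  have i1 : ∀ q : ℝ, Integrable fun x : ℝ => Real.exp (-|x - q|) := fun q =>
    integrable_exp_neg_abs.comp_sub_right q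
  have i3 : Integrable ((Ioc q r).indicator (fun _ : ℝ => (2 : ℝ))) :=
    (integrable_indicator_iff measurableSet_Ioc).2 (integrableOn_const (by simp))
  have i2 : Integrable fun x : ℝ =>
      (r - q) * (Real.exp (-|x - q|) + Real.exp (-|x - r|)) :=
    ((i1 q).add (i1 r)).const_mul (r - q)
  rw [Measure.restrict_univ]
  calc ∫⁻ x, ‖k (x - r) - k (x - q)‖ₑ
      ≤ ∫⁻ x, ENNReal.ofReal ((r - q) * (Real.exp (-|x - q|) + Real.exp (-|x - r|))
        + (Ioc q r).indicator (fun _ => 2) x) := by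
        refine lintegral_mono fun x => ?_
        rw [← ofReal_norm]
        exact ENNReal.ofReal_le_ofReal (hle x)
    _ = ENNReal.ofReal (∫ x, ((r - q) * (Real.exp (-|x - q|) + Real.exp (-|x - r|))
        + (Ioc q r).indicator (fun _ => 2) x)) := by
        refine (ofReal_integral_eq_lintegral_ofReal (i2.add i3)
          (Eventually.of_forall fun x => (abs_nonneg _).trans (hle x))).symm
    _ = _ := by
        congr 1
        rw [integral_add i2 i3, integral_const_mul, integral_add (i1 q) (i1 r),
          integral_sub_right_eq_self (fun x : ℝ => Real.exp (-|x|)),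
          integral_sub_right_eq_self (fun x : ℝ => Real.exp (-|x|)),
          integral_indicator measurableSet_Ioc, setIntegral_const]
        simp only [Measure.real, Real.volume_Ioc, smul_eq_mul]
        rw [ENNReal.toReal_ofReal (by linarith)]
        ring

/-- Since $h$ vanishes beyond $\pm R$, the half-lines may be cut there. With oriented integrals this
is correct for every $q$, also outside $[-R,R]$. -/
theorem integral_split {R : ℝ} {h wl wr : ℝ → ℝ} (hh : Continuous h) (hwl : Continuous wl)
    (hwr : Continuous wr) (hsupp : ∀ x, h x ≠ 0 → |x| < R) (q : ℝ) :
    ∫ x, (if x ≤ q then wl x else wr x) * h x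
      = (∫ x in (-R)..q, wl x * h x) + ∫ x in q..R, wr x * h x := by
  have hcs : HasCompactSupport h := HasCompactSupport.intro (isCompact_Icc (a := -R) (b := R))
    fun x hx => by
      by_contra h0
      have := abs_lt.1 (hsupp x h0)
      exact hx ⟨this.1.le, this.2.le⟩
  have il : Integrable fun x => wl x * h x :=
    (hwl.mul hh).integrable_of_hasCompactSupport (hcs.mul_left)
  have ir : Integrable fun x => wr x * h x :=
    (hwr.mul hh).integrable_of_hasCompactSupport (hcs.mul_left)
  have el : EqOn (fun x => (if x ≤ q then wl x else wr x) * h x) (fun x => wl x * h x) (Iic q) :=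
    fun x hx => by simp only [if_pos (mem_Iic.1 hx)]
  have er : EqOn (fun x => (if x ≤ q then wl x else wr x) * h x) (fun x => wr x * h x) (Ioi q) :=
    fun x hx => by simp only [if_neg (not_le.2 (mem_Ioi.1 hx))]
  rw [← intervalIntegral.integral_Iic_add_Ioi
    (il.integrableOn.congr_fun el.symm measurableSet_Iic)
    (ir.integrableOn.congr_fun er.symm measurableSet_Ioi),
    setIntegral_congr_fun measurableSet_Iic el, setIntegral_congr_fun measurableSet_Ioi er,
    ← intervalIntegral.integral_Iic_sub_Iic il.integrableOn il.integrableOn,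
    ← intervalIntegral.integral_Ioi_sub_Ioi' ir.integrableOn ir.integrableOn]
  have z1 : ∫ x in Iic (-R), wl x * h x = 0 :=
    setIntegral_eq_zero_of_forall_eq_zero fun x hx => by
      have : h x = 0 := by
        by_contra h0
        exact absurd (mem_Iic.1 hx) (not_le.2 (abs_lt.1 (hsupp x h0)).1)
      rw [this, mul_zero]
  have z2 : ∫ x in Ioi R, wr x * h x = 0 :=
    setIntegral_eq_zero_of_forall_eq_zero fun x hx => by
      have : h x = 0 := by
        by_contra h0
        exact absurd (mem_Ioi.1 hx) (not_lt.2 (abs_lt.1 (hsupp x h0)).2.le)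
      rw [this, mul_zero]
  rw [z1, z2, sub_zero, sub_zero]

/-! ### Bessel potentials of compactly supported functions -/

theorem IsLineAdm.exists_support {h : ℝ → ℝ} (hh : IsLineAdm h) :
    ∃ R : ℝ, ∀ x, (h x ≠ 0 → |x| < R) ∧ (deriv h x ≠ 0 → |x| < R) := by
  obtain ⟨R, hR⟩ := hh.2
  refine ⟨R + 1, fun x => ⟨fun h0 => (hR x h0).trans_lt (by linarith), fun h0 => ?_⟩⟩
  by_contra hx
  have hopen : IsOpen {y : ℝ | R < |y|} := isOpen_lt continuous_const continuous_abs
  have hev : h =ᶠ[𝓝 x] fun _ => 0 := by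
    filter_upwards [hopen.mem_nhds (show R < |x| by linarith)] with y hy
    by_contra h1
    exact absurd (hR y h1) (not_le.2 hy)
  exact h0 (by rw [hev.deriv_eq]; simp)

theorem IsLineAdm.deriv {h : ℝ → ℝ} (hh : IsLineAdm h) : IsLineAdm (deriv h) := by
  obtain ⟨R, hR⟩ := hh.exists_support
  exact ⟨hh.1.deriv', R, fun x hx => ((hR x).2 hx).le⟩

theorem IsLineAdm.hasCompactSupport {h : ℝ → ℝ} (hh : IsLineAdm h) : HasCompactSupport h := by
  obtain ⟨R, hR⟩ := hh.2
  refine HasCompactSupport.intro (isCompact_Icc (a := -R) (b := R)) fun x hx => ?_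
  by_contra h0
  exact hx (abs_le.1 (hR x h0))

/-- Explicit formulas for the Bessel potential on the line and its derivative. -/
theorem IsLineAdm.invD2_eq {h : ℝ → ℝ} (hh : IsLineAdm h) : ∃ R : ℝ,
    (∀ x, invD2 univ lineKernel h x = 1 / 2 * (Real.exp (-x) * (∫ y in (-R)..x, Real.exp y * h y)
      + Real.exp x * ∫ y in x..R, Real.exp (-y) * h y)) ∧
    (∀ x, invD2 univ lineKernel (_root_.deriv h) x
      = 1 / 2 * (-(Real.exp (-x) * (∫ y in (-R)..x, Real.exp y * h y))
      + Real.exp x * ∫ y in x..R, Real.exp (-y) * h y)) ∧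
    ∀ q, ∫ x, lineSlope (x - q) * h x = Real.exp (-q) * (∫ y in (-R)..q, Real.exp y * h y)
      - Real.exp q * ∫ y in q..R, Real.exp (-y) * h y := by
  obtain ⟨R, hR⟩ := hh.exists_support
  have hc : Continuous h := hh.1.continuous
  have hc' : Continuous (_root_.deriv h) := hh.deriv.1.continuous
  have hd : ∀ x, HasDerivAt h (_root_.deriv h x) x := fun x =>
    (hh.1.differentiable (by simp)).differentiableAt.hasDerivAt
  have hzero : ∀ x, |x| = |R| → h x = 0 := fun x hx => by
    by_contra h0
    have := (hR x).1 h0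
    rw [hx] at this
    exact absurd this (not_lt.2 (le_abs_self R))
  have hpot : ∀ k : ℝ → ℝ, Continuous k → (∀ x, k x ≠ 0 → |x| < R) → ∀ x,
      invD2 univ lineKernel k x = 1 / 2 * (Real.exp (-x) * (∫ y in (-R)..x, Real.exp y * k y)
      + Real.exp x * ∫ y in x..R, Real.exp (-y) * k y) := by
    intro k hk hks x
    have h1 := integral_split (wl := fun y => 1 / 2 * (Real.exp (-x) * Real.exp y))
      (wr := fun y => 1 / 2 * (Real.exp x * Real.exp (-y))) hk (by fun_prop) (by fun_prop) hks x
    rw [invD2, Measure.restrict_univ]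
    refine Eq.trans (integral_congr_ae (Eventually.of_forall fun y => ?_)) (h1.trans ?_)
    · simp only []
      congr 1
      rw [lineKernel]
      split_ifs with hxy
      · rw [abs_of_nonneg (by linarith), ← Real.exp_add]; ring_nf
      · rw [abs_of_nonpos (by linarith [not_le.1 hxy]), ← Real.exp_add]; ring_nf
    · simp only [mul_assoc, intervalIntegral.integral_const_mul]
      ring
  refine ⟨R, hpot h hc fun x hx => (hR x).1 hx, fun x => ?_, fun q => ?_⟩
  · rw [hpot _ hc' (fun x hx => (hR x).2 hx)]
    -- Integration by parts on both sides of $x$: the boundary terms at $\pm R$ vanish, those at $x$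
    -- cancel because the kernel is continuous.
    have e1 : ∫ y in (-R)..x, Real.exp y * _root_.deriv h y
        = Real.exp x * h x - ∫ y in (-R)..x, Real.exp y * h y := by
      rw [intervalIntegral.integral_mul_deriv_eq_deriv_mul (fun y _ => Real.hasDerivAt_exp y)
        (fun y _ => hd y) (Real.continuous_exp.intervalIntegrable _ _)
        (hc'.intervalIntegrable _ _), hzero (-R) (abs_neg R)]
      ring
    have e2 : ∫ y in x..R, Real.exp (-y) * _root_.deriv h y
        = -(Real.exp (-x) * h x) + ∫ y in x..R, Real.exp (-y) * h y := by
      rw [intervalIntegral.integral_mul_deriv_eq_deriv_mul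
        (fun y _ => (hasDerivAt_neg y).exp)
        (fun y _ => hd y) (Continuous.intervalIntegrable (by fun_prop) _ _)
        (hc'.intervalIntegrable _ _), hzero R rfl]
      simp only [mul_neg, mul_one, neg_mul, intervalIntegral.integral_neg]
      ring
    rw [e1, e2]
    have : Real.exp (-x) * Real.exp x = 1 := by rw [← Real.exp_add]; simp
    linear_combination (1 / 2 * h x - 1 / 2 * h x) * this
  · have h1 := integral_split (wl := fun y => Real.exp (-q) * Real.exp y)
      (wr := fun y => -(Real.exp q * Real.exp (-y))) hc (by fun_prop) (by fun_prop)
      (fun x hx => (hR x).1 hx) q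
    refine Eq.trans (integral_congr_ae (Eventually.of_forall fun y => ?_)) (h1.trans ?_)
    · simp only [lineSlope]
      congr 1
      by_cases hyq : y ≤ q
      · rw [if_pos (by linarith), if_pos hyq, ← Real.exp_add]; ring_nf
      · rw [if_neg (by linarith), if_neg hyq, ← Real.exp_add]; ring_nf
    · simp only [neg_mul, mul_assoc, intervalIntegral.integral_const_mul,
        intervalIntegral.integral_neg]
      ring

theorem IsLineAdm.hasDerivAt_invD2 {h : ℝ → ℝ} (hh : IsLineAdm h) (x : ℝ) :
    HasDerivAt (invD2 univ lineKernel h) (invD2 univ lineKernel (_root_.deriv h) x) x ∧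
    HasDerivAt (invD2 univ lineKernel (_root_.deriv h)) (invD2 univ lineKernel h x - h x) x := by
  obtain ⟨R, h1, h2, -⟩ := hh.invD2_eq
  have hc : Continuous h := hh.1.continuous
  have c1 : Continuous fun y => Real.exp y * h y := by fun_prop
  have c2 : Continuous fun y => Real.exp (-y) * h y := by fun_prop
  have d1 : HasDerivAt (fun x => Real.exp (-x) * ∫ y in (-R)..x, Real.exp y * h y)
      (h x - Real.exp (-x) * ∫ y in (-R)..x, Real.exp y * h y) x := by
    have := ((hasDerivAt_neg x).exp).mul (c1.integral_hasStrictDerivAt (-R) x).hasDerivAt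
    refine this.congr_deriv ?_
    have : Real.exp (-x) * Real.exp x = 1 := by rw [← Real.exp_add]; simp
    linear_combination h x * this
  have d2 : HasDerivAt (fun x => Real.exp x * ∫ y in x..R, Real.exp (-y) * h y)
      (-h x + Real.exp x * ∫ y in x..R, Real.exp (-y) * h y) x := by
    have e : HasDerivAt (fun x => ∫ y in x..R, Real.exp (-y) * h y) (-(Real.exp (-x) * h x)) x :=
      intervalIntegral.integral_hasDerivAt_left (c2.intervalIntegrable _ _)
        (c2.stronglyMeasurableAtFilter _ _) c2.continuousAt
    have := (Real.hasDerivAt_exp x).mul e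
    refine this.congr_deriv ?_
    have : Real.exp (-x) * Real.exp x = 1 := by rw [← Real.exp_add]; simp
    linear_combination -h x * this
  rw [funext h1, funext h2]
  constructor
  · exact ((d1.add d2).const_mul (1 / 2)).congr_deriv (by ring)
  · exact ((d1.neg.add d2).const_mul (1 / 2)).congr_deriv (by ring)

theorem abs_lineKernel_le (x : ℝ) : |lineKernel x| ≤ 1 := by
  have h := two_mul_lineKernel' x
  have h1 : Real.exp (-|x|) ≤ 1 := Real.exp_le_one_iff.2 (by linarith [abs_nonneg x])
  have h2 := Real.exp_pos (-|x|)
  rw [abs_of_nonneg (by linarith)]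
  linarith

theorem continuous_lineKernel : Continuous lineKernel := by
  unfold lineKernel; fun_prop

theorem IsLineAdm.integrable {h : ℝ → ℝ} (hh : IsLineAdm h) : Integrable h :=
  hh.1.continuous.integrable_of_hasCompactSupport hh.hasCompactSupport

theorem IsLineAdm.bdd {h : ℝ → ℝ} (hh : IsLineAdm h) : ∃ B, ∀ x, |h x| ≤ B :=
  hh.hasCompactSupport.exists_bound_of_continuous hh.1.continuous

theorem IsLineAdm.bdd_invD2 {h : ℝ → ℝ} (hh : IsLineAdm h) :
    ∃ B, ∀ x, |invD2 univ lineKernel h x| ≤ B :=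
  ⟨_, abs_invD2_le abs_lineKernel_le hh.integrable.integrableOn⟩

/-! ### Exact integration of the tested equation on the line -/

theorem crestProfile_one (r : ℝ) : crestProfile 1 r = Real.exp (-r) := by
  rw [crestProfile, one_mul, Real.cosh_sub_sinh]

theorem slopeProfile_one (r : ℝ) : slopeProfile 1 r = Real.exp (-r) := by
  rw [slopeProfile, one_mul, Real.cosh_sub_sinh]

/-- The integrand of the tested equation, in terms of the potentials `ψ = D⁻² h` and
`ψ' = D⁻² h'`. -/
def cubicForm (u v h ψ ψ' : ℝ) : ℝ :=
  u ^ 2 * v * h - (u ^ 3 + 3 / 2 * u * v ^ 2) * ψ' + 1 / 2 * v ^ 3 * ψ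

/-- The boundary term that the tested equation integrates to. -/
def boundaryTerm (u v ψ ψ' : ℝ) : ℝ := -(u ^ 2 * v * ψ') + 1 / 2 * u * v ^ 2 * ψ

/-- To the left of both crests $u=u_x=Ke^x$. The integrand is exact and the boundary term decays at
$-\infty$, so only the value at $q$ survives. -/
theorem integral_cubicForm_Iic {h ψ ψ' : ℝ → ℝ} (hh : Continuous h)
    (hψ : ∀ x, HasDerivAt ψ (ψ' x) x ∧ HasDerivAt ψ' (ψ x - h x) x) {B : ℝ}
    (hB : ∀ x, |h x| ≤ B ∧ |ψ x| ≤ B ∧ |ψ' x| ≤ B) (K q : ℝ) :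
    IntegrableOn (fun x => cubicForm (K * Real.exp x) (K * Real.exp x) (h x) (ψ x) (ψ' x))
      (Iic q) ∧
    ∫ x in Iic q, cubicForm (K * Real.exp x) (K * Real.exp x) (h x) (ψ x) (ψ' x)
      = boundaryTerm (K * Real.exp q) (K * Real.exp q) (ψ q) (ψ' q) := by
  have c1 : Continuous ψ := continuous_iff_continuousAt.2 fun x => (hψ x).1.continuousAt
  have c2 : Continuous ψ' := continuous_iff_continuousAt.2 fun x => (hψ x).2.continuousAt
  have hexp : ∀ x, Real.exp (3 * x) = Real.exp x ^ 3 := fun x => by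
    rw [← Real.exp_nat_mul]; norm_num
  have hint : IntegrableOn
      (fun x => cubicForm (K * Real.exp x) (K * Real.exp x) (h x) (ψ x) (ψ' x)) (Iic q) := by
    have h1 : IntegrableOn (fun x => Real.exp (3 * x) * (K ^ 3 * (h x - 5 / 2 * ψ' x + 1 / 2 * ψ x)))
        (Iic q) := by
      refine (integrableOn_exp_mul_Iic (by norm_num) q).mul_bdd (c := |K| ^ 3 * (4 * B))
        (by fun_prop) (Eventually.of_forall fun x => ?_)
      obtain ⟨b1, b2, b3⟩ := hB x
      rw [abs_le] at b1 b2 b3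
      rw [norm_mul, norm_pow, Real.norm_eq_abs, Real.norm_eq_abs]
      refine mul_le_mul_of_nonneg_left ?_ (by positivity)
      rw [abs_le]
      constructor <;> linarith [b1.1, b1.2, b2.1, b2.2, b3.1, b3.2]
    refine h1.congr_fun (fun x _ => ?_) measurableSet_Iic
    simp only [cubicForm, hexp]; ring
  refine ⟨hint, ?_⟩
  have hd : ∀ x, HasDerivAt (fun x => K * Real.exp x) (K * Real.exp x) x := fun x =>
    (Real.hasDerivAt_exp x).const_mul K
  have hlim : Tendsto (fun x => boundaryTerm (K * Real.exp x) (K * Real.exp x) (ψ x) (ψ' x))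
      atBot (𝓝 0) := by
    refine squeeze_zero_norm (a := fun x => |K| ^ 3 * (2 * B) * Real.exp x ^ 3) (fun x => ?_) ?_
    · obtain ⟨b1, b2, b3⟩ := hB x
      rw [abs_le] at b1 b2 b3
      have : boundaryTerm (K * Real.exp x) (K * Real.exp x) (ψ x) (ψ' x)
          = K ^ 3 * (-ψ' x + 1 / 2 * ψ x) * Real.exp x ^ 3 := by
        simp only [boundaryTerm]; ring
      rw [this, norm_mul, norm_mul, norm_pow, Real.norm_eq_abs, Real.norm_eq_abs, Real.norm_eq_abs,
        abs_of_pos (a := Real.exp x ^ 3) (by positivity)]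
      have : |-ψ' x + 1 / 2 * ψ x| ≤ 2 * B := by
        rw [abs_le]
        constructor <;> linarith [b1.1, b1.2, b2.1, b2.2, b3.1, b3.2]
      gcongr
    · have := (Real.tendsto_exp_atBot.pow 3).const_mul (|K| ^ 3 * (2 * B))
      simpa using this
  have := integral_Iic_of_hasDerivAt_of_tendsto' (a := q) (fun x _ =>
    hasDerivAt_boundaryTerm (hd x) (hd x) (hψ x).1 (hψ x).2) hint hlim
  rw [sub_zero] at this
  exact this

/-- The reflection $x\mapsto-x$ reduces this to the left half-line; `cubicForm` is odd under
changing the signs of $v$ and $\psi'$. -/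
theorem integral_cubicForm_Ioi {h ψ ψ' : ℝ → ℝ} (hh : Continuous h)
    (hψ : ∀ x, HasDerivAt ψ (ψ' x) x ∧ HasDerivAt ψ' (ψ x - h x) x) {B : ℝ}
    (hB : ∀ x, |h x| ≤ B ∧ |ψ x| ≤ B ∧ |ψ' x| ≤ B) (K q : ℝ) :
    IntegrableOn (fun x => cubicForm (K * Real.exp (-x)) (-(K * Real.exp (-x))) (h x) (ψ x) (ψ' x))
      (Ioi q) ∧
    ∫ x in Ioi q, cubicForm (K * Real.exp (-x)) (-(K * Real.exp (-x))) (h x) (ψ x) (ψ' x)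
      = -boundaryTerm (K * Real.exp (-q)) (-(K * Real.exp (-q))) (ψ q) (ψ' q) := by
  have hψr : ∀ x, HasDerivAt (fun x => ψ (-x)) (-ψ' (-x)) x ∧
      HasDerivAt (fun x => -ψ' (-x)) (ψ (-x) - h (-x)) x := fun x => by
    refine ⟨((hψ (-x)).1.comp x (hasDerivAt_neg x)).congr_deriv (by ring),
      ((hψ (-x)).2.comp x (hasDerivAt_neg x)).neg.congr_deriv (by ring)⟩
  obtain ⟨h1, h2⟩ := integral_cubicForm_Iic (h := fun x => h (-x)) (by fun_prop) hψr
    (fun x => ⟨(hB (-x)).1, (hB (-x)).2.1, by rw [abs_neg]; exact (hB (-x)).2.2⟩) K (-q)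
  have hflip : ∀ x, cubicForm (K * Real.exp (-x)) (-(K * Real.exp (-x))) (h x) (ψ x) (ψ' x)
      = -cubicForm (K * Real.exp (-x)) (K * Real.exp (-x)) (h (- -x)) (ψ (- -x)) (-ψ' (- -x)) :=
    fun x => by rw [neg_neg]; simp only [cubicForm]; ring
  constructor
  · have h3 := ((h1.mono_set Iio_subset_Iic_self).comp_neg_Ioi).neg
    simp only [neg_neg] at h3
    refine h3.congr_fun (fun x _ => ?_) measurableSet_Ioi
    rw [hflip, neg_neg]
    rfl
  · simp only [hflip]
    rw [integral_neg, integral_comp_neg_Ioi q (fun x => cubicForm (K * Real.exp x) (K * Real.exp x)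
      (h (-x)) (ψ (-x)) (-ψ' (-x))), h2]
    simp only [boundaryTerm, neg_neg]
    ring

theorem integral_cubicForm_interval {w w' h ψ ψ' : ℝ → ℝ} (hh : Continuous h)
    (hw : ∀ x, HasDerivAt w (w' x) x ∧ HasDerivAt w' (w x) x)
    (hψ : ∀ x, HasDerivAt ψ (ψ' x) x ∧ HasDerivAt ψ' (ψ x - h x) x) (a b : ℝ) :
    ∫ x in a..b, cubicForm (w x) (w' x) (h x) (ψ x) (ψ' x)
      = boundaryTerm (w b) (w' b) (ψ b) (ψ' b) - boundaryTerm (w a) (w' a) (ψ a) (ψ' a) := by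
  have c1 : Continuous ψ := continuous_iff_continuousAt.2 fun x => (hψ x).1.continuousAt
  have c2 : Continuous ψ' := continuous_iff_continuousAt.2 fun x => (hψ x).2.continuousAt
  have c3 : Continuous w := continuous_iff_continuousAt.2 fun x => (hw x).1.continuousAt
  have c4 : Continuous w' := continuous_iff_continuousAt.2 fun x => (hw x).2.continuousAt
  refine intervalIntegral.integral_eq_sub_of_hasDerivAt (fun x _ =>
    hasDerivAt_boundaryTerm (hw x).1 (hw x).2 (hψ x).1 (hψ x).2) ?_
  exact Continuous.intervalIntegrable (by fun_prop) _ _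

/-- The integral is exact on each of the three pieces cut out by the crests. The boundary values add
up to the jumps at $q_1$ and $q_2$, caused by the slope dropping by $2p_i$ there. -/
theorem IsLineAdm.integral_cubicForm {h : ℝ → ℝ} (hh : IsLineAdm h) (p₁ p₂ : ℝ) {q₁ q₂ : ℝ}
    (hq : q₁ < q₂) :
    ∫ x, cubicForm (pairField (fun x => 2 * lineKernel x) p₁ p₂ q₁ q₂ x)
        (pairField lineSlope p₁ p₂ q₁ q₂ x) (h x) (invD2 univ lineKernel h x)
        (invD2 univ lineKernel (_root_.deriv h) x)
    = 2 * p₁ * ((1 * p₁ + crestProfile 1 (q₂ - q₁) * p₂) *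
          (p₂ * slopeProfile 1 (q₂ - q₁)) * invD2 univ lineKernel h q₁
        - (1 * p₁ + crestProfile 1 (q₂ - q₁) * p₂) ^ 2 * invD2 univ lineKernel (_root_.deriv h) q₁)
      + 2 * p₂ * (-(crestProfile 1 (q₂ - q₁) * p₁ + 1 * p₂) *
          (p₁ * slopeProfile 1 (q₂ - q₁)) * invD2 univ lineKernel h q₂
        - (crestProfile 1 (q₂ - q₁) * p₁ + 1 * p₂) ^ 2
          * invD2 univ lineKernel (_root_.deriv h) q₂) := by
  set ψ := invD2 univ lineKernel h with hψdef
  set ψ' := invD2 univ lineKernel (_root_.deriv h) with hψ'def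
  have hψ : ∀ x, HasDerivAt ψ (ψ' x) x ∧ HasDerivAt ψ' (ψ x - h x) x := hh.hasDerivAt_invD2
  have hc := hh.1.continuous
  obtain ⟨B₁, hB₁⟩ := hh.bdd
  obtain ⟨B₂, hB₂⟩ := hh.bdd_invD2
  obtain ⟨B₃, hB₃⟩ := hh.deriv.bdd_invD2
  have hB : ∀ x, |h x| ≤ max B₁ (max B₂ B₃) ∧ |ψ x| ≤ max B₁ (max B₂ B₃) ∧
      |ψ' x| ≤ max B₁ (max B₂ B₃) := fun x =>
    ⟨(hB₁ x).trans (le_max_left _ _), (hB₂ x).trans ((le_max_left _ _).trans (le_max_right _ _)),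
      (hB₃ x).trans ((le_max_right _ _).trans (le_max_right _ _))⟩
  obtain ⟨l1, l2⟩ := integral_cubicForm_Iic hc hψ hB
    (p₁ * Real.exp (-q₁) + p₂ * Real.exp (-q₂)) q₁
  obtain ⟨r1, r2⟩ := integral_cubicForm_Ioi hc hψ hB
    (p₁ * Real.exp q₁ + p₂ * Real.exp q₂) q₂
  set w : ℝ → ℝ := fun x => p₁ * Real.exp (-(x - q₁)) + p₂ * Real.exp (x - q₂) with hw
  set w' : ℝ → ℝ := fun x => -(p₁ * Real.exp (-(x - q₁))) + p₂ * Real.exp (x - q₂) with hw'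
  have hwd : ∀ x, HasDerivAt w (w' x) x ∧ HasDerivAt w' (w x) x := fun x => by
    have e1 : HasDerivAt (fun x => p₁ * Real.exp (-(x - q₁))) (-(p₁ * Real.exp (-(x - q₁)))) x := by
      have := (((hasDerivAt_id x).sub_const q₁).neg.exp).const_mul p₁
      exact this.congr_deriv (by simp)
    have e2 : HasDerivAt (fun x => p₂ * Real.exp (x - q₂)) (p₂ * Real.exp (x - q₂)) x := by
      have := (((hasDerivAt_id x).sub_const q₂).exp).const_mul p₂
      exact this.congr_deriv (by simp)
    exact ⟨e1.add e2, (e1.neg.add e2).congr_deriv (by simp only [hw]; ring)⟩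
  have m := integral_cubicForm_interval hc hwd hψ q₁ q₂
  set E : ℝ → ℝ := fun x => cubicForm (pairField (fun x => 2 * lineKernel x) p₁ p₂ q₁ q₂ x)
        (pairField lineSlope p₁ p₂ q₁ q₂ x) (h x) (ψ x) (ψ' x) with hE
  have el : EqOn (fun x => cubicForm ((p₁ * Real.exp (-q₁) + p₂ * Real.exp (-q₂)) * Real.exp x)
      ((p₁ * Real.exp (-q₁) + p₂ * Real.exp (-q₂)) * Real.exp x) (h x) (ψ x) (ψ' x)) E (Iic q₁) := by
    intro x hx
    have hx1 : x - q₁ ≤ 0 := sub_nonpos.2 hx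
    have hx2 : x - q₂ ≤ 0 := by linarith
    simp only [hE, pairField, two_mul_lineKernel, lineSlope, if_pos hx1, if_pos hx2]
    rw [sub_eq_add_neg x q₁, sub_eq_add_neg x q₂, Real.exp_add, Real.exp_add]
    congr 1 <;> ring
  have em : EqOn (fun x => cubicForm (w x) (w' x) (h x) (ψ x) (ψ' x)) E (Ioc q₁ q₂) := by
    intro x hx
    have hx1 : ¬ x - q₁ ≤ 0 := not_le.2 (sub_pos.2 hx.1)
    have hx2 : x - q₂ ≤ 0 := sub_nonpos.2 hx.2
    simp only [hE, pairField, two_mul_lineKernel, lineSlope, if_neg hx1, if_pos hx2, hw, hw']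
    congr 1; ring
  have er : EqOn (fun x => cubicForm ((p₁ * Real.exp q₁ + p₂ * Real.exp q₂) * Real.exp (-x))
      (-((p₁ * Real.exp q₁ + p₂ * Real.exp q₂) * Real.exp (-x))) (h x) (ψ x) (ψ' x)) E (Ioi q₂) := by
    intro x hx
    have hx2 : ¬ x - q₂ ≤ 0 := not_le.2 (sub_pos.2 hx)
    have hx1 : ¬ x - q₁ ≤ 0 := fun h => hx2 (by linarith)
    simp only [hE, pairField, two_mul_lineKernel, lineSlope, if_neg hx1, if_neg hx2]
    rw [neg_sub, neg_sub, sub_eq_add_neg q₁, sub_eq_add_neg q₂, Real.exp_add, Real.exp_add]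
    congr 1 <;> ring
  have hI : IntegrableOn (fun x => cubicForm (w x) (w' x) (h x) (ψ x) (ψ' x)) (Ioc q₁ q₂) := by
    have c1 : Continuous ψ := continuous_iff_continuousAt.2 fun x => (hψ x).1.continuousAt
    have c2 : Continuous ψ' := continuous_iff_continuousAt.2 fun x => (hψ x).2.continuousAt
    refine (Continuous.integrableOn_Icc ?_).mono_set Ioc_subset_Icc_self
    simp only [cubicForm, hw, hw']; fun_prop
  have il := l1.congr_fun el measurableSet_Iic
  have im := hI.congr_fun em measurableSet_Ioc
  have ir := r1.congr_fun er measurableSet_Ioi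
  have ilm : IntegrableOn E (Iic q₂) := by
    rw [← Iic_union_Ioc_eq_Iic hq.le]; exact il.union im
  rw [← intervalIntegral.integral_Iic_add_Ioi ilm ir,
    ← Iic_union_Ioc_eq_Iic hq.le, setIntegral_union (by
      rw [Set.disjoint_left]; intro x hx hx'; exact absurd (mem_Iic.1 hx) (not_le.2 hx'.1))
      measurableSet_Ioc il im, ← setIntegral_congr_fun measurableSet_Iic el,
    ← setIntegral_congr_fun measurableSet_Ioc em, ← setIntegral_congr_fun measurableSet_Ioi er,
    ← intervalIntegral.integral_of_le hq.le, l2, m, r2, crestProfile_one, slopeProfile_one,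
    ← boundaryTerm_jumps]
  have x1 : (p₁ * Real.exp (-q₁) + p₂ * Real.exp (-q₂)) * Real.exp q₁
      = p₁ + Real.exp (-(q₂ - q₁)) * p₂ := by
    rw [add_mul, mul_assoc, mul_assoc, ← Real.exp_add, ← Real.exp_add]
    simp only [neg_add_cancel, Real.exp_zero]; ring_nf
  have x2 : (p₁ * Real.exp q₁ + p₂ * Real.exp q₂) * Real.exp (-q₂)
      = Real.exp (-(q₂ - q₁)) * p₁ + p₂ := by
    rw [add_mul, mul_assoc, mul_assoc, ← Real.exp_add, ← Real.exp_add]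
    simp only [add_neg_cancel, Real.exp_zero]; ring_nf
  have x3 : q₁ - q₂ = -(q₂ - q₁) := by ring
  simp only [boundaryTerm, x1, x2, hw, hw', sub_self, neg_zero, Real.exp_zero, x3]
  ring

/-! ### The line as a peakon geometry -/

theorem IsLineTest.peakon_properties {T : ℝ} {φ : ℝ → ℝ → ℝ} (hφ : IsLineTest T φ) :
    (∃ B : ℝ, ∀ z, |φ z.1 z.2| ≤ B ∧ ‖fderiv ℝ (fun z : ℝ × ℝ => φ z.1 z.2) z‖ ≤ B) ∧
    ∀ t, IsLineAdm (φ t) ∧ IsLineAdm (deriv (φ t)) ∧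
      IsLineAdm (fun x => deriv (fun τ => φ τ x) t) := by
  obtain ⟨hs, a, b, R, ha, hb, hR⟩ := hφ
  constructor
  · have hcs : HasCompactSupport (fun z : ℝ × ℝ => φ z.1 z.2) :=
      HasCompactSupport.intro (isCompact_Icc.prod (isCompact_Icc (a := -R) (b := R))
        : IsCompact (Icc a b ×ˢ Icc (-R) R)) fun z hz => by
          by_contra h0
          exact hz ⟨(hR _ _ h0).1, abs_le.1 (hR _ _ h0).2⟩
    obtain ⟨B₁, hB₁⟩ := hcs.exists_bound_of_continuous hs.continuous
    obtain ⟨B₂, hB₂⟩ := (hcs.fderiv (𝕜 := ℝ)).exists_bound_of_continuous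
      (hs.continuous_fderiv (by simp))
    exact ⟨max B₁ B₂, fun z => ⟨(hB₁ z).trans (le_max_left _ _), (hB₂ z).trans (le_max_right _ _)⟩⟩
  · intro t
    have h1 : IsLineAdm (φ t) :=
      ⟨hs.comp (contDiff_const.prodMk contDiff_id), R, fun x hx => (hR t x hx).2⟩
    refine ⟨h1, h1.deriv, ?_, R, fun x hx => ?_⟩
    · have h2 : (fun x => deriv (fun τ => φ τ x) t)
          = fun x => fderiv ℝ (fun z : ℝ × ℝ => φ z.1 z.2) (t, x) (1, 0) :=
        funext fun x => (hasDerivAt_fst hs t x).deriv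
      rw [h2]
      exact ((hs.fderiv_right (m := ∞) (by simp)).comp
        (contDiff_const.prodMk contDiff_id)).clm_apply contDiff_const
    · by_contra hx'
      refine hx ?_
      have : (fun τ => φ τ x) = fun _ => 0 := funext fun τ => by
        by_contra h0; exact hx' (hR τ x h0).2
      change deriv (fun τ => φ τ x) t = 0
      rw [this]; simp

theorem line_peakonGeometry :
    PeakonGeometry univ lineKernel lineSlope IsLineTest IsLineAdm 1 := by
  set C := ∫ x : ℝ, Real.exp (-|x|) with hC
  have hC0 : 0 ≤ C := integral_nonneg fun x => (Real.exp_pos _).le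
  have hle1 : ∀ x : ℝ, Real.exp (-|x|) ≤ 1 := fun x =>
    Real.exp_le_one_iff.2 (by linarith [abs_nonneg x])
  have hlint : ∀ q, ∫⁻ x : ℝ, ENNReal.ofReal (Real.exp (-|x - q|)) = ENNReal.ofReal C := fun q => by
    rw [lintegral_sub_right_eq_self (fun x : ℝ => ENNReal.ofReal (Real.exp (-|x|))),
      ofReal_integral_eq_lintegral_ofReal integrable_exp_neg_abs
        (Eventually.of_forall fun x => (Real.exp_pos _).le)]
  refine
    { measurable_G := continuous_lineKernel.measurable
      measurable_dg := measurable_lineSlope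
      bdd := ⟨1, fun x => ?_⟩
      lintegral_le := ⟨C, hC0, fun q => ?_⟩
      lintegral_sub_le := ⟨2 * C + 2, by positivity, fun q r hqr _ => ⟨?_, ?_⟩⟩
      even := fun x => by rw [lineKernel, lineKernel, abs_neg]
      adm_continuous := fun h hh => hh.1.continuous
      adm_integrable := fun h hh => hh.integrable.integrableOn
      adm_bdd := fun h hh => hh.bdd
      conv := fun h _ q => ?_
      weak := fun h hh q => ?_
      jump := fun h hh _ p₁ p₂ q₁ q₂ hq _ => ?_
      test_smooth := fun T φ hφ => hφ.1
      test_support := fun T φ hφ => ?_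
      test_bdd := fun T φ hφ => hφ.peakon_properties.1
      test_adm := fun T φ hφ => hφ.peakon_properties.2 }
  · rw [two_mul_lineKernel', abs_lineSlope, abs_of_pos (Real.exp_pos _)]
    exact ⟨hle1 x, hle1 x⟩
  · rw [Measure.restrict_univ]
    constructor
    · refine (lintegral_mono fun x => ?_).trans (hlint q).le
      rw [← ofReal_norm, two_mul_lineKernel', Real.norm_eq_abs, abs_of_pos (Real.exp_pos _)]
    · refine (lintegral_mono fun x => ?_).trans (hlint q).le
      rw [← ofReal_norm, Real.norm_eq_abs, abs_lineSlope]
  · refine lintegral_line_profile_sub_le (k := fun x => 2 * lineKernel x) hqr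
      (line_profile_sub_le (k := fun x => 2 * lineKernel x) (fun x hx => ?_) 1 abs_one (fun x hx => ?_) hqr)
    · rw [two_mul_lineKernel, if_pos hx]
    · rw [two_mul_lineKernel, if_neg (not_le.2 hx), one_mul]
  · refine lintegral_line_profile_sub_le hqr
      (line_profile_sub_le (fun x hx => ?_) (-1) (by simp) (fun x hx => ?_) hqr)
    · rw [lineSlope, if_pos hx]
    · rw [lineSlope, if_neg (not_le.2 hx), neg_one_mul]
  · rw [invD2, Measure.restrict_univ]
    have := integral_sub_left_eq_self (fun y => lineKernel y * h (q - y)) volume q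
    simpa using this
  · rw [Measure.restrict_univ]
    obtain ⟨R, -, h2, h3⟩ := hh.invD2_eq
    have h4 : ∫ x, 2 * lineKernel (x - q) * deriv h x
        = 2 * invD2 univ lineKernel (deriv h) q := by
      rw [invD2, Measure.restrict_univ, ← integral_const_mul]
      refine integral_congr_ae (Eventually.of_forall fun x => ?_)
      simp only [lineKernel]
      rw [abs_sub_comm]; ring
    rw [h4, h2, h3]; ring
  · rw [Measure.restrict_univ]
    exact hh.integral_cubicForm p₁ p₂ hq
  · obtain ⟨-, a, b, R, ha, hb, hR⟩ := hφ
    refine ⟨a, b, Icc (-R) R, ha, hb, isClosed_Icc, ?_, fun t x h0 =>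
      ⟨(hR t x h0).1, abs_le.1 (hR t x h0).2⟩⟩
    rw [inter_univ]
    exact measure_Icc_lt_top

/-- A test function for the shorter interval vanishes with its derivatives at the remaining times,
so the integrals over both intervals agree. -/
theorem IsWeakNovikov.mono {X : Set ℝ} {G : ℝ → ℝ} {Test Test' : (ℝ → ℝ → ℝ) → Prop} {T T' : ℝ}
    {u v : ℝ → ℝ → ℝ} (hX : MeasurableSet X) (hT : T' ≤ T)
    (hTest : ∀ φ, Test' φ → Test φ ∧ ∃ a b : ℝ, 0 < a ∧ b < T' ∧
      ∀ t x, φ t x ≠ 0 → t ∈ Icc a b)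
    (h : IsWeakNovikov X G Test T u v) : IsWeakNovikov X G Test' T' u v := by
  have hsub : Ioo 0 T' ×ˢ X ⊆ Ioo 0 T ×ˢ X := prod_mono (Ioo_subset_Ioo_right hT) subset_rfl
  have hms : MeasurableSet (Ioo 0 T ×ˢ X) := measurableSet_Ioo.prod hX
  have hvan : ∀ φ, Test' φ → ∀ z ∈ (Ioo 0 T ×ˢ X) \ (Ioo 0 T' ×ˢ X), φ z.1 z.2 = 0 ∧
      deriv (φ z.1) z.2 = 0 ∧ deriv (fun τ => φ τ z.2) z.1 = 0 := by
    intro φ hφ z hz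
    obtain ⟨-, a, b, ha, hb, hab⟩ := hTest φ hφ
    have hz1 : z.1 ∉ Icc a b := fun hz1 =>
      hz.2 ⟨⟨ha.trans_le hz1.1, hz1.2.trans_lt hb⟩, hz.1.2⟩
    have h0 : ∀ t ∉ Icc a b, ∀ x, φ t x = 0 := fun t ht x => by
      by_contra hne; exact ht (hab t x hne)
    refine ⟨h0 _ hz1 _, ?_, ?_⟩
    · rw [show φ z.1 = fun _ => 0 from funext (h0 _ hz1)]; simp
    · have : (fun τ => φ τ z.2) =ᶠ[𝓝 z.1] fun _ => 0 := by
        filter_upwards [isClosed_Icc.isOpen_compl.mem_nhds hz1] with t ht using h0 t ht _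
      rw [this.deriv_eq]; simp
  refine ⟨h.memLp_u.mono_measure (Measure.restrict_mono hsub le_rfl),
    h.memLp_v.mono_measure (Measure.restrict_mono hsub le_rfl), fun φ hφ => ?_, fun φ hφ => ?_⟩
  · have := h.weakDeriv φ (hTest φ hφ).1
    rwa [setIntegral_eq_of_subset_of_forall_sdiff_eq_zero hms hsub,
      setIntegral_eq_of_subset_of_forall_sdiff_eq_zero hms hsub] at this
    · intro z hz; rw [(hvan φ hφ z hz).1, mul_zero]
    · intro z hz; rw [(hvan φ hφ z hz).2.1, mul_zero]
  · have := h.equation φ (hTest φ hφ).1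
    rwa [setIntegral_eq_of_subset_of_forall_sdiff_eq_zero hms hsub] at this
    intro z hz
    obtain ⟨h1, h2, h3⟩ := hvan φ hφ z hz
    rw [h1, h2, h3]; ring

/-! ### Fourier transform of the peakon on the line -/

theorem line_freqScale : FreqScale (volume : Measure ℝ) (fun ξ => ξ) where
  meas := measurable_id
  map_neg _ := rfl
  integrable r hr := by
    have := integrable_rpow_neg_one_add_norm_sq (E := ℝ) (μ := volume) (r := 2 * r)
      (by simp; linarith)
    simpa [show -(2 * r) / 2 = -r by ring] using this
  dyadic := ⟨1, one_pos, fun R _ => by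
    have : {ξ : ℝ | R ≤ ξ ∧ ξ ≤ 2 * R} = Icc R (2 * R) := rfl
    rw [this, Real.volume_Icc]
    exact ENNReal.ofReal_le_ofReal (by linarith)⟩
  eval_zero f hf h0 := by
    have := (Continuous.ae_eq_iff_eq volume hf continuous_const).1 h0
    rw [this]

theorem isLineFourier_of_integrable {f : ℝ → ℝ} {F : ℝ → ℂ} (hf : Integrable f)
    (hF : ∀ᵐ ξ : ℝ, F ξ = ∫ x : ℝ, Complex.exp (-(Complex.I * x * ξ)) * (f x : ℂ)) :
    IsLineFourier f F := by
  intro φ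
  have hexp : ∀ x ξ : ℝ, ‖Complex.exp (-(Complex.I * x * ξ))‖ = 1 := fun x ξ => by
    rw [Complex.norm_exp]; simp
  have hint : Integrable (Function.uncurry fun x ξ : ℝ =>
      Complex.exp (-(Complex.I * x * ξ)) * ((f x : ℂ) * φ ξ)) (volume.prod volume) := by
    refine (hf.ofReal.mul_prod φ.integrable).bdd_mul (c := 1)
      (Continuous.aestronglyMeasurable (by fun_prop)) (Eventually.of_forall fun z => ?_)
    exact (hexp z.1 z.2).le
  have h1 : ∫ ξ : ℝ, F ξ * φ ξ
      = ∫ ξ : ℝ, (∫ x : ℝ, Complex.exp (-(Complex.I * x * ξ)) * (f x : ℂ)) * φ ξ := by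
    refine integral_congr_ae ?_
    filter_upwards [hF] with ξ hξ
    rw [hξ]
  rw [h1]
  simp only [← integral_const_mul, ← integral_mul_const]
  refine Eq.trans ?_ ((integral_integral_swap hint).trans ?_)
  · congr 1; ext x; congr 1; ext ξ; ring
  · congr 1; ext x; congr 1; ext ξ; ring

theorem integrable_two_mul_lineKernel (q : ℝ) : Integrable fun x => 2 * lineKernel (x - q) := by
  simp only [two_mul_lineKernel']
  exact integrable_exp_neg_abs.comp_sub_right q

/-- The two half-line exponentials add up to $2/(1+\xi^2)$, whence $\kappa=2$; the translation gives
the phase. -/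
theorem integral_exp_mul_lineKernel (q ξ : ℝ) :
    ∫ x : ℝ, Complex.exp (-(Complex.I * x * ξ)) * ((2 * lineKernel (x - q) : ℝ) : ℂ)
      = peakonSymbol 2 (fun ξ => ξ) q ξ := by
  have h0 : ∫ x : ℝ, Complex.exp (-(Complex.I * x * ξ)) * ((2 * lineKernel x : ℝ) : ℂ)
      = ((2 / (1 + ξ ^ 2) : ℝ) : ℂ) := by
    have r1 : (0 : ℝ) < (1 - Complex.I * ξ).re := by simp
    have r2 : (-1 - Complex.I * ξ).re < (0 : ℝ) := by simp
    have el : EqOn (fun x : ℝ => Complex.exp ((1 - Complex.I * ξ) * x))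
        (fun x : ℝ => Complex.exp (-(Complex.I * x * ξ)) * ((2 * lineKernel x : ℝ) : ℂ))
        (Iic 0) := fun x hx => by
      simp only
      rw [two_mul_lineKernel, if_pos (mem_Iic.1 hx), Complex.ofReal_exp, ← Complex.exp_add]
      ring_nf
    have er : EqOn (fun x : ℝ => Complex.exp ((-1 - Complex.I * ξ) * x))
        (fun x : ℝ => Complex.exp (-(Complex.I * x * ξ)) * ((2 * lineKernel x : ℝ) : ℂ))
        (Ioi 0) := fun x hx => by
      simp only
      rw [two_mul_lineKernel, if_neg (not_le.2 hx), Complex.ofReal_exp, ← Complex.exp_add]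
      push_cast
      ring_nf
    rw [← intervalIntegral.integral_Iic_add_Ioi
      ((integrableOn_exp_mul_complex_Iic r1 0).congr_fun el measurableSet_Iic)
      ((integrableOn_exp_mul_complex_Ioi r2 0).congr_fun er measurableSet_Ioi),
      ← setIntegral_congr_fun measurableSet_Iic el, ← setIntegral_congr_fun measurableSet_Ioi er,
      integral_exp_mul_complex_Iic r1, integral_exp_mul_complex_Ioi r2]
    have n1 : (1 - Complex.I * ξ) ≠ 0 := fun h => by rw [h] at r1; simp at r1
    have n2 : (-1 - Complex.I * ξ) ≠ 0 := fun h => by rw [h] at r2; simp at r2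
    have n3 : (1 + (ξ : ℂ) ^ 2) ≠ 0 := by
      have : (1 + ξ ^ 2 : ℝ) ≠ 0 := by positivity
      exact_mod_cast this
    push_cast
    simp only [mul_zero, Complex.exp_zero]
    rw [div_add_div _ _ n1 n2, div_eq_div_iff (mul_ne_zero n1 n2) n3]
    ring_nf
    simp only [Complex.I_sq]
    ring
  rw [← integral_add_right_eq_self _ q]
  have h2 : ∀ x : ℝ, Complex.exp (-(Complex.I * ((x + q : ℝ) : ℂ) * ξ))
      * ((2 * lineKernel (x + q - q) : ℝ) : ℂ) = Complex.exp (-(Complex.I * q * ξ)) *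
        (Complex.exp (-(Complex.I * x * ξ)) * ((2 * lineKernel x : ℝ) : ℂ)) := fun x => by
    rw [add_sub_cancel_right, ← mul_assoc, ← Complex.exp_add]
    push_cast
    ring_nf
  simp only [h2]
  rw [integral_const_mul, h0, peakonSymbol, mul_comm]

theorem IsLineTest.mono {T T' : ℝ} (hT : T' ≤ T) {φ : ℝ → ℝ → ℝ} (hφ : IsLineTest T' φ) :
    IsLineTest T φ ∧ ∃ a b : ℝ, 0 < a ∧ b < T' ∧ ∀ t x, φ t x ≠ 0 → t ∈ Icc a b := by
  obtain ⟨h1, a, b, R, ha, hb, h⟩ := hφ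
  exact ⟨⟨h1, a, b, R, ha, hb.trans_le hT, h⟩, a, b, ha, hb, fun t x hx => (h t x hx).1⟩

theorem line_admitsPeakons {s : ℝ} (hs : s < 3 / 2) :
    AdmitsPeakons (j := fun ξ => ξ) (hj := measurable_id) line_freqScale hs 2 1 (LineSolution s) where
  continuousOn _ _ h := h.1
  mono T T' U hT h := by
    obtain ⟨hc, u, v, hw, hae⟩ := h
    exact ⟨hc.mono (Icc_subset_Icc_right hT), u, v,
      hw.mono MeasurableSet.univ hT fun φ hφ => hφ.mono hT,
      ae_mono (Measure.restrict_mono (Ioo_subset_Ioo_right hT) le_rfl) hae⟩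
  flow T p₁ p₂ q₁ q₂ U hT hflow hc hU := by
    refine ⟨hc, _, _, line_peakonGeometry.isWeakNovikov hT hflow, ?_⟩
    refine (ae_restrict_iff' measurableSet_Ioo).2 (Eventually.of_forall fun t ht => ?_)
    have i1 := (integrable_two_mul_lineKernel (q₁ t)).const_mul (p₁ t)
    have i2 := (integrable_two_mul_lineKernel (q₂ t)).const_mul (p₂ t)
    refine isLineFourier_of_integrable (i1.add i2) ?_
    filter_upwards [coeFn_peakonPair (j := fun ξ => ξ) (hj := measurable_id) line_freqScale hs (κ := 2)
      (p₁ t) (p₂ t) (q₁ t) (q₂ t)] with ξ hξ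
    rw [hU t ht, hξ, ← integral_exp_mul_lineKernel, ← integral_exp_mul_lineKernel (q₂ t),
      ← integral_const_mul, ← integral_const_mul, ← integral_add]
    · congr 1; ext x
      simp only [pairField]
      push_cast; ring
    all_goals
      refine Integrable.const_mul (Integrable.bdd_mul (c := 1)
        (integrable_two_mul_lineKernel _).ofReal
        (Continuous.aestronglyMeasurable (by fun_prop)) (Eventually.of_forall fun x => ?_)) _
      rw [Complex.norm_exp]; simp

/-! ### The circle -/

/-- The derivative of `2 * circleKernel`. -/
def circleSlope (x : ℝ) : ℝ :=
  Real.sinh (x - 2 * Real.pi * ⌈x / (2 * Real.pi)⌉ + Real.pi) / Real.sinh Real.pi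

/-- Smooth `2π`-periodic functions. -/
def IsCircleAdm (h : ℝ → ℝ) : Prop := ContDiff ℝ ∞ h ∧ Function.Periodic h (2 * Real.pi)

/-! ### Kernel and slope on the circle -/

theorem sinh_pi_pos : 0 < Real.sinh Real.pi := Real.sinh_pos_iff.2 Real.pi_pos

theorem periodic_circleKernel : Function.Periodic circleKernel (2 * Real.pi) := fun x => by
  have : (x + 2 * Real.pi) / (2 * Real.pi) = x / (2 * Real.pi) + 1 := by
    field_simp [Real.pi_ne_zero]
  rw [circleKernel, circleKernel, this, Int.floor_add_one]
  push_cast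
  congr 2; ring

theorem periodic_circleSlope : Function.Periodic circleSlope (2 * Real.pi) := fun x => by
  have : (x + 2 * Real.pi) / (2 * Real.pi) = x / (2 * Real.pi) + 1 := by
    field_simp [Real.pi_ne_zero]
  rw [circleSlope, circleSlope, this, Int.ceil_add_one]
  push_cast
  congr 2; ring

theorem two_mul_circleKernel_of_mem {x : ℝ} (hx : x ∈ Icc 0 (2 * Real.pi)) :
    2 * circleKernel x = Real.cosh (x - Real.pi) / Real.sinh Real.pi := by
  have hpi := Real.pi_pos
  have hs := sinh_pi_pos.ne'
  rcases eq_or_lt_of_le hx.2 with h | h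
  · rw [h, circleKernel, div_self (by positivity), Int.floor_one,
      show 2 * Real.pi - 2 * Real.pi * ((1 : ℤ) : ℝ) - Real.pi = -Real.pi by push_cast; ring,
      Real.cosh_neg, show 2 * Real.pi - Real.pi = Real.pi by ring]
    field_simp
  · have : ⌊x / (2 * Real.pi)⌋ = 0 := by
      rw [Int.floor_eq_zero_iff]
      exact ⟨div_nonneg hx.1 (by positivity), (div_lt_one (by positivity)).2 h⟩
    rw [circleKernel, this, Int.cast_zero, mul_zero, sub_zero]
    field_simp

theorem two_mul_circleKernel_of_mem' {x : ℝ} (hx : x ∈ Icc (-(2 * Real.pi)) 0) :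
    2 * circleKernel x = Real.cosh (x + Real.pi) / Real.sinh Real.pi := by
  rw [← periodic_circleKernel x, two_mul_circleKernel_of_mem
    ⟨by linarith [hx.1], by linarith [hx.2]⟩]
  ring_nf

/-- The ceiling in `circleSlope` gives the left limit at a crest, so the formula holds on intervals
closed on the right, which are the ones integrated over. -/
theorem circleSlope_of_mem {x : ℝ} (hx : x ∈ Ioc 0 (2 * Real.pi)) :
    circleSlope x = Real.sinh (x - Real.pi) / Real.sinh Real.pi := by
  have hpi := Real.pi_pos
  have : ⌈x / (2 * Real.pi)⌉ = 1 := by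
    rw [Int.ceil_eq_iff]
    push_cast
    exact ⟨by rw [sub_self]; exact div_pos hx.1 (by positivity),
      (div_le_one (by positivity)).2 hx.2⟩
  rw [circleSlope, this]
  push_cast
  ring_nf

theorem circleSlope_of_mem' {x : ℝ} (hx : x ∈ Ioc (-(2 * Real.pi)) 0) :
    circleSlope x = Real.sinh (x + Real.pi) / Real.sinh Real.pi := by
  rw [← periodic_circleSlope x, circleSlope_of_mem ⟨by linarith [hx.1], by linarith [hx.2]⟩]
  ring_nf

theorem circleKernel_neg (x : ℝ) : circleKernel (-x) = circleKernel x := by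
  have hper : Function.Periodic (fun x => circleKernel (-x) - circleKernel x) (2 * Real.pi) :=
    fun x => by
      simp only
      rw [periodic_circleKernel, neg_add, ← sub_eq_add_neg, periodic_circleKernel.sub_eq]
  obtain ⟨y, hy, hxy⟩ := hper.exists_mem_Ico₀ (by positivity) x
  have h3 := two_mul_circleKernel_of_mem ⟨hy.1, hy.2.le⟩
  have h4 := two_mul_circleKernel_of_mem' (x := -y) ⟨by linarith [hy.2], by linarith [hy.1]⟩
  rw [← Real.cosh_neg, show -(-y + Real.pi) = y - Real.pi by ring] at h4
  linarith

theorem measurable_circleKernel : Measurable circleKernel := by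
  unfold circleKernel
  have : Measurable fun x : ℝ => ((⌊x / (2 * Real.pi)⌋ : ℤ) : ℝ) :=
    (measurable_from_top (f := fun n : ℤ => (n : ℝ))).comp
      (Int.measurable_floor.comp (measurable_id.div_const _))
  fun_prop

theorem measurable_circleSlope : Measurable circleSlope := by
  unfold circleSlope
  have : Measurable fun x : ℝ => ((⌈x / (2 * Real.pi)⌉ : ℤ) : ℝ) :=
    (measurable_from_top (f := fun n : ℤ => (n : ℝ))).comp
      (Int.measurable_ceil.comp (measurable_id.div_const _))
  fun_prop

theorem one_le_coth_pi : 1 ≤ Real.cosh Real.pi / Real.sinh Real.pi :=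
  (one_le_div sinh_pi_pos).2 (Real.sinh_lt_cosh _).le

theorem abs_hyperbolic_le {x : ℝ} (hx : |x| ≤ Real.pi) :
    |Real.cosh x / Real.sinh Real.pi| ≤ Real.cosh Real.pi / Real.sinh Real.pi ∧
    |Real.sinh x / Real.sinh Real.pi| ≤ Real.cosh Real.pi / Real.sinh Real.pi := by
  have h1 : Real.cosh x ≤ Real.cosh Real.pi :=
    Real.cosh_le_cosh.2 (by rwa [abs_of_pos Real.pi_pos])
  rw [abs_div, abs_div, abs_of_pos sinh_pi_pos, abs_of_pos (Real.cosh_pos x)]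
  refine ⟨by gcongr, ?_⟩
  have h2 : |Real.sinh x| ≤ Real.cosh x := by
    rw [abs_le]
    constructor
    · have := Real.sinh_lt_cosh (-x)
      rw [Real.sinh_neg, Real.cosh_neg] at this
      linarith
    · exact (Real.sinh_lt_cosh x).le
  gcongr
  exact h2.trans h1

theorem abs_circle_le (x : ℝ) :
    |2 * circleKernel x| ≤ Real.cosh Real.pi / Real.sinh Real.pi ∧
    |circleSlope x| ≤ Real.cosh Real.pi / Real.sinh Real.pi := by
  have hpi := Real.pi_pos
  constructor
  · obtain ⟨y, hy, hxy⟩ := periodic_circleKernel.exists_mem_Ico₀ (by positivity) x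
    rw [hxy, two_mul_circleKernel_of_mem ⟨hy.1, hy.2.le⟩]
    exact (abs_hyperbolic_le (abs_le.2 ⟨by linarith [hy.1], by linarith [hy.2]⟩)).1
  · obtain ⟨y, hy, hxy⟩ := periodic_circleSlope.exists_mem_Ioc (by positivity) x 0
    rw [zero_add] at hy
    rw [hxy, circleSlope_of_mem hy]
    exact (abs_hyperbolic_le (abs_le.2 ⟨by linarith [hy.1], by linarith [hy.2]⟩)).2

theorem setLIntegral_Ioc_eq_of_periodic {f : ℝ → ℝ≥0∞} (hf : Function.Periodic f (2 * Real.pi))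
    (a : ℝ) : ∫⁻ x in Ioc 0 (2 * Real.pi), f x = ∫⁻ x in Ioc a (a + 2 * Real.pi), f x := by
  have h0 := isAddFundamentalDomain_Ioc (T := 2 * Real.pi) (by positivity) 0
  have h1 := isAddFundamentalDomain_Ioc (T := 2 * Real.pi) (by positivity) a
  rw [zero_add] at h0
  refine h0.setLIntegral_eq h1 f fun g x => ?_
  obtain ⟨g, n, rfl⟩ := g
  have := hf.int_mul n x
  rw [← this]
  congr 1
  simp [AddSubgroup.vadd_def, add_comm]

theorem setIntegral_Ioc_eq_of_periodic {f : ℝ → ℝ} (hf : Function.Periodic f (2 * Real.pi))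
    (a : ℝ) : ∫ x in Ioc 0 (2 * Real.pi), f x = ∫ x in a..(a + 2 * Real.pi), f x := by
  rw [← intervalIntegral.integral_of_le (by positivity), ← hf.intervalIntegral_add_eq 0 a, zero_add]

/-- The period is shifted to start at $q$. On $(q,r]$ the arguments lie on different sides of the
crest and the difference is at most $2c$; on the rest both lie in one period, where $k$ is
Lipschitz. -/
theorem lintegral_periodic_sub_le {k : ℝ → ℝ} {c : ℝ} (hk : Function.Periodic k (2 * Real.pi))
    (hc : ∀ x, |k x| ≤ c)
    (hL : ∀ x ∈ Ioc 0 (2 * Real.pi), ∀ y ∈ Ioc 0 (2 * Real.pi), |k x - k y| ≤ c * |x - y|)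
    {q r : ℝ} (h1 : q < r) (h2 : r < q + 1) :
    ∫⁻ x in Ioc 0 (2 * Real.pi), ‖k (x - r) - k (x - q)‖ₑ
      ≤ ENNReal.ofReal (c * (2 * Real.pi + 2) * (r - q)) := by
  have hpi := Real.pi_gt_three
  have hc0 : 0 ≤ c := (abs_nonneg _).trans (hc 0)
  have hrq : 0 < r - q := sub_pos.2 h1
  rw [setLIntegral_Ioc_eq_of_periodic (fun x => by
      rw [show x + 2 * Real.pi - r = x - r + 2 * Real.pi by ring,
        show x + 2 * Real.pi - q = x - q + 2 * Real.pi by ring, hk, hk]) q,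
    ← Ioc_union_Ioc_eq_Ioc h1.le (by linarith : r ≤ q + 2 * Real.pi)]
  have b1 : ∫⁻ x in Ioc q r, ‖k (x - r) - k (x - q)‖ₑ ≤ ENNReal.ofReal (2 * c * (r - q)) := by
    calc ∫⁻ x in Ioc q r, ‖k (x - r) - k (x - q)‖ₑ ≤ ∫⁻ x in Ioc q r, ENNReal.ofReal (2 * c) := by
          refine lintegral_mono fun x => ?_
          rw [← ofReal_norm]
          refine ENNReal.ofReal_le_ofReal ((norm_sub_le _ _).trans ?_)
          linarith [hc (x - r), hc (x - q), Real.norm_eq_abs (k (x - r)),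
            Real.norm_eq_abs (k (x - q))]
      _ = _ := by
          rw [setLIntegral_const, Real.volume_Ioc, ← ENNReal.ofReal_mul (by positivity)]
  have b2 : ∫⁻ x in Ioc r (q + 2 * Real.pi), ‖k (x - r) - k (x - q)‖ₑ
      ≤ ENNReal.ofReal (c * (r - q) * (2 * Real.pi)) := by
    calc ∫⁻ x in Ioc r (q + 2 * Real.pi), ‖k (x - r) - k (x - q)‖ₑ
        ≤ ∫⁻ x in Ioc r (q + 2 * Real.pi), ENNReal.ofReal (c * (r - q)) := by
          refine setLIntegral_mono measurable_const fun x hx => ?_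
          rw [← ofReal_norm]
          refine ENNReal.ofReal_le_ofReal ((hL _ ⟨by linarith [hx.1], by linarith [hx.2]⟩ _
            ⟨by linarith [hx.1], by linarith [hx.2]⟩).trans (le_of_eq ?_))
          rw [show x - r - (x - q) = -(r - q) by ring, abs_neg, abs_of_pos hrq]
      _ ≤ _ := by
          rw [setLIntegral_const, Real.volume_Ioc, ← ENNReal.ofReal_mul (by positivity)]
          refine ENNReal.ofReal_le_ofReal ?_
          gcongr
          linarith
  refine (lintegral_union_le _ _ _).trans ((add_le_add b1 b2).trans ?_)
  rw [← ENNReal.ofReal_add (by positivity) (by positivity)]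
  exact ENNReal.ofReal_le_ofReal (by linarith)

theorem abs_hyperbolic_sub_le {x y : ℝ} (hx : |x| ≤ Real.pi) (hy : |y| ≤ Real.pi) :
    |Real.cosh x / Real.sinh Real.pi - Real.cosh y / Real.sinh Real.pi|
      ≤ Real.cosh Real.pi / Real.sinh Real.pi * |x - y| ∧
    |Real.sinh x / Real.sinh Real.pi - Real.sinh y / Real.sinh Real.pi|
      ≤ Real.cosh Real.pi / Real.sinh Real.pi * |x - y| := by
  have hx' : x ∈ Icc (-Real.pi) Real.pi := abs_le.1 hx
  have hy' : y ∈ Icc (-Real.pi) Real.pi := abs_le.1 hy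
  constructor
  · exact (convex_Icc (-Real.pi) Real.pi).norm_image_sub_le_of_norm_hasDerivWithin_le
      (f := fun x => Real.cosh x / Real.sinh Real.pi)
      (fun z _ => ((Real.hasDerivAt_cosh z).div_const _).hasDerivWithinAt)
      (fun z hz => (abs_hyperbolic_le (abs_le.2 hz)).2) hy' hx'
  · exact (convex_Icc (-Real.pi) Real.pi).norm_image_sub_le_of_norm_hasDerivWithin_le
      (f := fun x => Real.sinh x / Real.sinh Real.pi)
      (fun z _ => ((Real.hasDerivAt_sinh z).div_const _).hasDerivWithinAt)
      (fun z hz => (abs_hyperbolic_le (abs_le.2 hz)).1) hy' hx'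

/-- Explicit formulas for the Bessel potential on the circle and its derivative. -/
theorem IsCircleAdm.invD2_eq {h : ℝ → ℝ} (hh : IsCircleAdm h) (x : ℝ) :
    invD2 (Ioc 0 (2 * Real.pi)) circleKernel h x = 1 / (2 * Real.sinh Real.pi) *
      (Real.cosh (x - Real.pi) * (∫ y in (x - 2 * Real.pi)..x, Real.cosh y * h y)
        - Real.sinh (x - Real.pi) * ∫ y in (x - 2 * Real.pi)..x, Real.sinh y * h y) := by
  have hc := hh.1.continuous
  have hs := sinh_pi_pos.ne'
  rw [invD2, setIntegral_Ioc_eq_of_periodic (fun y => by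
      rw [hh.2, show x - (y + 2 * Real.pi) = x - y - 2 * Real.pi by ring,
        periodic_circleKernel.sub_eq]) (x - 2 * Real.pi), sub_add_cancel,
    ← intervalIntegral.integral_const_mul, ← intervalIntegral.integral_const_mul,
    ← intervalIntegral.integral_sub (Continuous.intervalIntegrable (by fun_prop) _ _)
      (Continuous.intervalIntegrable (by fun_prop) _ _), ← intervalIntegral.integral_const_mul]
  refine intervalIntegral.integral_congr fun y hy => ?_
  rw [uIcc_of_le (by linarith [Real.pi_pos])] at hy
  have h1 := two_mul_circleKernel_of_mem (x := x - y) ⟨by linarith [hy.2], by linarith [hy.1]⟩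
  rw [show x - y - Real.pi = x - Real.pi - y by ring, Real.cosh_sub] at h1
  have h2 : circleKernel (x - y) = 1 / 2 * (2 * circleKernel (x - y)) := by ring
  rw [h2, h1]
  field_simp

theorem IsCircleAdm.deriv {h : ℝ → ℝ} (hh : IsCircleAdm h) : IsCircleAdm (deriv h) := by
  refine ⟨hh.1.deriv', fun x => ?_⟩
  rw [← deriv_comp_add_const, show (fun x => h (x + 2 * Real.pi)) = h from funext hh.2]

/-- These are the contributions of the moving endpoints when the potential is differentiated. The
first expresses continuity of the kernel across its crest; the second is the jump of its slope,
which produces the source in $\psi''=\psi-h$. -/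
theorem cosh_sinh_shift (x : ℝ) :
    Real.cosh (x - Real.pi) * (Real.cosh x - Real.cosh (x - 2 * Real.pi))
      - Real.sinh (x - Real.pi) * (Real.sinh x - Real.sinh (x - 2 * Real.pi)) = 0 ∧
    Real.sinh (x - Real.pi) * (Real.cosh x - Real.cosh (x - 2 * Real.pi))
      - Real.cosh (x - Real.pi) * (Real.sinh x - Real.sinh (x - 2 * Real.pi))
      = -(2 * Real.sinh Real.pi) := by
  obtain ⟨y, rfl⟩ : ∃ y, x = y + Real.pi := ⟨x - Real.pi, by ring⟩
  rw [show y + Real.pi - 2 * Real.pi = y - Real.pi by ring, add_sub_cancel_right, Real.cosh_add,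
    Real.sinh_add, Real.cosh_sub, Real.sinh_sub]
  have := Real.cosh_sq y
  constructor
  · ring
  · linear_combination -(2 * Real.sinh Real.pi) * this

theorem IsCircleAdm.invD2_deriv_eq {h : ℝ → ℝ} (hh : IsCircleAdm h) (x : ℝ) :
    invD2 (Ioc 0 (2 * Real.pi)) circleKernel (_root_.deriv h) x = 1 / (2 * Real.sinh Real.pi) *
      (Real.sinh (x - Real.pi) * (∫ y in (x - 2 * Real.pi)..x, Real.cosh y * h y)
        - Real.cosh (x - Real.pi) * ∫ y in (x - 2 * Real.pi)..x, Real.sinh y * h y) := by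
  have hd : ∀ x, HasDerivAt h (_root_.deriv h x) x := fun x =>
    (hh.1.differentiable (by simp)).differentiableAt.hasDerivAt
  have hc' := hh.deriv.1.continuous
  rw [hh.deriv.invD2_eq, intervalIntegral.integral_mul_deriv_eq_deriv_mul
      (fun y _ => Real.hasDerivAt_cosh y) (fun y _ => hd y)
      (Real.continuous_sinh.intervalIntegrable _ _) (hc'.intervalIntegrable _ _),
    intervalIntegral.integral_mul_deriv_eq_deriv_mul
      (fun y _ => Real.hasDerivAt_sinh y) (fun y _ => hd y)
      (Real.continuous_cosh.intervalIntegrable _ _) (hc'.intervalIntegrable _ _),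
    hh.2.sub_eq]
  linear_combination 1 / (2 * Real.sinh Real.pi) * h x * (cosh_sinh_shift x).1

theorem IsCircleAdm.hasDerivAt_invD2 {h : ℝ → ℝ} (hh : IsCircleAdm h) (x : ℝ) :
    HasDerivAt (invD2 (Ioc 0 (2 * Real.pi)) circleKernel h)
      (invD2 (Ioc 0 (2 * Real.pi)) circleKernel (_root_.deriv h) x) x ∧
    HasDerivAt (invD2 (Ioc 0 (2 * Real.pi)) circleKernel (_root_.deriv h))
      (invD2 (Ioc 0 (2 * Real.pi)) circleKernel h x - h x) x := by
  have hc := hh.1.continuous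
  have hs := sinh_pi_pos.ne'
  have hint : ∀ w : ℝ → ℝ, Continuous w → HasDerivAt
      (fun x => ∫ y in (x - 2 * Real.pi)..x, w y * h y)
      ((w x - w (x - 2 * Real.pi)) * h x) x := by
    intro w hw
    have hwh : Continuous fun y => w y * h y := by fun_prop
    have e : (fun x => ∫ y in (x - 2 * Real.pi)..x, w y * h y) = fun x =>
        (∫ y in (0)..x, w y * h y) - ∫ y in (0)..(x - 2 * Real.pi), w y * h y := funext fun x => by
      rw [intervalIntegral.integral_interval_sub_left] <;> exact hwh.intervalIntegrable _ _
    have d := fun z => (hwh.integral_hasStrictDerivAt 0 z).hasDerivAt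
    rw [e]
    refine ((d x).sub ((d (x - 2 * Real.pi)).comp x
      ((hasDerivAt_id x).sub_const (2 * Real.pi)))).congr_deriv ?_
    rw [hh.2.sub_eq]; ring
  have dC := hint Real.cosh Real.continuous_cosh
  have dS := hint Real.sinh Real.continuous_sinh
  have dc : HasDerivAt (fun x => Real.cosh (x - Real.pi)) (Real.sinh (x - Real.pi)) x :=
    ((hasDerivAt_id x).sub_const Real.pi).cosh.congr_deriv (by simp)
  have ds : HasDerivAt (fun x => Real.sinh (x - Real.pi)) (Real.cosh (x - Real.pi)) x :=
    ((hasDerivAt_id x).sub_const Real.pi).sinh.congr_deriv (by simp)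
  obtain ⟨s1, s2⟩ := cosh_sinh_shift x
  rw [funext hh.invD2_eq, funext hh.invD2_deriv_eq]
  constructor
  · refine (((dc.mul dC).sub (ds.mul dS)).const_mul _).congr_deriv ?_
    linear_combination 1 / (2 * Real.sinh Real.pi) * h x * s1
  · refine (((ds.mul dC).sub (dc.mul dS)).const_mul _).congr_deriv ?_
    have e : 1 / (2 * Real.sinh Real.pi) * (2 * Real.sinh Real.pi) = 1 := by field_simp
    linear_combination 1 / (2 * Real.sinh Real.pi) * h x * s2 - h x * e

/-! ### Exact integration of the tested equation over a period -/

theorem IsCircleAdm.periodic_invD2 {h : ℝ → ℝ} :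
    Function.Periodic (invD2 (Ioc 0 (2 * Real.pi)) circleKernel h) (2 * Real.pi) := fun x => by
  simp only [invD2]
  congr 1; ext y
  rw [show x + 2 * Real.pi - y = x - y + 2 * Real.pi by ring, periodic_circleKernel]

theorem periodic_pairField {k : ℝ → ℝ} {L : ℝ} (hk : Function.Periodic k L) (p₁ p₂ q₁ q₂ : ℝ) :
    Function.Periodic (pairField k p₁ p₂ q₁ q₂) L := fun x => by
  rw [pairField, pairField, show x + L - q₁ = x - q₁ + L by ring,
    show x + L - q₂ = x - q₂ + L by ring, hk, hk]

theorem periodic_two_mul_circleKernel :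
    Function.Periodic (fun x => 2 * circleKernel x) (2 * Real.pi) := fun x => by
  simp only [periodic_circleKernel x]

theorem hasDerivAt_hyperbolic (S a x : ℝ) :
    HasDerivAt (fun x => Real.cosh (x - a) / S) (Real.sinh (x - a) / S) x ∧
    HasDerivAt (fun x => Real.sinh (x - a) / S) (Real.cosh (x - a) / S) x :=
  ⟨(((hasDerivAt_id x).sub_const a).cosh.congr_deriv (by simp)).div_const S,
    (((hasDerivAt_id x).sub_const a).sinh.congr_deriv (by simp)).div_const S⟩

theorem crestProfile_coth_pi (r : ℝ) :
    crestProfile (Real.cosh Real.pi / Real.sinh Real.pi) r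
      = Real.cosh (Real.pi - r) / Real.sinh Real.pi := by
  have hs := sinh_pi_pos.ne'
  rw [crestProfile, Real.cosh_sub]
  field_simp

theorem slopeProfile_coth_pi (r : ℝ) :
    slopeProfile (Real.cosh Real.pi / Real.sinh Real.pi) r
      = Real.sinh (Real.pi - r) / Real.sinh Real.pi := by
  have hs := sinh_pi_pos.ne'
  rw [slopeProfile, Real.sinh_sub]
  field_simp

/-- The integral of the tested equation over an interval on which the field is a combination of
hyperbolic functions. -/
theorem integral_cubicForm_hyperbolic {u v h ψ ψ' : ℝ → ℝ} (hh : Continuous h)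
    (hψ : ∀ x, HasDerivAt ψ (ψ' x) x ∧ HasDerivAt ψ' (ψ x - h x) x) {a b S p₁ p₂ y₁ y₂ : ℝ}
    (hab : a ≤ b)
    (hu : ∀ x ∈ Ioc a b, u x = p₁ * (Real.cosh (x - y₁) / S) + p₂ * (Real.cosh (x - y₂) / S))
    (hv : ∀ x ∈ Ioc a b, v x = p₁ * (Real.sinh (x - y₁) / S) + p₂ * (Real.sinh (x - y₂) / S)) :
    IntervalIntegrable (fun x => cubicForm (u x) (v x) (h x) (ψ x) (ψ' x)) volume a b ∧
    ∫ x in a..b, cubicForm (u x) (v x) (h x) (ψ x) (ψ' x)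
      = boundaryTerm (p₁ * (Real.cosh (b - y₁) / S) + p₂ * (Real.cosh (b - y₂) / S))
          (p₁ * (Real.sinh (b - y₁) / S) + p₂ * (Real.sinh (b - y₂) / S)) (ψ b) (ψ' b)
        - boundaryTerm (p₁ * (Real.cosh (a - y₁) / S) + p₂ * (Real.cosh (a - y₂) / S))
          (p₁ * (Real.sinh (a - y₁) / S) + p₂ * (Real.sinh (a - y₂) / S)) (ψ a) (ψ' a) := by
  have c1 : Continuous ψ := continuous_iff_continuousAt.2 fun x => (hψ x).1.continuousAt
  have c2 : Continuous ψ' := continuous_iff_continuousAt.2 fun x => (hψ x).2.continuousAt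
  set w : ℝ → ℝ := fun x => p₁ * (Real.cosh (x - y₁) / S) + p₂ * (Real.cosh (x - y₂) / S) with hw
  set w' : ℝ → ℝ := fun x => p₁ * (Real.sinh (x - y₁) / S) + p₂ * (Real.sinh (x - y₂) / S)
    with hw'
  have hwd : ∀ x, HasDerivAt w (w' x) x ∧ HasDerivAt w' (w x) x := fun x => by
    obtain ⟨d1, d2⟩ := hasDerivAt_hyperbolic S y₁ x
    obtain ⟨d3, d4⟩ := hasDerivAt_hyperbolic S y₂ x
    exact ⟨(d1.const_mul p₁).add (d3.const_mul p₂), (d2.const_mul p₁).add (d4.const_mul p₂)⟩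
  have e : EqOn (fun x => cubicForm (w x) (w' x) (h x) (ψ x) (ψ' x))
      (fun x => cubicForm (u x) (v x) (h x) (ψ x) (ψ' x)) (Ioc a b) := fun x hx => by
    simp only [hu x hx, hv x hx, hw, hw']
  have hcont : Continuous fun x => cubicForm (w x) (w' x) (h x) (ψ x) (ψ' x) := by
    simp only [cubicForm, hw, hw']; fun_prop
  constructor
  · rw [intervalIntegrable_iff_integrableOn_Ioc_of_le hab]
    exact ((hcont.integrableOn_Icc).mono_set Ioc_subset_Icc_self).congr_fun e measurableSet_Ioc
  · rw [← integral_cubicForm_interval hh hwd hψ, intervalIntegral.integral_of_le hab,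
      intervalIntegral.integral_of_le hab, setIntegral_congr_fun measurableSet_Ioc e]

/-- The period from $q_1$ to $q_1+2\pi$ is cut at $q_2$, and the integral is exact on both pieces.
By periodicity the boundary value at $q_1+2\pi$ is the left limit at $q_1$, so the jumps combine as
on the line. -/
theorem IsCircleAdm.integral_cubicForm {h : ℝ → ℝ} (hh : IsCircleAdm h) (p₁ p₂ : ℝ) {q₁ q₂ : ℝ}
    (hq : q₁ < q₂) (hq' : q₂ < q₁ + 1) {X : Set ℝ} (hX : X = Ioc 0 (2 * Real.pi)) {c : ℝ}
    (hc : c = Real.cosh Real.pi / Real.sinh Real.pi) :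
    ∫ x in X, cubicForm (pairField (fun x => 2 * circleKernel x) p₁ p₂ q₁ q₂ x)
        (pairField circleSlope p₁ p₂ q₁ q₂ x) (h x) (invD2 X circleKernel h x)
        (invD2 X circleKernel (_root_.deriv h) x)
    = 2 * p₁ * ((c * p₁ + crestProfile c (q₂ - q₁) * p₂) *
          (p₂ * slopeProfile c (q₂ - q₁)) * invD2 X circleKernel h q₁
        - (c * p₁ + crestProfile c (q₂ - q₁) * p₂) ^ 2 *
          invD2 X circleKernel (_root_.deriv h) q₁)
      + 2 * p₂ * (-(crestProfile c (q₂ - q₁) * p₁ + c * p₂) *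
          (p₁ * slopeProfile c (q₂ - q₁)) * invD2 X circleKernel h q₂
        - (crestProfile c (q₂ - q₁) * p₁ + c * p₂) ^ 2
          * invD2 X circleKernel (_root_.deriv h) q₂) := by
  subst hX
  have hpi := Real.pi_gt_three
  have hs := sinh_pi_pos.ne'
  have hper1 := IsCircleAdm.periodic_invD2 (h := h)
  have hper2 := IsCircleAdm.periodic_invD2 (h := _root_.deriv h)
  have hψ := hh.hasDerivAt_invD2
  set ψ := invD2 (Ioc 0 (2 * Real.pi)) circleKernel h with hψdef
  set ψ' := invD2 (Ioc 0 (2 * Real.pi)) circleKernel (_root_.deriv h) with hψ'def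
  have hu := periodic_pairField periodic_two_mul_circleKernel p₁ p₂ q₁ q₂
  have hv := periodic_pairField periodic_circleSlope p₁ p₂ q₁ q₂
  -- Between the crests $x-q_1$ is positive and $x-q_2$ is not, so the two hyperbolic cosines are
  -- centred at $q_1+\pi$ and $q_2-\pi$.
  obtain ⟨m1, m2⟩ := integral_cubicForm_hyperbolic (p₁ := p₁) (p₂ := p₂) (y₁ := q₁ + Real.pi)
    (y₂ := q₂ - Real.pi) (S := Real.sinh Real.pi) hh.1.continuous hψ hq.le
    (u := pairField (fun x => 2 * circleKernel x) p₁ p₂ q₁ q₂)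
    (v := pairField circleSlope p₁ p₂ q₁ q₂)
    (fun x hx => by
      rw [pairField, two_mul_circleKernel_of_mem ⟨by linarith [hx.1], by linarith [hx.2]⟩,
        two_mul_circleKernel_of_mem' ⟨by linarith [hx.1], by linarith [hx.2]⟩]
      ring_nf)
    (fun x hx => by
      rw [pairField, circleSlope_of_mem ⟨by linarith [hx.1], by linarith [hx.2]⟩,
        circleSlope_of_mem' ⟨by linarith [hx.1], by linarith [hx.2]⟩]
      ring_nf)
  obtain ⟨r1, r2⟩ := integral_cubicForm_hyperbolic (p₁ := p₁) (p₂ := p₂) (y₁ := q₁ + Real.pi)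
    (y₂ := q₂ + Real.pi) (S := Real.sinh Real.pi) hh.1.continuous hψ
    (by linarith : q₂ ≤ q₁ + 2 * Real.pi)
    (u := pairField (fun x => 2 * circleKernel x) p₁ p₂ q₁ q₂)
    (v := pairField circleSlope p₁ p₂ q₁ q₂)
    (fun x hx => by
      rw [pairField, two_mul_circleKernel_of_mem ⟨by linarith [hx.1], by linarith [hx.2]⟩,
        two_mul_circleKernel_of_mem ⟨by linarith [hx.1], by linarith [hx.2]⟩]
      ring_nf)
    (fun x hx => by
      rw [pairField, circleSlope_of_mem ⟨by linarith [hx.1], by linarith [hx.2]⟩,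
        circleSlope_of_mem ⟨by linarith [hx.1], by linarith [hx.2]⟩]
      ring_nf)
  rw [setIntegral_Ioc_eq_of_periodic (fun x => by rw [hu, hv, hh.2, hper1, hper2]) q₁,
    ← intervalIntegral.integral_add_adjacent_intervals m1 r1, m2, r2, hper1, hper2, hc,
    crestProfile_coth_pi, slopeProfile_coth_pi, ← boundaryTerm_jumps]
  have a1 : q₂ - (q₁ + Real.pi) = -(Real.pi - (q₂ - q₁)) := by ring
  have a2 : q₂ - (q₂ - Real.pi) = Real.pi := by ring
  have a3 : q₁ - (q₁ + Real.pi) = -Real.pi := by ring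
  have a4 : q₁ - (q₂ - Real.pi) = Real.pi - (q₂ - q₁) := by ring
  have a5 : q₁ + 2 * Real.pi - (q₁ + Real.pi) = Real.pi := by ring
  have a6 : q₁ + 2 * Real.pi - (q₂ + Real.pi) = Real.pi - (q₂ - q₁) := by ring
  have a7 : q₂ - (q₂ + Real.pi) = -Real.pi := by ring
  have a8 : Real.sinh Real.pi / Real.sinh Real.pi = 1 := div_self hs
  simp only [boundaryTerm, a1, a2, a3, a4, a5, a6, a7, Real.cosh_neg, Real.sinh_neg, neg_div, a8]
  ring

/-! ### The circle as a peakon geometry -/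

theorem exists_bound_of_periodic {E : Type*} [NormedAddCommGroup E] {F : ℝ × ℝ → E}
    (hF : Continuous F) {L a b : ℝ} (hL : 0 < L) (hper : ∀ t, Function.Periodic (fun x => F (t, x)) L)
    (hsupp : ∀ t ∉ Icc a b, ∀ x, F (t, x) = 0) : ∃ B, ∀ z, ‖F z‖ ≤ B := by
  obtain ⟨B, hB⟩ := (isCompact_Icc.prod isCompact_Icc : IsCompact (Icc a b ×ˢ Icc 0 L)
    ).exists_bound_of_continuousOn hF.continuousOn
  refine ⟨max B 0, fun z => ?_⟩
  by_cases ht : z.1 ∈ Icc a b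
  · obtain ⟨y, hy, hxy⟩ := (hper z.1).exists_mem_Ico₀ hL z.2
    have := hB (z.1, y) ⟨ht, hy.1, hy.2.le⟩
    rw [← hxy] at this
    exact this.trans (le_max_left _ _)
  · have := hsupp z.1 ht z.2
    rw [show F z = 0 from this, norm_zero]
    exact le_max_right _ _

theorem IsCircleTest.peakon_properties {T : ℝ} {φ : ℝ → ℝ → ℝ} (hφ : IsCircleTest T φ) :
    (∃ B : ℝ, ∀ z, |φ z.1 z.2| ≤ B ∧ ‖fderiv ℝ (fun z : ℝ × ℝ => φ z.1 z.2) z‖ ≤ B) ∧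
    ∀ t, IsCircleAdm (φ t) ∧ IsCircleAdm (deriv (φ t)) ∧
      IsCircleAdm (fun x => deriv (fun τ => φ τ x) t) := by
  obtain ⟨hs, hper, a, b, ha, hb, hR⟩ := hφ
  have h0 : ∀ t ∉ Icc a b, ∀ x, φ t x = 0 := fun t ht x => by
    by_contra hne; exact ht (hR t x hne)
  constructor
  · obtain ⟨B₁, hB₁⟩ := exists_bound_of_periodic hs.continuous (by positivity) hper h0
    obtain ⟨B₂, hB₂⟩ := exists_bound_of_periodic (a := a) (b := b) (L := 2 * Real.pi)
      (hs.continuous_fderiv (by simp)) (by positivity)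
      (fun t x => by
        have h1 : (fun z : ℝ × ℝ => φ (z + (0, 2 * Real.pi)).1 (z + (0, 2 * Real.pi)).2)
            = fun z : ℝ × ℝ => φ z.1 z.2 := funext fun z => by
          simp only [Prod.fst_add, Prod.snd_add, add_zero, hper z.1 z.2]
        have h2 := fderiv_comp_add_right (𝕜 := ℝ) (f := fun z : ℝ × ℝ => φ z.1 z.2) (x := (t, x))
          (0, 2 * Real.pi)
        rw [h1] at h2
        simpa using h2.symm)
      (fun t ht x => by
        have hev : (fun z : ℝ × ℝ => φ z.1 z.2) =ᶠ[𝓝 (t, x)] fun _ => 0 := by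
          filter_upwards [continuous_fst.continuousAt.preimage_mem_nhds
            (isClosed_Icc.isOpen_compl.mem_nhds ht)] with z hz using h0 z.1 hz _
        rw [hev.fderiv_eq]; simp)
    exact ⟨max B₁ B₂, fun z => ⟨(hB₁ z).trans (le_max_left _ _), (hB₂ z).trans (le_max_right _ _)⟩⟩
  · intro t
    have h1 : IsCircleAdm (φ t) := ⟨hs.comp (contDiff_const.prodMk contDiff_id), hper t⟩
    refine ⟨h1, h1.deriv, ?_, fun x => ?_⟩
    · have h2 : (fun x => deriv (fun τ => φ τ x) t)
          = fun x => fderiv ℝ (fun z : ℝ × ℝ => φ z.1 z.2) (t, x) (1, 0) :=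
        funext fun x => (hasDerivAt_fst hs t x).deriv
      rw [h2]
      exact ((hs.fderiv_right (m := ∞) (by simp)).comp
        (contDiff_const.prodMk contDiff_id)).clm_apply contDiff_const
    · simp only [hper _ x]

theorem circle_peakonGeometry :
    PeakonGeometry (Ioc 0 (2 * Real.pi)) circleKernel circleSlope IsCircleTest IsCircleAdm
      (Real.cosh Real.pi / Real.sinh Real.pi) := by
  have hpi := Real.pi_pos
  set c := Real.cosh Real.pi / Real.sinh Real.pi with hc
  have hc0 : 0 ≤ c := zero_le_one.trans one_le_coth_pi
  have hconst : ∀ f : ℝ → ℝ, (∀ x, |f x| ≤ c) →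
      ∫⁻ x in Ioc 0 (2 * Real.pi), ‖f x‖ₑ ≤ ENNReal.ofReal (c * (2 * Real.pi)) := fun f hf => by
    calc ∫⁻ x in Ioc 0 (2 * Real.pi), ‖f x‖ₑ
        ≤ ∫⁻ x in Ioc 0 (2 * Real.pi), ENNReal.ofReal c := lintegral_mono fun x => by
          rw [← ofReal_norm]; exact ENNReal.ofReal_le_ofReal (hf x)
      _ = _ := by rw [setLIntegral_const, Real.volume_Ioc, ← ENNReal.ofReal_mul hc0, sub_zero]
  refine
    { measurable_G := measurable_circleKernel
      measurable_dg := measurable_circleSlope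
      bdd := ⟨c, abs_circle_le⟩
      lintegral_le := ⟨c * (2 * Real.pi), by positivity, fun q =>
        ⟨hconst _ fun x => (abs_circle_le _).1, hconst _ fun x => (abs_circle_le _).2⟩⟩
      lintegral_sub_le := ⟨c * (2 * Real.pi + 2), by positivity, fun q r hqr hrq => ⟨?_, ?_⟩⟩
      even := circleKernel_neg
      adm_continuous := fun h hh => hh.1.continuous
      adm_integrable := fun h hh =>
        hh.1.continuous.integrableOn_Icc.mono_set Ioc_subset_Icc_self
      adm_bdd := fun h hh => ?_
      conv := fun h hh q => ?_
      weak := fun h hh q => ?_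
      jump := fun h hh _ p₁ p₂ q₁ q₂ hq hq' => hh.integral_cubicForm p₁ p₂ hq hq' rfl rfl
      test_smooth := fun T φ hφ => hφ.1
      test_support := fun T φ hφ => ?_
      test_bdd := fun T φ hφ => hφ.peakon_properties.1
      test_adm := fun T φ hφ => hφ.peakon_properties.2 }
  · refine lintegral_periodic_sub_le (k := fun x => 2 * circleKernel x)
      periodic_two_mul_circleKernel (fun x => (abs_circle_le x).1) (fun x hx y hy => ?_) hqr hrq
    rw [two_mul_circleKernel_of_mem ⟨hx.1.le, hx.2⟩, two_mul_circleKernel_of_mem ⟨hy.1.le, hy.2⟩,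
      ← sub_sub_sub_cancel_right x y Real.pi]
    exact (abs_hyperbolic_sub_le (abs_le.2 ⟨by linarith [hx.1], by linarith [hx.2]⟩)
      (abs_le.2 ⟨by linarith [hy.1], by linarith [hy.2]⟩)).1
  · refine lintegral_periodic_sub_le periodic_circleSlope (fun x => (abs_circle_le x).2)
      (fun x hx y hy => ?_) hqr hrq
    rw [circleSlope_of_mem hx, circleSlope_of_mem hy, ← sub_sub_sub_cancel_right x y Real.pi]
    exact (abs_hyperbolic_sub_le (abs_le.2 ⟨by linarith [hx.1], by linarith [hx.2]⟩)
      (abs_le.2 ⟨by linarith [hy.1], by linarith [hy.2]⟩)).2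
  · obtain ⟨B, hB⟩ := (isCompact_Icc (a := (0 : ℝ)) (b := 2 * Real.pi)).exists_bound_of_continuousOn
      hh.1.continuous.continuousOn
    refine ⟨B, fun x => ?_⟩
    obtain ⟨y, hy, hxy⟩ := hh.2.exists_mem_Ico₀ (by positivity) x
    rw [hxy]
    exact hB y ⟨hy.1, hy.2.le⟩
  · rw [invD2, setIntegral_Ioc_eq_of_periodic (fun y => by
      rw [hh.2, show q - (y + 2 * Real.pi) = q - y - 2 * Real.pi by ring,
        periodic_circleKernel.sub_eq]) (q - 2 * Real.pi), sub_add_cancel,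
      ← intervalIntegral.integral_of_le (by positivity)]
    have := intervalIntegral.integral_comp_sub_left
      (fun y => circleKernel (q - y) * h y) (a := 0) (b := 2 * Real.pi) q
    simp only [sub_sub_cancel, sub_zero] at this
    exact this.symm
  · have h1 : ∫ x in Ioc 0 (2 * Real.pi), 2 * circleKernel (x - q) * deriv h x
        = 2 * invD2 (Ioc 0 (2 * Real.pi)) circleKernel (deriv h) q := by
      rw [invD2, ← integral_const_mul]
      congr 1; ext x
      rw [← circleKernel_neg, neg_sub]; ring
    have hs := sinh_pi_pos.ne'
    have hcont := hh.1.continuous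
    rw [h1, hh.invD2_deriv_eq, setIntegral_Ioc_eq_of_periodic (fun x => by
        rw [hh.2, show x + 2 * Real.pi - q = x - q + 2 * Real.pi by ring, periodic_circleSlope])
        (q - 2 * Real.pi), sub_add_cancel, ← intervalIntegral.integral_neg,
      ← intervalIntegral.integral_const_mul, ← intervalIntegral.integral_const_mul,
      ← intervalIntegral.integral_sub (Continuous.intervalIntegrable (by fun_prop) _ _)
        (Continuous.intervalIntegrable (by fun_prop) _ _), ← intervalIntegral.integral_const_mul,
      ← intervalIntegral.integral_const_mul, intervalIntegral.integral_of_le (by linarith),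
      intervalIntegral.integral_of_le (by linarith)]
    refine setIntegral_congr_fun measurableSet_Ioc fun x hx => ?_
    rw [circleSlope_of_mem' ⟨by linarith [hx.1], by linarith [hx.2]⟩,
      show x - q + Real.pi = -(q - Real.pi - x) by ring, Real.sinh_neg,
      Real.sinh_sub (q - Real.pi) x]
    field_simp
  · obtain ⟨-, -, a, b, ha, hb, hR⟩ := hφ
    refine ⟨a, b, univ, ha, hb, isClosed_univ, ?_, fun t x h0 => ⟨hR t x h0, mem_univ _⟩⟩
    rw [univ_inter]
    exact measure_Ioc_lt_top

/-! ### Fourier coefficients of the peakon on the circle -/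

theorem circle_freqScale : FreqScale (Measure.count : Measure ℤ) (fun n => (n : ℝ)) where
  meas := measurable_of_countable _
  map_neg n := Int.cast_neg n
  integrable r hr := by
    have hb := Real.summable_abs_int_rpow (b := 2 * r) (by linarith)
    refine integrable_count_iff.2 (Summable.norm ?_)
    refine Summable.of_norm_bounded_eventually hb ?_
    filter_upwards [(finite_singleton (0 : ℤ)).compl_mem_cofinite] with n hn
    have hn0 : (n : ℝ) ≠ 0 := by exact_mod_cast hn
    have hpos : (0 : ℝ) < |(n : ℝ)| := abs_pos.2 hn0
    rw [Real.norm_of_nonneg (by positivity), show -(2 * r) = 2 * -r by ring, Real.rpow_mul hpos.le,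
      Real.rpow_two, sq_abs]
    exact Real.rpow_le_rpow_of_nonpos (by positivity) (by linarith) (by linarith)
  -- The interval $[R,2R]$ contains more than $R-1$ integers, and $R-1\ge R/2$ for $R\ge2$.
  dyadic := ⟨1 / 2, by norm_num, fun R hR => by
    have hsub : ((Finset.Icc ⌈R⌉ ⌊2 * R⌋ : Finset ℤ) : Set ℤ)
        ⊆ {n : ℤ | R ≤ (n : ℝ) ∧ (n : ℝ) ≤ 2 * R} := fun n hn => by
      rw [Finset.mem_coe, Finset.mem_Icc] at hn
      exact ⟨Int.ceil_le.1 hn.1, Int.le_floor.1 hn.2⟩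
    refine le_trans ?_ (measure_mono hsub)
    rw [Measure.count_apply_finset, ← ENNReal.ofReal_natCast, Int.card_Icc]
    refine ENNReal.ofReal_le_ofReal ?_
    have h1 := Int.ceil_lt_add_one R
    have h2 := Int.lt_floor_add_one (2 * R)
    have h3 : ((⌊2 * R⌋ + 1 - ⌈R⌉ : ℤ) : ℝ) ≤ ((⌊2 * R⌋ + 1 - ⌈R⌉).toNat : ℝ) := by
      exact_mod_cast Int.self_le_toNat _
    push_cast at h3
    linarith⟩
  eval_zero f _ h0 := by
    rw [Measure.ae_count_iff] at h0
    simpa using h0 0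

/-- From crest to crest $e^{-inx}\cosh(x-q-\pi)$ has an explicit primitive and integrates to
$2\sinh\pi/(1+n^2)$ times the phase. Division by $2\pi\sinh\pi$ leaves $\kappa=1/\pi$. -/
theorem integral_exp_mul_circleKernel (q : ℝ) (n : ℤ) :
    (2 * Real.pi : ℂ)⁻¹ * ∫ x in Ioc 0 (2 * Real.pi),
        Complex.exp (-(Complex.I * n * x)) * ((2 * circleKernel (x - q) : ℝ) : ℂ)
      = peakonSymbol (1 / Real.pi) (fun n : ℤ => (n : ℝ)) q n := by
  have hpi := Real.pi_pos
  have hs := sinh_pi_pos.ne'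
  have hn1 : (1 + (n : ℂ) ^ 2) ≠ 0 := by
    have : (1 + (n : ℝ) ^ 2 : ℝ) ≠ 0 := by positivity
    exact_mod_cast this
  have hper : ∀ x : ℝ, Complex.exp (-(Complex.I * n * ((x + 2 * Real.pi : ℝ) : ℂ)))
      = Complex.exp (-(Complex.I * n * x)) := fun x => by
    have := Complex.exp_periodic.int_mul (-n) (-(Complex.I * n * x))
    rw [← this]
    congr 1
    push_cast; ring
  have hprim : ∫ x in (q)..(q + 2 * Real.pi),
      Complex.exp (-(Complex.I * n * x)) * ((Real.cosh (x - q - Real.pi) : ℝ) : ℂ)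
      = 2 * Real.sinh Real.pi / (1 + (n : ℂ) ^ 2) * Complex.exp (-(Complex.I * n * q)) := by
    have hd : ∀ x : ℝ, HasDerivAt (fun x : ℝ => Complex.exp (-(Complex.I * n * x)) *
        (((Real.sinh (x - q - Real.pi) : ℝ) : ℂ)
          + Complex.I * n * ((Real.cosh (x - q - Real.pi) : ℝ) : ℂ)) / (1 + (n : ℂ) ^ 2))
        (Complex.exp (-(Complex.I * n * x)) * ((Real.cosh (x - q - Real.pi) : ℝ) : ℂ)) x := by
      intro x
      have e1 : HasDerivAt (fun x : ℝ => Complex.exp (-(Complex.I * n * x)))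
          (Complex.exp (-(Complex.I * n * x)) * (-(Complex.I * n))) x := by
        have := ((Complex.ofRealCLM.hasDerivAt (x := x)).const_mul (Complex.I * n)).neg.cexp
        simpa using this
      have e2 : HasDerivAt (fun x : ℝ => ((Real.sinh (x - q - Real.pi) : ℝ) : ℂ))
          ((Real.cosh (x - q - Real.pi) : ℝ) : ℂ) x :=
        ((((hasDerivAt_id x).sub_const q).sub_const Real.pi).sinh.congr_deriv (by simp)).ofReal_comp
      have e3 : HasDerivAt (fun x : ℝ => ((Real.cosh (x - q - Real.pi) : ℝ) : ℂ))
          ((Real.sinh (x - q - Real.pi) : ℝ) : ℂ) x :=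
        ((((hasDerivAt_id x).sub_const q).sub_const Real.pi).cosh.congr_deriv (by simp)).ofReal_comp
      refine ((e1.mul (e2.add (e3.const_mul (Complex.I * n)))).div_const _).congr_deriv ?_
      rw [div_eq_iff hn1, Pi.add_apply]
      ring_nf
      rw [Complex.I_sq]
      ring
    rw [intervalIntegral.integral_eq_sub_of_hasDerivAt (fun x _ => hd x)
      (Continuous.intervalIntegrable (by fun_prop) _ _), hper,
      show q + 2 * Real.pi - q - Real.pi = Real.pi by ring, show q - q - Real.pi = -Real.pi by ring,
      Real.sinh_neg, Real.cosh_neg]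
    push_cast
    field_simp
    ring
  have hshift : ∫ x in Ioc 0 (2 * Real.pi),
        Complex.exp (-(Complex.I * n * x)) * ((2 * circleKernel (x - q) : ℝ) : ℂ)
      = ∫ x in (q)..(q + 2 * Real.pi),
        Complex.exp (-(Complex.I * n * x)) * ((2 * circleKernel (x - q) : ℝ) : ℂ) := by
    have hf : Function.Periodic (fun x : ℝ =>
        Complex.exp (-(Complex.I * n * x)) * ((2 * circleKernel (x - q) : ℝ) : ℂ)) (2 * Real.pi) :=
      fun x => by
        simp only []
        rw [hper, show x + 2 * Real.pi - q = x - q + 2 * Real.pi by ring, periodic_circleKernel]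
    rw [← intervalIntegral.integral_of_le (by positivity), ← hf.intervalIntegral_add_eq 0 q,
      zero_add]
  have hval : ∫ x in (q)..(q + 2 * Real.pi),
        Complex.exp (-(Complex.I * n * x)) * ((2 * circleKernel (x - q) : ℝ) : ℂ)
      = ((Real.sinh Real.pi : ℝ) : ℂ)⁻¹ * ∫ x in (q)..(q + 2 * Real.pi),
        Complex.exp (-(Complex.I * n * x)) * ((Real.cosh (x - q - Real.pi) : ℝ) : ℂ) := by
    rw [← intervalIntegral.integral_const_mul]
    refine intervalIntegral.integral_congr fun x hx => ?_
    rw [uIcc_of_le (by linarith)] at hx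
    rw [two_mul_circleKernel_of_mem ⟨by linarith [hx.1], by linarith [hx.2]⟩]
    push_cast
    field_simp
  have hs' : Complex.sinh Real.pi ≠ 0 := by exact_mod_cast hs
  have hpi' : (Real.pi : ℂ) ≠ 0 := by exact_mod_cast hpi.ne'
  rw [hshift, hval, hprim, peakonSymbol]
  push_cast
  rw [show Complex.I * n * q = Complex.I * q * n by ring]
  field_simp

theorem IsCircleTest.mono {T T' : ℝ} (hT : T' ≤ T) {φ : ℝ → ℝ → ℝ} (hφ : IsCircleTest T' φ) :
    IsCircleTest T φ ∧ ∃ a b : ℝ, 0 < a ∧ b < T' ∧ ∀ t x, φ t x ≠ 0 → t ∈ Icc a b := by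
  obtain ⟨h1, h2, a, b, ha, hb, h⟩ := hφ
  exact ⟨⟨h1, h2, a, b, ha, hb.trans_le hT, h⟩, a, b, ha, hb, h⟩

theorem circle_admitsPeakons {s : ℝ} (hs : s < 3 / 2) :
    AdmitsPeakons (hj := measurable_of_countable _) circle_freqScale hs (1 / Real.pi)
      (Real.cosh Real.pi / Real.sinh Real.pi) (CircleSolution s) where
  continuousOn _ _ h := h.1
  mono T T' U hT h := by
    obtain ⟨hc, u, v, hpu, hpv, hw, hae⟩ := h
    exact ⟨hc.mono (Icc_subset_Icc_right hT), u, v, hpu, hpv,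
      hw.mono measurableSet_Ioc hT fun φ hφ => hφ.mono hT,
      ae_mono (Measure.restrict_mono (Ioo_subset_Ioo_right hT) le_rfl) hae⟩
  flow T p₁ p₂ q₁ q₂ U hT hflow hc hU := by
    refine ⟨hc, _, _, fun t => periodic_pairField periodic_two_mul_circleKernel _ _ _ _,
      fun t => periodic_pairField periodic_circleSlope _ _ _ _,
      circle_peakonGeometry.isWeakNovikov hT hflow, ?_⟩
    refine (ae_restrict_iff' measurableSet_Ioo).2 (Eventually.of_forall fun t ht n => ?_)
    have hrep := coeFn_peakonPair (hj := measurable_of_countable _) circle_freqScale hs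
      (κ := 1 / Real.pi) (p₁ t) (p₂ t) (q₁ t) (q₂ t)
    rw [Measure.ae_count_iff] at hrep
    have hint : ∀ q : ℝ, IntegrableOn (fun x : ℝ => Complex.exp (-(Complex.I * n * x)) *
        ((2 * circleKernel (x - q) : ℝ) : ℂ)) (Ioc 0 (2 * Real.pi)) := fun q => by
      refine Integrable.bdd_mul (c := 1) (Integrable.ofReal ?_)
        (Continuous.aestronglyMeasurable (by fun_prop)) (Eventually.of_forall fun x => ?_)
      · refine Measure.integrableOn_of_bounded (M := Real.cosh Real.pi / Real.sinh Real.pi)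
          measure_Ioc_lt_top.ne ?_ (Eventually.of_forall fun x => (abs_circle_le _).1)
        exact ((measurable_circleKernel.comp (measurable_id.sub_const q)).const_mul
          2).aestronglyMeasurable
      · rw [Complex.norm_exp]; simp
    rw [hU t ht, hrep n, ← integral_exp_mul_circleKernel, ← integral_exp_mul_circleKernel (q₂ t),
      mul_left_comm, mul_left_comm (p₂ t : ℂ), ← integral_const_mul (p₁ t : ℂ),
      ← integral_const_mul (p₂ t : ℂ),
      ← mul_add, ← integral_add ((hint _).const_mul _) ((hint _).const_mul _)]
    congr 2; ext x
    simp only [pairField]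
    push_cast; ring

end

/-! ### The theorem on the line and on the circle -/

theorem mainTheorem2 (s : ℝ) (hs : s < 3 / 2) :
    (¬ WellPosed (LineSolution s) ∧
      (5 / 4 < s → NormInflation (LineSolution s) ∧
        ∀ T > 0, LineSolution s T (fun _ => 0) ∧
          ¬ SolutionMapContinuousAt (LineSolution s) T (fun _ => 0)) ∧
      (s < 5 / 4 → ¬ UniqueSolutions (LineSolution s)) ∧
      (s = 5 / 4 → ¬ HasContinuousSolutionMap (LineSolution s) ∨
        ¬ UniqueSolutions (LineSolution s))) ∧
    (¬ WellPosed (CircleSolution s) ∧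
      (5 / 4 < s → NormInflation (CircleSolution s) ∧
        ∀ T > 0, CircleSolution s T (fun _ => 0) ∧
          ¬ SolutionMapContinuousAt (CircleSolution s) T (fun _ => 0)) ∧
      (s < 5 / 4 → ¬ UniqueSolutions (CircleSolution s)) ∧
      (s = 5 / 4 → ¬ HasContinuousSolutionMap (CircleSolution s) ∨
        ¬ UniqueSolutions (CircleSolution s))) := by
  exact ⟨ill_posed line_freqScale hs two_ne_zero le_rfl (line_admitsPeakons hs),
    ill_posed circle_freqScale hs (one_div_ne_zero Real.pi_ne_zero) one_le_coth_pi
      (circle_admitsPeakons hs)⟩
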